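/- All algebras are associative algebras over $\mathbb C$ with non-degenerate product (a unit is not required), and $M(X)$ is the multiplier algebra of $X$. For a multiplier Hopf algebra $(X,\Delta_X)$ let $T_1^X,T_2^X$ be the bijections of $X\otimes X$ given by $T_1^X(x\otimes x')=\Delta_X(x)(1\otimes x')$ and $T_2^X(x\otimes x')=(x\otimes 1)\Delta_X(x')$. Let $A$ and $B$ be regular multiplier Hopf algebras. Let $B$ be a right $A$-module algebra: there is a right action $\triangleleft$ of $A$ on $B$ which is unital (the elements $b\triangleleft a$ span $B$) and satisfies $(bb')\triangleleft a=\sum (b\triangleleft a_{(1)})(b'\triangleleft a_{(2)})$. Let $R:B\otimes A\to A\otimes B$, $R(b\otimes a)=\sum a_{(1)}\otimes (b\triangleleft a_{(2)})$, be its twist map. Let $AB=A\# B$ be the smash product, i.e. the space $A\otimes B$ (write $ab$ for $a\otimes b$) with the product $(ab)(a'b')=\sum a a'_{(1)}\,(b\triangleleft a'_{(2)})b'$; the algebras $A$ and $B$ embed in $M(AB)$, and $ba=R(b\otimes a)$. Let $A$ be a left $B$-comodule coalgebra. That is, there is an injective linear map $\Gamma:A\to M_0(B\otimes A)$, where $M_0(B\otimes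 A)$ is the completion of $B\otimes A$ as a $B$-bimodule (multiplication in the first factor), with $(\iota\otimes\Gamma)\Gamma=(\Delta_B\otimes\iota)\Gamma$. Moreover, with the cotwist map $T:A\otimes B\to B\otimes A$, $T(a\otimes b)=\Gamma(a)(b\otimes 1)$, the elements $((\iota\otimes T)(\Delta_A(a)\otimes b))(1\otimes 1\otimes a')$ and $(1\otimes 1\otimes a')((\iota\otimes T)(\Delta_A(a)\otimes b))$ lie in $A\otimes B\otimes A$ for all $a,a'\in A$, $b\in B$, and $$(\iota_B\otimes\Delta_A)T=(T\otimes\iota_A)(\iota_A\otimes T)(\Delta_A\otimes\iota_B)\quad\text{on } A\otimes B$$ (read after multiplication with $1\otimes 1\otimes a'$ on the left and on the right). Then $R$ and $T$ are bijective, and there is a unique linear map $\Delta_\#:AB\to M(AB\otimes AB)$ with $$\Delta_\#(ab)=\sum (a_{(1)}\otimes 1)\,\Gamma(a_{(2)})\,\Delta_B(b),$$ that is, $(p\otimes 1)\Delta_\#(ab)(q\otimes q')=\sum (pa_{(1)}\otimes 1)\,\Gamma(a_{(2)})\,\bigl(\Delta_B(b)(q\otimes q')\bigr)$ for all $a,p\in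 A$ and $b,q,q'\in B$. There are unique linear maps $T_1^\#,T_2^\#$ from $AB\otimes AB$ to itself with $$T_1^\#(x\otimes x')=\Delta_\#(x)(1\otimes x'),\qquad T_2^\#(x\otimes x')=(x\otimes 1)\Delta_\#(x')\qquad (x,x'\in AB).$$ Identify $AB\otimes AB$ with $A\otimes B\otimes A\otimes B$ through $ab\leftrightarrow a\otimes b$ and use leg numbering notation. Then $$\begin{aligned} T_1^\# &= (T^{-1})_{12}\,(T_1^A)_{23}\,T_{12}\,R_{34}\,(T_1^B)_{23}\,(R^{-1})_{34},\\ T_2^\# &= (T^{-1})_{34}\,(T_2^B)_{23}\,T_{34}\,R_{12}\,(T_2^A)_{23}\,(R^{-1})_{12}. \end{aligned}$$ In particular $T_1^\#$ and $T_2^\#$ are bijective. (No compatibility between the action and the coaction is assumed.) -/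

import Mathlib

open scoped TensorProduct

noncomputable section

namespace Bicross

section Multiplier

variable {X Y : Type*}
  [NonUnitalRing X] [Module ℂ X] [IsScalarTower ℂ X X] [SMulCommClass ℂ X X]
  [NonUnitalRing Y] [Module ℂ Y] [IsScalarTower ℂ Y Y] [SMulCommClass ℂ Y Y]

variable (X) in
/-- The multiplier algebra `M(X)` of an algebra `X` (with non-degenerate product): the pairs
`m = (L, R)` of linear maps `X → X` (`L x = m x` and `R x = x m`) such that
`(x m) y = x (m y)`.  The second component lives in the opposite of the endomorphism algebra,
so that the product is the one of multipliers: `(m n) x = m (n x)` and `x (m n) = (x m) n`. -/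
def MultiplierAlgebra : Subalgebra ℂ (Module.End ℂ X × (Module.End ℂ X)ᵐᵒᵖ) where
  carrier := {m | ∀ x y : X, m.2.unop x * y = x * m.1 y}
  mul_mem' := by
    intro m n hm hn x y
    simp only [Set.mem_ofPred_eq] at hm hn
    simp [hm, hn]
  add_mem' := by
    intro m n hm hn x y
    simp only [Set.mem_ofPred_eq] at hm hn
    simp [hm, hn, add_mul, mul_add]
  algebraMap_mem' := by
    intro r x y
    simp [smul_mul_assoc, mul_smul_comm]

/-- The product `m x` of a multiplier `m` with an element `x`. -/
def lmul : MultiplierAlgebra X →ₗ[ℂ] X →ₗ[ℂ] X where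
  toFun m := m.1.1
  map_add' _ _ := rfl
  map_smul' _ _ := rfl

/-- The product `x m` of an element `x` with a multiplier `m`. -/
def rmul : MultiplierAlgebra X →ₗ[ℂ] X →ₗ[ℂ] X where
  toFun m := m.1.2.unop
  map_add' _ _ := rfl
  map_smul' _ _ := rfl

theorem rmul_mul (m : MultiplierAlgebra X) (x y : X) : rmul m x * y = x * lmul m y := m.2 x y

theorem multiplier_ext {m n : MultiplierAlgebra X} (hl : ∀ x, lmul m x = lmul n x)
    (hr : ∀ x, rmul m x = rmul n x) : m = n :=
  Subtype.ext (Prod.ext (LinearMap.ext hl) (MulOpposite.unop_injective (LinearMap.ext hr)))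

/-- The multiplier given by two linear maps. -/
def mkMultiplier (L R : X →ₗ[ℂ] X) (h : ∀ x y, R x * y = x * L y) : MultiplierAlgebra X :=
  ⟨(L, MulOpposite.op R), h⟩

@[simp] theorem lmul_mk (L R : X →ₗ[ℂ] X) (h : ∀ x y, R x * y = x * L y) :
    lmul (mkMultiplier L R h) = L := rfl

@[simp] theorem rmul_mk (L R : X →ₗ[ℂ] X) (h : ∀ x y, R x * y = x * L y) :
    rmul (mkMultiplier L R h) = R := rfl

@[simp] theorem lmul_one (x : X) : lmul (1 : MultiplierAlgebra X) x = x := rfl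

@[simp] theorem rmul_one (x : X) : rmul (1 : MultiplierAlgebra X) x = x := rfl

@[simp] theorem lmul_mul (m n : MultiplierAlgebra X) (x : X) :
    lmul (m * n) x = lmul m (lmul n x) := rfl

@[simp] theorem rmul_mul' (m n : MultiplierAlgebra X) (x : X) :
    rmul (m * n) x = rmul n (rmul m x) := rfl

/-- The canonical map `X → M(X)`. -/
def toMultiplier : X →ₗ[ℂ] MultiplierAlgebra X where
  toFun x := mkMultiplier (LinearMap.mulLeft ℂ x) (LinearMap.mulRight ℂ x)
    (fun y z => by simp [mul_assoc])
  map_add' x y := multiplier_ext (fun z => add_mul x y z) (fun z => mul_add z x y)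
  map_smul' r x := multiplier_ext (fun z => smul_mul_assoc r x z)
    (fun z => mul_smul_comm r z x)

@[simp] theorem lmul_toMultiplier (x y : X) : lmul (toMultiplier x) y = x * y := rfl

@[simp] theorem rmul_toMultiplier (x y : X) : rmul (toMultiplier x) y = y * x := rfl

theorem map_rmul_mul (m : MultiplierAlgebra X) (n : MultiplierAlgebra Y) (x y : X ⊗[ℂ] Y) :
    TensorProduct.map (rmul m) (rmul n) x * y = x * TensorProduct.map (lmul m) (lmul n) y := by
  induction x with
  | zero => simp
  | add x₁ x₂ h₁ h₂ => simp_all [add_mul]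
  | tmul x x' =>
    induction y with
    | zero => simp
    | add y₁ y₂ h₁ h₂ => simp_all [mul_add]
    | tmul y y' => simp [rmul_mul]

/-- The multiplier `m ⊗ n` of `X ⊗ Y`, for multipliers `m` of `X` and `n` of `Y`. -/
def tmulMultiplier :
    MultiplierAlgebra X →ₗ[ℂ] MultiplierAlgebra Y →ₗ[ℂ] MultiplierAlgebra (X ⊗[ℂ] Y) :=
  LinearMap.mk₂ ℂ
    (fun m n => mkMultiplier (TensorProduct.map (lmul m) (lmul n))
      (TensorProduct.map (rmul m) (rmul n)) (map_rmul_mul m n))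
    (fun m m' n => multiplier_ext (fun x => by simp [TensorProduct.map_add_left])
      (fun x => by simp [TensorProduct.map_add_left]))
    (fun r m n => multiplier_ext (fun x => by simp [TensorProduct.map_smul_left])
      (fun x => by simp [TensorProduct.map_smul_left]))
    (fun m n n' => multiplier_ext (fun x => by simp [TensorProduct.map_add_right])
      (fun x => by simp [TensorProduct.map_add_right]))
    (fun r m n => multiplier_ext (fun x => by simp [TensorProduct.map_smul_right])
      (fun x => by simp [TensorProduct.map_smul_right]))

@[simp] theorem lmul_tmulMultiplier (m : MultiplierAlgebra X) (n : MultiplierAlgebra Y) :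
    lmul (tmulMultiplier m n) = TensorProduct.map (lmul m) (lmul n) := rfl

@[simp] theorem rmul_tmulMultiplier (m : MultiplierAlgebra X) (n : MultiplierAlgebra Y) :
    rmul (tmulMultiplier m n) = TensorProduct.map (rmul m) (rmul n) := rfl

theorem comm_mul (x y : X ⊗[ℂ] X) :
    TensorProduct.comm ℂ X X (x * y) = TensorProduct.comm ℂ X X x * TensorProduct.comm ℂ X X y := by
  induction x with
  | zero => simp
  | add x₁ x₂ h₁ h₂ => simp_all [add_mul]
  | tmul x x' =>
    induction y with
    | zero => simp
    | add y₁ y₂ h₁ h₂ => simp_all [mul_add]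
    | tmul y y' => simp

/-- The multiplier `σ(m)` of `X ⊗ X`, where `m` is a multiplier of `X ⊗ X` and `σ` is the
extension to multipliers of the flip `x ⊗ y ↦ y ⊗ x`. -/
def flipMultiplier (m : MultiplierAlgebra (X ⊗[ℂ] X)) : MultiplierAlgebra (X ⊗[ℂ] X) :=
  mkMultiplier
    ((TensorProduct.comm ℂ X X).toLinearMap ∘ₗ lmul m ∘ₗ (TensorProduct.comm ℂ X X).toLinearMap)
    ((TensorProduct.comm ℂ X X).toLinearMap ∘ₗ rmul m ∘ₗ (TensorProduct.comm ℂ X X).toLinearMap)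
    (fun x y => by
      have h := rmul_mul m (TensorProduct.comm ℂ X X x) (TensorProduct.comm ℂ X X y)
      have h' := congrArg (TensorProduct.comm ℂ X X) h
      simp only [comm_mul, TensorProduct.comm_comm] at h'
      simpa using h')

end Multiplier

section Legs

variable {X Y Y' Z Z' W : Type*} [AddCommGroup X] [Module ℂ X] [AddCommGroup Y] [Module ℂ Y]
  [AddCommGroup Y'] [Module ℂ Y'] [AddCommGroup Z] [Module ℂ Z] [AddCommGroup Z'] [Module ℂ Z']
  [AddCommGroup W] [Module ℂ W]

/-- Leg numbering: `f₁₂`, the map `f` on the first two factors of a fourfold tensor product. -/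
def leg12 (f : X ⊗[ℂ] Y →ₗ[ℂ] Y' ⊗[ℂ] Z') :
    (X ⊗[ℂ] Y) ⊗[ℂ] (Z ⊗[ℂ] W) →ₗ[ℂ] (Y' ⊗[ℂ] Z') ⊗[ℂ] (Z ⊗[ℂ] W) :=
  TensorProduct.map f LinearMap.id

/-- Leg numbering: `f₃₄`, the map `f` on the last two factors of a fourfold tensor product. -/
def leg34 (f : Z ⊗[ℂ] W →ₗ[ℂ] Y' ⊗[ℂ] Z') :
    (X ⊗[ℂ] Y) ⊗[ℂ] (Z ⊗[ℂ] W) →ₗ[ℂ] (X ⊗[ℂ] Y) ⊗[ℂ] (Y' ⊗[ℂ] Z') :=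
  TensorProduct.map LinearMap.id f

/-- The identification `(X ⊗ Y) ⊗ (Z ⊗ W) = X ⊗ ((Y ⊗ Z) ⊗ W)`. -/
def middle (X Y Z W : Type*) [AddCommGroup X] [Module ℂ X] [AddCommGroup Y] [Module ℂ Y]
    [AddCommGroup Z] [Module ℂ Z] [AddCommGroup W] [Module ℂ W] :
    (X ⊗[ℂ] Y) ⊗[ℂ] (Z ⊗[ℂ] W) ≃ₗ[ℂ] X ⊗[ℂ] ((Y ⊗[ℂ] Z) ⊗[ℂ] W) :=
  (TensorProduct.assoc ℂ X Y (Z ⊗[ℂ] W)).trans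
    (TensorProduct.congr (LinearEquiv.refl ℂ X) (TensorProduct.assoc ℂ Y Z W).symm)

@[simp] theorem middle_tmul (x : X) (y : Y) (z : Z) (w : W) :
    middle X Y Z W ((x ⊗ₜ y) ⊗ₜ (z ⊗ₜ w)) = x ⊗ₜ ((y ⊗ₜ z) ⊗ₜ w) := rfl

/-- Leg numbering: `f₂₃`, the map `f` on the two middle factors of a fourfold tensor product. -/
def leg23 (f : Y ⊗[ℂ] Z →ₗ[ℂ] Y' ⊗[ℂ] Z') :
    (X ⊗[ℂ] Y) ⊗[ℂ] (Z ⊗[ℂ] W) →ₗ[ℂ] (X ⊗[ℂ] Y') ⊗[ℂ] (Z' ⊗[ℂ] W) :=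
  (middle X Y' Z' W).symm.toLinearMap ∘ₗ
    TensorProduct.map LinearMap.id (TensorProduct.map f LinearMap.id) ∘ₗ
      (middle X Y Z W).toLinearMap

end Legs

section Hopf

variable (A B : Type*)
  [NonUnitalRing A] [Module ℂ A] [IsScalarTower ℂ A A] [SMulCommClass ℂ A A]
  [NonUnitalRing B] [Module ℂ B] [IsScalarTower ℂ B B] [SMulCommClass ℂ B B]

/-- A multiplier Hopf algebra structure on the algebra `A`: the product is non-degenerate, the
coproduct `Δ` is a homomorphism from `A` to `M(A ⊗ A)`, the elements `Δ(a)(1 ⊗ b)` and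
`(a ⊗ 1)Δ(b)` of `M(A ⊗ A)` lie in `A ⊗ A`, the coproduct is coassociative, and the canonical
maps `T₁(a ⊗ b) = Δ(a)(1 ⊗ b)` and `T₂(a ⊗ b) = (a ⊗ 1)Δ(b)` are bijections of `A ⊗ A`.
The maps `T₁`, `T₂` are determined by `Δ`. -/
structure MultiplierHopfAlgebra where
  eq_zero_of_mul_left : ∀ a : A, (∀ x, x * a = 0) → a = 0
  eq_zero_of_mul_right : ∀ a : A, (∀ x, a * x = 0) → a = 0
  comul : A →ₙₐ[ℂ] MultiplierAlgebra (A ⊗[ℂ] A)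
  T₁ : (A ⊗[ℂ] A) ≃ₗ[ℂ] (A ⊗[ℂ] A)
  T₂ : (A ⊗[ℂ] A) ≃ₗ[ℂ] (A ⊗[ℂ] A)
  T₁_spec : ∀ a b : A,
    toMultiplier (T₁ (a ⊗ₜ b)) = comul a * tmulMultiplier 1 (toMultiplier b)
  T₂_spec : ∀ a b : A,
    toMultiplier (T₂ (a ⊗ₜ b)) = tmulMultiplier (toMultiplier a) 1 * comul b
  /-- `(a ⊗ 1 ⊗ 1)((Δ ⊗ ι)(Δ(b)(1 ⊗ c))) = ((ι ⊗ Δ)((a ⊗ 1)Δ(b)))(1 ⊗ 1 ⊗ c)`. -/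
  coassoc : ∀ a b c : A,
    TensorProduct.map T₂.toLinearMap LinearMap.id
        ((TensorProduct.assoc ℂ A A A).symm (a ⊗ₜ T₁ (b ⊗ₜ c))) =
      (TensorProduct.assoc ℂ A A A).symm
        (TensorProduct.map LinearMap.id T₁.toLinearMap
          (TensorProduct.assoc ℂ A A A (T₂ (a ⊗ₜ b) ⊗ₜ c)))

/-- A regular multiplier Hopf algebra: also the opposite coproduct makes `A` into a multiplier
Hopf algebra. -/
structure RegularMultiplierHopfAlgebra extends MultiplierHopfAlgebra A where
  opp : MultiplierHopfAlgebra A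
  opp_comul : ∀ a : A, opp.comul a = flipMultiplier (comul a)

variable {A} in
/-- The linear map `a ⊗ b ↦ (1 ⊗ a)Δ(b)` from `A ⊗ A` to itself. -/
def RegularMultiplierHopfAlgebra.T₄ (H : RegularMultiplierHopfAlgebra A) :
    A ⊗[ℂ] A →ₗ[ℂ] A ⊗[ℂ] A :=
  (TensorProduct.comm ℂ A A).toLinearMap ∘ₗ H.opp.T₂.toLinearMap

variable {A} in
/-- A right `A`-module algebra `B`: a unital right action of `A` on `B`
(`act b a` stands for `b ◁ a`) such that `(b b') ◁ a = ∑ (b ◁ a₁)(b' ◁ a₂)`.  In the last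
formula `a₁` and `a₂` are covered by writing the elements of `B` as `b ◁ e` and `b' ◁ e'`:
then the right hand side is the image of `(e ⊗ e')Δ(a)` in `A ⊗ A` under
`x ⊗ y ↦ (b ◁ x)(b' ◁ y)`. -/
structure RightModuleAlgebra (HA : RegularMultiplierHopfAlgebra A) where
  act : B →ₗ[ℂ] A →ₗ[ℂ] B
  act_mul : ∀ (b : B) (a a' : A), act b (a * a') = act (act b a) a'
  unital : Submodule.span ℂ (Set.range fun p : B × A => act p.1 p.2) = ⊤
  mul_act : ∀ (b b' : B) (e e' a : A),
    act (act b e * act b' e') a =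
      LinearMap.mul' ℂ B
        (TensorProduct.map (act b) (act b') (rmul (HA.comul a) (e ⊗ₜ e')))

variable (V : Type*) [AddCommGroup V] [Module ℂ V]

/-- The completed module `M₀(B ⊗ V)` of the `B`-bimodule `B ⊗ V` (with `B` acting by
multiplication in the first factor): an element `y` is a pair of linear maps
`b ↦ y(b ⊗ 1)` and `b ↦ (b ⊗ 1)y` from `B` to `B ⊗ V` such that
`(b ⊗ 1)(y(b' ⊗ 1)) = ((b ⊗ 1)y)(b' ⊗ 1)`. -/
def CompletedModule : Submodule ℂ ((B →ₗ[ℂ] B ⊗[ℂ] V) × (B →ₗ[ℂ] B ⊗[ℂ] V)) where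
  carrier := {y | ∀ b b' : B,
    TensorProduct.map (LinearMap.mulLeft ℂ b) LinearMap.id (y.1 b') =
      TensorProduct.map (LinearMap.mulRight ℂ b') LinearMap.id (y.2 b)}
  add_mem' := by
    intro y z hy hz b b'
    simp only [Set.mem_ofPred_eq] at hy hz
    simp [hy, hz]
  zero_mem' := by
    intro b b'
    simp
  smul_mem' := by
    intro r y hy b b'
    simp only [Set.mem_ofPred_eq] at hy
    simp [hy]

variable {B} {V} in
/-- The cotwist map `T : V ⊗ B → B ⊗ V`, `T(v ⊗ b) = Γ(v)(b ⊗ 1)`, of a linear map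
`Γ : V → M₀(B ⊗ V)`. -/
def cotwist (Γ : V →ₗ[ℂ] CompletedModule B V) : V ⊗[ℂ] B →ₗ[ℂ] B ⊗[ℂ] V :=
  TensorProduct.lift
    (LinearMap.fst ℂ _ (B →ₗ[ℂ] B ⊗[ℂ] V) ∘ₗ (CompletedModule B V).subtype ∘ₗ Γ)

variable {B} in
/-- A left coaction of `B` on the vector space `V`: an injective linear map
`Γ : V → M₀(B ⊗ V)` such that `(ι ⊗ Γ)Γ = (Δ ⊗ ι)Γ`.  The last equation holds in
`M₀(B ⊗ B ⊗ V)`; it is stated after multiplication from the right with the elements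
`Δ(p)w`, which span `B ⊗ B` (where `p ∈ B`, `w ∈ B ⊗ B`): the left hand side becomes
`(ι ⊗ Γ)(Γ(v)) (Δ(p)w ⊗ 1)` and the right hand side `(Δ ⊗ ι)(Γ(v)(p ⊗ 1)) (w ⊗ 1)`. -/
structure LeftCoaction (HB : RegularMultiplierHopfAlgebra B) where
  Γ : V →ₗ[ℂ] CompletedModule B V
  injective : Function.Injective Γ
  coassoc : ∀ (v : V) (p : B) (w : B ⊗[ℂ] B),
    TensorProduct.map LinearMap.id (cotwist Γ)
        (TensorProduct.assoc ℂ B V B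
          (TensorProduct.map (cotwist Γ) LinearMap.id
            ((TensorProduct.assoc ℂ V B B).symm (v ⊗ₜ lmul (HB.comul p) w)))) =
      TensorProduct.assoc ℂ B B V
        (TensorProduct.map
          (LinearMap.applyₗ w ∘ₗ lmul ∘ₗ (HB.comul : B →ₗ[ℂ] MultiplierAlgebra (B ⊗[ℂ] B)))
          LinearMap.id (cotwist Γ (v ⊗ₜ p)))

end Hopf
section Smash

variable {A B V : Type*}
  [NonUnitalRing A] [Module ℂ A] [IsScalarTower ℂ A A] [SMulCommClass ℂ A A]
  [NonUnitalRing B] [Module ℂ B] [IsScalarTower ℂ B B] [SMulCommClass ℂ B B]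
  [AddCommGroup V] [Module ℂ V]

open TensorProduct (map)
open LinearMap (mulLeft mulRight)

theorem eq_zero_of_map_left {ι : Type*} (f : ι → A →ₗ[ℂ] A)
    (hf : ∀ a, (∀ i, f i a = 0) → a = 0) (z : A ⊗[ℂ] V)
    (hz : ∀ i, map (f i) LinearMap.id z = 0) : z = 0 := by
  classical
  let b := Module.Basis.ofVectorSpace ℂ V
  apply (TensorProduct.equivFinsuppOfBasisRight (M := A) b).injective
  rw [map_zero]
  ext j
  apply hf
  intro i
  have key : ∀ z : A ⊗[ℂ] V, TensorProduct.equivFinsuppOfBasisRight b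
      (map (f i) LinearMap.id z) j = f i (TensorProduct.equivFinsuppOfBasisRight b z j) := by
    intro z
    induction z with
    | zero => simp
    | add x y hx hy => simp [hx, hy]
    | tmul x y => simp
  rw [← key, hz i]
  simp

theorem eq_zero_of_map_right {ι : Type*} (f : ι → A →ₗ[ℂ] A)
    (hf : ∀ a, (∀ i, f i a = 0) → a = 0) (z : V ⊗[ℂ] A)
    (hz : ∀ i, map LinearMap.id (f i) z = 0) : z = 0 := by
  apply (TensorProduct.comm ℂ V A).injective
  rw [map_zero]
  apply eq_zero_of_map_left f hf
  intro i
  rw [TensorProduct.map_comm, hz i, map_zero]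

namespace MultiplierHopfAlgebra

theorem cancel_left (H : MultiplierHopfAlgebra A) {z w : A ⊗[ℂ] V}
    (h : ∀ p : A, map (mulLeft ℂ p) LinearMap.id z = map (mulLeft ℂ p) LinearMap.id w) :
    z = w := by
  rw [← sub_eq_zero]
  apply eq_zero_of_map_left (fun p : A => mulLeft ℂ p)
  · exact H.eq_zero_of_mul_left
  · intro p
    rw [map_sub, h p, sub_self]

theorem cancel_right (H : MultiplierHopfAlgebra A) {z w : V ⊗[ℂ] A}
    (h : ∀ p : A, map LinearMap.id (mulRight ℂ p) z = map LinearMap.id (mulRight ℂ p) w) :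
    z = w := by
  rw [← sub_eq_zero]
  apply eq_zero_of_map_right (fun p : A => mulRight ℂ p)
  · exact H.eq_zero_of_mul_right
  · intro p
    rw [map_sub, h p, sub_self]

theorem tmul_mul_eq (x y : A) (z : A ⊗[ℂ] A) :
    (x ⊗ₜ[ℂ] y) * z = map (mulLeft ℂ x) LinearMap.id (map LinearMap.id (mulLeft ℂ y) z) := by
  induction z with
  | zero => simp
  | add u v hu hv => simp [mul_add, hu, hv]
  | tmul u v => simp

theorem mul_tmul_eq (x y : A) (z : A ⊗[ℂ] A) :
    z * (x ⊗ₜ[ℂ] y) = map (mulRight ℂ x) LinearMap.id (map LinearMap.id (mulRight ℂ y) z) := by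
  induction z with
  | zero => simp
  | add u v hu hv => simp [add_mul, hu, hv]
  | tmul u v => simp

theorem mul_left_inj' (H : MultiplierHopfAlgebra A) {z w : A ⊗[ℂ] A}
    (h : ∀ x y : A, (x ⊗ₜ[ℂ] y) * z = (x ⊗ₜ[ℂ] y) * w) : z = w := by
  rw [← sub_eq_zero]
  apply eq_zero_of_map_right (fun p : A => mulLeft ℂ p) H.eq_zero_of_mul_left
  intro y
  apply eq_zero_of_map_left (fun p : A => mulLeft ℂ p) H.eq_zero_of_mul_left
  intro x
  rw [← tmul_mul_eq, mul_sub, h, sub_self]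

theorem mul_right_inj' (H : MultiplierHopfAlgebra A) {z w : A ⊗[ℂ] A}
    (h : ∀ x : A ⊗[ℂ] A, z * x = w * x) : z = w := by
  rw [← sub_eq_zero]
  apply eq_zero_of_map_right (fun p : A => mulRight ℂ p) H.eq_zero_of_mul_right
  intro y
  apply eq_zero_of_map_left (fun p : A => mulRight ℂ p) H.eq_zero_of_mul_right
  intro x
  rw [← mul_tmul_eq, sub_mul, h, sub_self]

theorem rmul_mul_right (H : MultiplierHopfAlgebra A) (m : MultiplierAlgebra (A ⊗[ℂ] A))
    (w z : A ⊗[ℂ] A) : rmul m (w * z) = w * rmul m z := by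
  apply H.mul_right_inj'
  intro x
  rw [rmul_mul, mul_assoc, mul_assoc, rmul_mul]

/-- `w((a ⊗ 1)Δ(b)) = (w(a ⊗ 1))Δ(b)`. -/
theorem mul_T₂ (H : MultiplierHopfAlgebra A) (x y a b : A) :
    (x ⊗ₜ[ℂ] y) * H.T₂ (a ⊗ₜ b) = rmul (H.comul b) ((x * a) ⊗ₜ y) := by
  rw [← rmul_toMultiplier, H.T₂_spec]
  simp

theorem T₁_mul (H : MultiplierHopfAlgebra A) (x y a b : A) :
    H.T₁ (a ⊗ₜ b) * (x ⊗ₜ[ℂ] y) = lmul (H.comul a) (x ⊗ₜ (b * y)) := by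
  rw [← lmul_toMultiplier, H.T₁_spec]
  simp

theorem mulLeft_T₂ (H : MultiplierHopfAlgebra A) (e p a : A) :
    map LinearMap.id (mulLeft ℂ e) (H.T₂ (p ⊗ₜ a)) = rmul (H.comul a) (p ⊗ₜ e) := by
  apply H.mul_left_inj'
  intro x y
  rw [← H.rmul_mul_right, Algebra.TensorProduct.tmul_mul_tmul, ← H.mul_T₂, tmul_mul_eq,
    tmul_mul_eq, ← LinearMap.comp_apply, ← LinearMap.comp_apply, ← LinearMap.comp_apply,
    ← TensorProduct.map_comp, ← TensorProduct.map_comp, ← TensorProduct.map_comp]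
  rw [LinearMap.mulLeft_mul]
  rfl

theorem mulRight_rmul (H : MultiplierHopfAlgebra A) (e e' v c : A) :
    map LinearMap.id (mulRight ℂ c) (rmul (H.comul v) (e ⊗ₜ e')) =
      map (mulLeft ℂ e) (mulLeft ℂ e') (H.T₁ (v ⊗ₜ c)) := by
  have h1 : map (mulLeft ℂ e) (mulLeft ℂ e') (H.T₁ (v ⊗ₜ c)) =
      (e ⊗ₜ e') * H.T₁ (v ⊗ₜ c) := by
    rw [tmul_mul_eq, ← LinearMap.comp_apply, ← TensorProduct.map_comp]
    rfl
  rw [h1]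
  have h2 : ∀ (z : A ⊗[ℂ] A) (x y : A), map LinearMap.id (mulRight ℂ c) z * (x ⊗ₜ[ℂ] y) =
      z * (x ⊗ₜ (c * y)) := by
    intro z x y
    induction z with
    | zero => simp
    | add u v hu hv => simp [add_mul, hu, hv]
    | tmul u v => simp [mul_assoc]
  apply H.mul_right_inj'
  intro w
  induction w with
  | zero => simp
  | add u v hu hv => simp only [mul_add, hu, hv]
  | tmul x y => rw [h2, rmul_mul, mul_assoc, H.T₁_mul]

theorem T₂_mul (H : MultiplierHopfAlgebra A) (p a a' : A) :
    H.T₂ (p ⊗ₜ (a * a')) = rmul (H.comul a') (H.T₂ (p ⊗ₜ a)) := by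
  apply H.mul_left_inj'
  intro x y
  rw [← H.rmul_mul_right, H.mul_T₂, H.mul_T₂, map_mul, rmul_mul']

end MultiplierHopfAlgebra

namespace RegularMultiplierHopfAlgebra

theorem mulLeft_T₄ (H : RegularMultiplierHopfAlgebra A) (e p a : A) :
    map (mulLeft ℂ p) LinearMap.id (H.T₄ (e ⊗ₜ a)) = rmul (H.comul a) (p ⊗ₜ e) := by
  have h := H.opp.mulLeft_T₂ p e a
  rw [H.opp_comul] at h
  simp only [T₄, LinearMap.comp_apply, LinearEquiv.coe_coe]
  rw [TensorProduct.map_comm, h]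
  simp [flipMultiplier]

end RegularMultiplierHopfAlgebra

theorem map_map' {X Y X' Y' X'' Y'' : Type*} [AddCommGroup X] [Module ℂ X] [AddCommGroup Y]
    [Module ℂ Y] [AddCommGroup X'] [Module ℂ X'] [AddCommGroup Y'] [Module ℂ Y']
    [AddCommGroup X''] [Module ℂ X''] [AddCommGroup Y''] [Module ℂ Y'']
    (f : X →ₗ[ℂ] X') (g : Y →ₗ[ℂ] Y') (f' : X' →ₗ[ℂ] X'') (g' : Y' →ₗ[ℂ] Y'')
    (z : X ⊗[ℂ] Y) : map f' g' (map f g z) = map (f' ∘ₗ f) (g' ∘ₗ g) z := by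
  rw [← LinearMap.comp_apply, ← TensorProduct.map_comp]

namespace RightModuleAlgebra

variable {HA : RegularMultiplierHopfAlgebra A}

theorem act_induction (α : RightModuleAlgebra B HA) {p : B → Prop} (b : B)
    (h0 : p 0) (hadd : ∀ b b', p b → p b' → p (b + b')) (hact : ∀ c e, p (α.act c e)) : p b := by
  have hb : b ∈ Submodule.span ℂ (Set.range fun q : B × A => α.act q.1 q.2) := by
    rw [α.unital]; trivial
  induction hb using Submodule.span_induction with
  | mem x hx => obtain ⟨q, rfl⟩ := hx; exact hact _ _
  | zero => exact h0
  | add x y _ _ hx hy => exact hadd _ _ hx hy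
  | smul r x hx _ =>
    have : ∀ x ∈ Submodule.span ℂ (Set.range fun q : B × A => α.act q.1 q.2),
        ∀ r : ℂ, p (r • x) := by
      intro x hx
      induction hx using Submodule.span_induction with
      | mem x hx =>
        obtain ⟨q, rfl⟩ := hx
        intro r
        have := hact (r • q.1) q.2
        simpa using this
      | zero => intro r; simpa using h0
      | add x y _ _ hx hy => intro r; rw [smul_add]; exact hadd _ _ (hx r) (hy r)
      | smul s x _ hx => intro r; rw [smul_smul]; exact hx _
    exact this x hx r

/-- Covering by the action: `(p ⊗ 1)z = ∑ p a₁ ⊗ (c ◁ e a₂)` for the element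
`z = ∑ a₁ ⊗ (c ◁ e a₂)`. -/
theorem cover_eq (α : RightModuleAlgebra B HA) (c : B) (e a p : A) :
    map (mulLeft ℂ p) LinearMap.id (map LinearMap.id (α.act c) (HA.T₄ (e ⊗ₜ a))) =
      map LinearMap.id (α.act (α.act c e)) (HA.T₂ (p ⊗ₜ a)) := by
  have h : α.act (α.act c e) = α.act c ∘ₗ mulLeft ℂ e := by
    ext x; simp [α.act_mul]
  have h2 : map LinearMap.id (α.act c) (map LinearMap.id (mulLeft ℂ e) (HA.T₂ (p ⊗ₜ a))) =
      map LinearMap.id (α.act (α.act c e)) (HA.T₂ (p ⊗ₜ a)) := by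
    rw [map_map', h]; rfl
  rw [← h2, HA.mulLeft_T₂, ← HA.mulLeft_T₄, map_map', map_map']
  rfl

/-- The formula `∑ a₁ ⊗ (b ◁ a₂)` defines an element of `A ⊗ B`. -/
theorem exists_twist (α : RightModuleAlgebra B HA) (b : B) (a : A) :
    ∃ z : A ⊗[ℂ] B, ∀ p : A, map (mulLeft ℂ p) LinearMap.id z =
      map LinearMap.id (α.act b) (HA.T₂ (p ⊗ₜ a)) := by
  induction b using α.act_induction with
  | h0 => exact ⟨0, fun p => by simp [TensorProduct.map_zero_right]⟩
  | hadd b b' h h' =>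
    obtain ⟨z, hz⟩ := h
    obtain ⟨z', hz'⟩ := h'
    exact ⟨z + z', fun p => by simp [hz, hz', TensorProduct.map_add_right]⟩
  | hact c e => exact ⟨_, fun p => α.cover_eq c e a p⟩

/-- The element `∑ a₁ ⊗ (b ◁ a₂)` of `A ⊗ B`. -/
def twistFun (α : RightModuleAlgebra B HA) (b : B) (a : A) : A ⊗[ℂ] B :=
  (α.exists_twist b a).choose

theorem twistFun_spec (α : RightModuleAlgebra B HA) (b : B) (a p : A) :
    map (mulLeft ℂ p) LinearMap.id (α.twistFun b a) =
      map LinearMap.id (α.act b) (HA.T₂ (p ⊗ₜ a)) :=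
  (α.exists_twist b a).choose_spec p

/-- The twist map `R : B ⊗ A → A ⊗ B`, `R(b ⊗ a) = ∑ a₁ ⊗ (b ◁ a₂)`: the element `R(b ⊗ a)` is
determined by `(p ⊗ 1)R(b ⊗ a) = ∑ p a₁ ⊗ (b ◁ a₂)` for all `p ∈ A`, where the right hand side
is the image of `(p ⊗ 1)Δ(a)` in `A ⊗ A` under `x ⊗ y ↦ x ⊗ (b ◁ y)`; see `twist_spec`.  When
`b = c ◁ e`, it is the image of `(1 ⊗ e)Δ(a)` under `x ⊗ y ↦ x ⊗ (c ◁ y)`; see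
`twist_act`. -/
def twist (α : RightModuleAlgebra B HA) : B ⊗[ℂ] A →ₗ[ℂ] A ⊗[ℂ] B :=
  TensorProduct.lift (LinearMap.mk₂ ℂ α.twistFun
    (fun b b' a => HA.cancel_left fun p => by
      simp only [map_add, α.twistFun_spec, TensorProduct.map_add_right, LinearMap.add_apply])
    (fun r b a => HA.cancel_left fun p => by
      simp only [map_smul, α.twistFun_spec, TensorProduct.map_smul_right, LinearMap.smul_apply])
    (fun b a a' => HA.cancel_left fun p => by
      simp only [map_add, α.twistFun_spec, TensorProduct.tmul_add])
    (fun r b a => HA.cancel_left fun p => by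
      simp only [map_smul, α.twistFun_spec, TensorProduct.tmul_smul]))

theorem twist_spec (α : RightModuleAlgebra B HA) (b : B) (a p : A) :
    map (mulLeft ℂ p) LinearMap.id (α.twist (b ⊗ₜ a)) =
      map LinearMap.id (α.act b) (HA.T₂ (p ⊗ₜ a)) :=
  α.twistFun_spec b a p

theorem twist_act (α : RightModuleAlgebra B HA) (c : B) (e a : A) :
    α.twist (α.act c e ⊗ₜ a) = map LinearMap.id (α.act c) (HA.T₄ (e ⊗ₜ a)) :=
  HA.cancel_left fun p => by rw [α.twist_spec, α.cover_eq]

/-- Right multiplication with `a ∈ A` on `A ⊗ B`: `(c ⊗ d) a = c R(d ⊗ a)`. -/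
def mulA (α : RightModuleAlgebra B HA) (a : A) : A ⊗[ℂ] B →ₗ[ℂ] A ⊗[ℂ] B :=
  map (LinearMap.mul' ℂ A) LinearMap.id ∘ₗ (TensorProduct.assoc ℂ A A B).symm.toLinearMap ∘ₗ
    map LinearMap.id (α.twist ∘ₗ (TensorProduct.mk ℂ B A).flip a)

/-- Left multiplication with `b ∈ B` on `A ⊗ B`: `b (c ⊗ d) = R(b ⊗ c) d`. -/
def Bmul (α : RightModuleAlgebra B HA) (b : B) : A ⊗[ℂ] B →ₗ[ℂ] A ⊗[ℂ] B :=
  map LinearMap.id (LinearMap.mul' ℂ B) ∘ₗ (TensorProduct.assoc ℂ A B B).toLinearMap ∘ₗ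
    map (α.twist ∘ₗ TensorProduct.mk ℂ B A b) LinearMap.id

theorem mulA_tmul (α : RightModuleAlgebra B HA) (a c : A) (d : B) :
    α.mulA a (c ⊗ₜ d) = map (mulLeft ℂ c) LinearMap.id (α.twist (d ⊗ₜ a)) := by
  simp only [mulA, LinearMap.comp_apply, TensorProduct.map_tmul, LinearMap.flip_apply,
    TensorProduct.mk_apply, LinearMap.id_apply]
  generalize α.twist (d ⊗ₜ a) = z
  induction z with
  | zero => simp
  | add u v hu hv => simp only [TensorProduct.tmul_add, map_add, hu, hv]
  | tmul u v => simp

theorem Bmul_tmul (α : RightModuleAlgebra B HA) (b : B) (c : A) (d : B) :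
    α.Bmul b (c ⊗ₜ d) = map LinearMap.id (mulRight ℂ d) (α.twist (b ⊗ₜ c)) := by
  simp only [Bmul, LinearMap.comp_apply, TensorProduct.map_tmul, TensorProduct.mk_apply,
    LinearMap.id_apply]
  generalize α.twist (b ⊗ₜ c) = z
  induction z with
  | zero => simp
  | add u v hu hv => simp only [TensorProduct.add_tmul, map_add, hu, hv]
  | tmul u v => simp

theorem mulA_mulLeft (α : RightModuleAlgebra B HA) (a c : A) (z : A ⊗[ℂ] B) :
    α.mulA a (map (mulLeft ℂ c) LinearMap.id z) =
      map (mulLeft ℂ c) LinearMap.id (α.mulA a z) := by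
  induction z with
  | zero => simp
  | add u v hu hv => simp only [map_add, hu, hv]
  | tmul u v =>
    rw [mulA_tmul, TensorProduct.map_tmul, mulA_tmul, map_map', LinearMap.mulLeft_apply,
      LinearMap.mulLeft_mul]
    rfl

theorem Bmul_mulRight (α : RightModuleAlgebra B HA) (b d : B) (z : A ⊗[ℂ] B) :
    α.Bmul b (map LinearMap.id (mulRight ℂ d) z) =
      map LinearMap.id (mulRight ℂ d) (α.Bmul b z) := by
  induction z with
  | zero => simp
  | add u v hu hv => simp only [map_add, hu, hv]
  | tmul u v =>
    rw [Bmul_tmul, TensorProduct.map_tmul, Bmul_tmul, map_map', LinearMap.mulRight_apply,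
      LinearMap.mulRight_mul]
    rfl

theorem map_left_right (f : A →ₗ[ℂ] A) (g : B →ₗ[ℂ] B) (z : A ⊗[ℂ] B) :
    map f LinearMap.id (map LinearMap.id g z) = map LinearMap.id g (map f LinearMap.id z) := by
  rw [map_map', map_map']; rfl

theorem twist_mul_right (α : RightModuleAlgebra B HA) (b : B) (a a' : A) :
    α.twist (b ⊗ₜ (a * a')) = α.mulA a' (α.twist (b ⊗ₜ a)) := by
  apply HA.cancel_left
  intro p
  have key : ∀ w : A ⊗[ℂ] A, α.mulA a' (map LinearMap.id (α.act b) w) =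
      map LinearMap.id (α.act b) (rmul (HA.comul a') w) := by
    intro w
    induction w with
    | zero => simp
    | add u v hu hv => simp only [map_add, hu, hv]
    | tmul u v =>
      rw [TensorProduct.map_tmul, mulA_tmul, LinearMap.id_apply, α.twist_spec,
        ← HA.mulLeft_T₂, map_map']
      congr 2
      ext x
      simp [α.act_mul]
  rw [α.twist_spec, ← mulA_mulLeft, α.twist_spec, key, ← HA.T₂_mul]

/-- `(p ⊗ e ⊗ e')(ι ⊗ Δ)Δ(a) = (p ⊗ e ⊗ e')(Δ ⊗ ι)Δ(a)`. -/
theorem coassoc_left (HA : RegularMultiplierHopfAlgebra A) (p e e' a : A) :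
    map LinearMap.id (LinearMap.applyₗ (e ⊗ₜ e') ∘ₗ rmul ∘ₗ
        (HA.comul : A →ₗ[ℂ] MultiplierAlgebra (A ⊗[ℂ] A))) (HA.T₂ (p ⊗ₜ a)) =
      TensorProduct.assoc ℂ A A A (map (LinearMap.applyₗ (p ⊗ₜ e) ∘ₗ rmul ∘ₗ
        (HA.comul : A →ₗ[ℂ] MultiplierAlgebra (A ⊗[ℂ] A))) LinearMap.id (HA.T₄ (e' ⊗ₜ a))) := by
  apply (TensorProduct.assoc ℂ A A A).symm.injective
  rw [LinearEquiv.symm_apply_apply]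
  apply HA.cancel_right
  intro c
  have hassoc : ∀ z : A ⊗[ℂ] (A ⊗[ℂ] A),
      map LinearMap.id (mulRight ℂ c) ((TensorProduct.assoc ℂ A A A).symm z) =
        (TensorProduct.assoc ℂ A A A).symm
          (map LinearMap.id (map LinearMap.id (mulRight ℂ c)) z) := by
    intro z
    induction z with
    | zero => simp
    | add u v hu hv => simp only [map_add, hu, hv]
    | tmul u v =>
      induction v with
      | zero => simp
      | add v v' hu hv => simp only [TensorProduct.tmul_add, map_add, hu, hv]
      | tmul x y => simp
  have hassoc2 : ∀ z : A ⊗[ℂ] (A ⊗[ℂ] A),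
      (TensorProduct.assoc ℂ A A A).symm (map LinearMap.id
        (map (mulLeft ℂ e) (mulLeft ℂ e')) z) =
      map (map LinearMap.id (mulLeft ℂ e)) (mulLeft ℂ e')
        ((TensorProduct.assoc ℂ A A A).symm z) := by
    intro z
    induction z with
    | zero => simp
    | add u v hu hv => simp only [map_add, hu, hv]
    | tmul u v =>
      induction v with
      | zero => simp
      | add v v' hu hv => simp only [TensorProduct.tmul_add, map_add, hu, hv]
      | tmul x y => simp
  -- left hand side
  have h1 : map LinearMap.id (mulRight ℂ c) ∘ₗ (LinearMap.applyₗ (e ⊗ₜ[ℂ] e') ∘ₗ rmul ∘ₗ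
        (HA.comul : A →ₗ[ℂ] MultiplierAlgebra (A ⊗[ℂ] A))) =
      map (mulLeft ℂ e) (mulLeft ℂ e') ∘ₗ HA.T₁.toLinearMap ∘ₗ
        (TensorProduct.mk ℂ A A).flip c := by
    ext v
    exact HA.mulRight_rmul e e' v c
  have h2 : map LinearMap.id (HA.T₁.toLinearMap ∘ₗ (TensorProduct.mk ℂ A A).flip c)
        (HA.T₂ (p ⊗ₜ a)) =
      map LinearMap.id HA.T₁.toLinearMap
        (TensorProduct.assoc ℂ A A A (HA.T₂ (p ⊗ₜ a) ⊗ₜ c)) := by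
    generalize HA.T₂ (p ⊗ₜ a) = z
    induction z with
    | zero => simp
    | add u v hu hv => simp only [TensorProduct.add_tmul, map_add, hu, hv]
    | tmul u v => simp
  -- right hand side
  have h3 : map LinearMap.id (mulRight ℂ c) (HA.T₄ (e' ⊗ₜ a)) =
      map LinearMap.id (mulLeft ℂ e') (HA.T₁ (a ⊗ₜ c)) := by
    apply HA.cancel_left
    intro q
    rw [map_left_right, HA.mulLeft_T₄, HA.mulRight_rmul, map_map']
    rfl
  have h4 : (LinearMap.applyₗ (p ⊗ₜ[ℂ] e) ∘ₗ rmul ∘ₗ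
        (HA.comul : A →ₗ[ℂ] MultiplierAlgebra (A ⊗[ℂ] A))) =
      map LinearMap.id (mulLeft ℂ e) ∘ₗ HA.T₂.toLinearMap ∘ₗ TensorProduct.mk ℂ A A p := by
    ext v
    exact (HA.mulLeft_T₂ e p v).symm
  have h5 : map (HA.T₂.toLinearMap ∘ₗ TensorProduct.mk ℂ A A p) LinearMap.id
        (HA.T₁ (a ⊗ₜ c)) =
      map HA.T₂.toLinearMap LinearMap.id
        ((TensorProduct.assoc ℂ A A A).symm (p ⊗ₜ HA.T₁ (a ⊗ₜ c))) := by
    generalize HA.T₁ (a ⊗ₜ c) = z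
    induction z with
    | zero => simp
    | add u v hu hv => simp only [TensorProduct.tmul_add, map_add, hu, hv]
    | tmul u v => simp
  have hL : map LinearMap.id (map LinearMap.id (mulRight ℂ c))
      (map LinearMap.id (LinearMap.applyₗ (e ⊗ₜ e') ∘ₗ rmul ∘ₗ
        (HA.comul : A →ₗ[ℂ] MultiplierAlgebra (A ⊗[ℂ] A))) (HA.T₂ (p ⊗ₜ a))) =
      map LinearMap.id (map (mulLeft ℂ e) (mulLeft ℂ e'))
        (map LinearMap.id HA.T₁.toLinearMap
          (TensorProduct.assoc ℂ A A A (HA.T₂ (p ⊗ₜ a) ⊗ₜ c))) := by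
    rw [map_map', h1, ← h2, map_map']
  have hR : map LinearMap.id (mulRight ℂ c)
      (map (LinearMap.applyₗ (p ⊗ₜ e) ∘ₗ rmul ∘ₗ
        (HA.comul : A →ₗ[ℂ] MultiplierAlgebra (A ⊗[ℂ] A))) LinearMap.id (HA.T₄ (e' ⊗ₜ a))) =
      map (map LinearMap.id (mulLeft ℂ e)) (mulLeft ℂ e')
        (map HA.T₂.toLinearMap LinearMap.id
          ((TensorProduct.assoc ℂ A A A).symm (p ⊗ₜ HA.T₁ (a ⊗ₜ c)))) := by
    rw [← h5, map_map', h4, map_map']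
    have h6 := congrArg (map (map LinearMap.id (mulLeft ℂ e) ∘ₗ HA.T₂.toLinearMap ∘ₗ
      TensorProduct.mk ℂ A A p) (LinearMap.id : A →ₗ[ℂ] A)) h3
    rw [map_map', map_map'] at h6
    exact h6
  rw [hassoc, hL, hassoc2, hR, HA.coassoc]

theorem twist_mul_left (α : RightModuleAlgebra B HA) (b b' : B) (a : A) :
    α.twist ((b * b') ⊗ₜ a) = α.Bmul b (α.twist (b' ⊗ₜ a)) := by
  have hB0 : α.Bmul 0 = 0 := by
    ext c d; simp [Bmul_tmul]
  have hBadd : ∀ b c, α.Bmul (b + c) = α.Bmul b + α.Bmul c := by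
    intro b c; ext x y; simp [Bmul_tmul, TensorProduct.add_tmul]
  induction b using α.act_induction with
  | h0 => simp [hB0]
  | hadd b c h h' => simp [add_mul, TensorProduct.add_tmul, hBadd, h, h']
  | hact c e =>
    induction b' using α.act_induction with
    | h0 => simp
    | hadd b c h h' => simp [mul_add, TensorProduct.add_tmul, h, h']
    | hact c' e' =>
      apply HA.cancel_left
      intro p
      have hpB : ∀ z : A ⊗[ℂ] B, ∀ b : B, map (mulLeft ℂ p) LinearMap.id (α.Bmul b z) =
          map LinearMap.id (LinearMap.mul' ℂ B) (TensorProduct.assoc ℂ A B B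
            (map (map (mulLeft ℂ p) LinearMap.id ∘ₗ α.twist ∘ₗ TensorProduct.mk ℂ B A b)
              LinearMap.id z)) := by
        intro z b
        induction z with
        | zero => simp
        | add u v hu hv => simp only [map_add, hu, hv]
        | tmul u v =>
          rw [Bmul_tmul]
          simp only [TensorProduct.map_tmul, LinearMap.comp_apply, TensorProduct.mk_apply,
            LinearMap.id_apply]
          generalize α.twist (b ⊗ₜ u) = y
          induction y with
          | zero => simp
          | add u v hu hv => simp only [TensorProduct.add_tmul, map_add, hu, hv]
          | tmul u v => simp
      have h1 : map (mulLeft ℂ p) LinearMap.id ∘ₗ α.twist ∘ₗ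
            TensorProduct.mk ℂ B A (α.act c e) =
          map LinearMap.id (α.act c) ∘ₗ (LinearMap.applyₗ (p ⊗ₜ[ℂ] e) ∘ₗ rmul ∘ₗ
            (HA.comul : A →ₗ[ℂ] MultiplierAlgebra (A ⊗[ℂ] A))) := by
        ext u
        have : α.act (α.act c e) = α.act c ∘ₗ mulLeft ℂ e := by
          ext x; simp [α.act_mul]
        simp only [LinearMap.comp_apply, TensorProduct.mk_apply, α.twist_spec, this]
        rw [show map LinearMap.id (α.act c ∘ₗ mulLeft ℂ e) (HA.T₂ (p ⊗ₜ u)) =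
          map LinearMap.id (α.act c) (map LinearMap.id (mulLeft ℂ e) (HA.T₂ (p ⊗ₜ u))) by
            rw [map_map']; rfl, HA.mulLeft_T₂]
        rfl
      have h2 : α.act (α.act c e * α.act c' e') = LinearMap.mul' ℂ B ∘ₗ
          map (α.act c) (α.act c') ∘ₗ (LinearMap.applyₗ (e ⊗ₜ[ℂ] e') ∘ₗ rmul ∘ₗ
            (HA.comul : A →ₗ[ℂ] MultiplierAlgebra (A ⊗[ℂ] A))) := by
        ext v
        exact α.mul_act c c' e e' v
      have h3 : ∀ z : (A ⊗[ℂ] A) ⊗[ℂ] A, TensorProduct.assoc ℂ A B B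
          (map (map LinearMap.id (α.act c)) (α.act c') z) =
          map LinearMap.id (map (α.act c) (α.act c')) (TensorProduct.assoc ℂ A A A z) := by
        intro z
        induction z with
        | zero => simp
        | add u v hu hv => simp only [map_add, hu, hv]
        | tmul u v =>
          induction u with
          | zero => simp
          | add v v' hu hv => simp only [TensorProduct.add_tmul, map_add, hu, hv]
          | tmul x y => simp
      have h4 := coassoc_left HA p e e' a
      rw [α.twist_spec, hpB, h1, α.twist_act, map_map', h2]
      rw [show (map LinearMap.id (α.act c) ∘ₗ (LinearMap.applyₗ (p ⊗ₜ[ℂ] e) ∘ₗ rmul ∘ₗ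
            (HA.comul : A →ₗ[ℂ] MultiplierAlgebra (A ⊗[ℂ] A)))) ∘ₗ LinearMap.id =
          map LinearMap.id (α.act c) ∘ₗ (LinearMap.applyₗ (p ⊗ₜ[ℂ] e) ∘ₗ rmul ∘ₗ
            (HA.comul : A →ₗ[ℂ] MultiplierAlgebra (A ⊗[ℂ] A))) from rfl,
        show LinearMap.id ∘ₗ α.act c' = α.act c' ∘ₗ LinearMap.id from rfl,
        ← map_map', h3, ← h4, map_map', map_map']
      rfl

end RightModuleAlgebra
variable {HA : RegularMultiplierHopfAlgebra A}

namespace RightModuleAlgebra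

/-- The product `(m_A ⊗ m_B)(ι ⊗ R ⊗ ι)` of the smash product, as a map on
`(A ⊗ B) ⊗ (A ⊗ B)`. -/
def smashMul (α : RightModuleAlgebra B HA) :
    (A ⊗[ℂ] B) ⊗[ℂ] (A ⊗[ℂ] B) →ₗ[ℂ] A ⊗[ℂ] B :=
  map (LinearMap.mul' ℂ A) (LinearMap.mul' ℂ B) ∘ₗ leg23 α.twist

theorem smashMul_tmul_tmul (α : RightModuleAlgebra B HA) (a a' : A) (b b' : B) :
    α.smashMul ((a ⊗ₜ b) ⊗ₜ (a' ⊗ₜ b')) =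
      map (mulLeft ℂ a) (mulRight ℂ b') (α.twist (b ⊗ₜ a')) := by
  simp only [smashMul, leg23, LinearMap.comp_apply, LinearEquiv.coe_coe, middle_tmul,
    TensorProduct.map_tmul, LinearMap.id_apply]
  generalize α.twist (b ⊗ₜ a') = z
  induction z with
  | zero => simp
  | add u v hu hv => simp only [TensorProduct.add_tmul, TensorProduct.tmul_add, map_add, hu, hv]
  | tmul u v =>
    have : (middle A A B B).symm (a ⊗ₜ ((u ⊗ₜ v) ⊗ₜ b')) = (a ⊗ₜ u) ⊗ₜ (v ⊗ₜ b') := rfl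
    rw [this]
    simp

theorem smashMul_right (α : RightModuleAlgebra B HA) (x : A ⊗[ℂ] B) (a : A) (b : B) :
    α.smashMul (x ⊗ₜ (a ⊗ₜ b)) = map LinearMap.id (mulRight ℂ b) (α.mulA a x) := by
  induction x with
  | zero => simp
  | add u v hu hv => simp only [TensorProduct.add_tmul, map_add, hu, hv]
  | tmul u v => rw [smashMul_tmul_tmul, mulA_tmul, map_map']; rfl

theorem smashMul_left (α : RightModuleAlgebra B HA) (x : A ⊗[ℂ] B) (a : A) (b : B) :
    α.smashMul ((a ⊗ₜ b) ⊗ₜ x) = map (mulLeft ℂ a) LinearMap.id (α.Bmul b x) := by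
  induction x with
  | zero => simp
  | add u v hu hv => simp only [TensorProduct.tmul_add, map_add, hu, hv]
  | tmul u v => rw [smashMul_tmul_tmul, Bmul_tmul, map_map']; rfl

theorem mulA_mul (α : RightModuleAlgebra B HA) (a a' : A) (x : A ⊗[ℂ] B) :
    α.mulA (a * a') x = α.mulA a' (α.mulA a x) := by
  induction x with
  | zero => simp
  | add u v hu hv => simp only [map_add, hu, hv]
  | tmul u v => rw [mulA_tmul, mulA_tmul, twist_mul_right, mulA_mulLeft]

theorem Bmul_mul (α : RightModuleAlgebra B HA) (b b' : B) (x : A ⊗[ℂ] B) :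
    α.Bmul (b * b') x = α.Bmul b (α.Bmul b' x) := by
  induction x with
  | zero => simp
  | add u v hu hv => simp only [map_add, hu, hv]
  | tmul u v => rw [Bmul_tmul, Bmul_tmul, twist_mul_left, Bmul_mulRight]

theorem mulA_mulRight (α : RightModuleAlgebra B HA) (a : A) (d : B) (w : A ⊗[ℂ] B) :
    α.mulA a (map LinearMap.id (mulRight ℂ d) w) =
      α.smashMul (w ⊗ₜ α.twist (d ⊗ₜ a)) := by
  induction w with
  | zero => simp
  | add u v hu hv => simp only [TensorProduct.add_tmul, map_add, hu, hv]
  | tmul u v =>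
    rw [TensorProduct.map_tmul, mulA_tmul, smashMul_left, LinearMap.mulRight_apply,
      twist_mul_left]
    rfl

theorem Bmul_mulLeft (α : RightModuleAlgebra B HA) (b : B) (c : A) (w : A ⊗[ℂ] B) :
    α.Bmul b (map (mulLeft ℂ c) LinearMap.id w) =
      α.smashMul (α.twist (b ⊗ₜ c) ⊗ₜ w) := by
  induction w with
  | zero => simp
  | add u v hu hv => simp only [TensorProduct.tmul_add, map_add, hu, hv]
  | tmul u v =>
    rw [TensorProduct.map_tmul, Bmul_tmul, smashMul_right, LinearMap.mulLeft_apply,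
      twist_mul_right]
    rfl

theorem mulA_Bmul (α : RightModuleAlgebra B HA) (a : A) (b : B) (x : A ⊗[ℂ] B) :
    α.mulA a (α.Bmul b x) = α.Bmul b (α.mulA a x) := by
  induction x with
  | zero => simp
  | add u v hu hv => simp only [map_add, hu, hv]
  | tmul u v => rw [Bmul_tmul, mulA_tmul, mulA_mulRight, Bmul_mulLeft]

theorem smashMul_assoc (α : RightModuleAlgebra B HA) (x y z : A ⊗[ℂ] B) :
    α.smashMul (α.smashMul (x ⊗ₜ y) ⊗ₜ z) = α.smashMul (x ⊗ₜ α.smashMul (y ⊗ₜ z)) := by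
  induction x with
  | zero => simp
  | add u v hu hv => simp only [TensorProduct.add_tmul, map_add, hu, hv]
  | tmul a b =>
    induction z with
    | zero => simp
    | add u v hu hv => simp only [TensorProduct.tmul_add, map_add, hu, hv]
    | tmul a' b' =>
      rw [smashMul_left, smashMul_left, smashMul_right, smashMul_right, mulA_mulLeft,
        mulA_Bmul, Bmul_mulRight, map_left_right]

end RightModuleAlgebra

/-- The smash product `AB = A # B` of `A` and the right `A`-module algebra `B`: the space
`A ⊗ B` with the product `(a # b)(a' # b') = ∑ a a'₁ # (b ◁ a'₂) b'`. -/
def SmashProduct (_α : RightModuleAlgebra B HA) : Type _ := A ⊗[ℂ] B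

namespace SmashProduct

variable (α : RightModuleAlgebra B HA)

instance : AddCommGroup (SmashProduct α) := inferInstanceAs (AddCommGroup (A ⊗[ℂ] B))

instance : Module ℂ (SmashProduct α) := inferInstanceAs (Module ℂ (A ⊗[ℂ] B))

/-- The identification `a ⊗ b ↦ ab` of `A ⊗ B` with `AB`. -/
def equiv : A ⊗[ℂ] B ≃ₗ[ℂ] SmashProduct α := LinearEquiv.refl ℂ (A ⊗[ℂ] B)

instance : Mul (SmashProduct α) where
  mul x y := equiv α (α.smashMul ((equiv α).symm x ⊗ₜ (equiv α).symm y))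

theorem mul_def (x y : SmashProduct α) :
    x * y = equiv α (α.smashMul ((equiv α).symm x ⊗ₜ (equiv α).symm y)) := rfl

instance : NonUnitalRing (SmashProduct α) where
  left_distrib x y z := by simp only [mul_def, map_add, TensorProduct.tmul_add]
  right_distrib x y z := by simp only [mul_def, map_add, TensorProduct.add_tmul]
  zero_mul x := by simp only [mul_def, map_zero, TensorProduct.zero_tmul]
  mul_zero x := by simp only [mul_def, map_zero, TensorProduct.tmul_zero]
  mul_assoc x y z := by
    simp only [mul_def, LinearEquiv.symm_apply_apply, α.smashMul_assoc]

instance : IsScalarTower ℂ (SmashProduct α) (SmashProduct α) where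
  smul_assoc r x y := by
    simp only [smul_eq_mul, mul_def, map_smul, ← TensorProduct.smul_tmul']

instance : SMulCommClass ℂ (SmashProduct α) (SmashProduct α) where
  smul_comm r x y := by
    simp only [smul_eq_mul, mul_def, map_smul, TensorProduct.tmul_smul]

/-- The embedding `π_A : A → M(AB)`: `a'(a # b) = a'a # b`, and `(a # b)a' = a R(b ⊗ a')`. -/
def inclA : A →ₗ[ℂ] MultiplierAlgebra (SmashProduct α) where
  toFun a := mkMultiplier
    ((equiv α).toLinearMap ∘ₗ map (mulLeft ℂ a) LinearMap.id ∘ₗ (equiv α).symm.toLinearMap)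
    ((equiv α).toLinearMap ∘ₗ α.mulA a ∘ₗ (equiv α).symm.toLinearMap)
    (fun x y => by
      obtain ⟨x, rfl⟩ := (equiv α).surjective x
      obtain ⟨y, rfl⟩ := (equiv α).surjective y
      simp only [mul_def, LinearMap.comp_apply, LinearEquiv.coe_coe,
        LinearEquiv.symm_apply_apply]
      congr 1
      induction y with
      | zero => simp
      | add u v hu hv => simp only [TensorProduct.tmul_add, map_add, hu, hv]
      | tmul u v =>
        rw [TensorProduct.map_tmul, α.smashMul_right, α.smashMul_right, LinearMap.mulLeft_apply,
          α.mulA_mul]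
        rfl)
  map_add' a a' := multiplier_ext
    (fun x => by
      obtain ⟨x, rfl⟩ := (equiv α).surjective x
      induction x with
      | zero => simp
      | add u v hu hv => simp only [map_add, hu, hv]
      | tmul u v => simp [add_mul, TensorProduct.add_tmul])
    (fun x => by
      obtain ⟨x, rfl⟩ := (equiv α).surjective x
      induction x with
      | zero => simp
      | add u v hu hv => simp only [map_add, hu, hv]
      | tmul u v => simp [α.mulA_tmul, TensorProduct.tmul_add])
  map_smul' r a := multiplier_ext
    (fun x => by
      obtain ⟨x, rfl⟩ := (equiv α).surjective x
      induction x with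
      | zero => simp
      | add u v hu hv => simp only [map_add, hu, hv]
      | tmul u v => simp [smul_mul_assoc, ← TensorProduct.smul_tmul'])
    (fun x => by
      obtain ⟨x, rfl⟩ := (equiv α).surjective x
      induction x with
      | zero => simp
      | add u v hu hv => simp only [map_add, hu, hv]
      | tmul u v => simp [α.mulA_tmul])

/-- The embedding `π_B : B → M(AB)`: `(a # b)b' = a # bb'`, and `b'(a # b) = R(b' ⊗ a) b`. -/
def inclB : B →ₗ[ℂ] MultiplierAlgebra (SmashProduct α) where
  toFun b := mkMultiplier
    ((equiv α).toLinearMap ∘ₗ α.Bmul b ∘ₗ (equiv α).symm.toLinearMap)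
    ((equiv α).toLinearMap ∘ₗ map LinearMap.id (mulRight ℂ b) ∘ₗ (equiv α).symm.toLinearMap)
    (fun x y => by
      obtain ⟨x, rfl⟩ := (equiv α).surjective x
      obtain ⟨y, rfl⟩ := (equiv α).surjective y
      simp only [mul_def, LinearMap.comp_apply, LinearEquiv.coe_coe,
        LinearEquiv.symm_apply_apply]
      congr 1
      induction x with
      | zero => simp
      | add u v hu hv => simp only [TensorProduct.add_tmul, map_add, hu, hv]
      | tmul u v =>
        rw [TensorProduct.map_tmul, α.smashMul_left, α.smashMul_left, LinearMap.mulRight_apply,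
          α.Bmul_mul]
        rfl)
  map_add' b b' := multiplier_ext
    (fun x => by
      obtain ⟨x, rfl⟩ := (equiv α).surjective x
      induction x with
      | zero => simp
      | add u v hu hv => simp only [map_add, hu, hv]
      | tmul u v => simp [α.Bmul_tmul, TensorProduct.add_tmul])
    (fun x => by
      obtain ⟨x, rfl⟩ := (equiv α).surjective x
      induction x with
      | zero => simp
      | add u v hu hv => simp only [map_add, hu, hv]
      | tmul u v => simp [mul_add, TensorProduct.tmul_add])
  map_smul' r b := multiplier_ext
    (fun x => by
      obtain ⟨x, rfl⟩ := (equiv α).surjective x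
      induction x with
      | zero => simp
      | add u v hu hv => simp only [map_add, hu, hv]
      | tmul u v => simp [α.Bmul_tmul, ← TensorProduct.smul_tmul'])
    (fun x => by
      obtain ⟨x, rfl⟩ := (equiv α).surjective x
      induction x with
      | zero => simp
      | add u v hu hv => simp only [map_add, hu, hv]
      | tmul u v => simp [mul_smul_comm])

end SmashProduct

/-- A left `B`-comodule coalgebra `A`: a left coaction `Γ` of `B` on `A`, with cotwist map `T`,
such that `(ι ⊗ T)(Δ_A ⊗ ι) = (T⁻¹ ⊗ ι)(ι ⊗ Δ_A)T` on `A ⊗ B`, including the assumption which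
gives a meaning to this equation, that the elements
`((ι ⊗ T)(Δ_A(a) ⊗ b))(1 ⊗ 1 ⊗ a')` and `(1 ⊗ 1 ⊗ a')((ι ⊗ T)(Δ_A(a) ⊗ b))` lie in `A ⊗ B ⊗ A`.

Here `(ι ⊗ T)(Δ_A(a) ⊗ b)` is the element of the completion of `A ⊗ B ⊗ A` with respect to the
first factor whose product with `p ⊗ 1 ⊗ 1` from the left is `(ι ⊗ T)((p ⊗ 1)Δ_A(a) ⊗ b)`. -/
structure LeftComoduleCoalgebra (HA : RegularMultiplierHopfAlgebra A)
    (HB : RegularMultiplierHopfAlgebra B) extends LeftCoaction A HB where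
  /-- There is `z = ((ι ⊗ T)(Δ_A(a) ⊗ b))(1 ⊗ 1 ⊗ a')` in `A ⊗ B ⊗ A`, and
  `(T ⊗ ι)z = ((ι ⊗ Δ_A)T(a ⊗ b))(1 ⊗ 1 ⊗ a')`. -/
  comul_right : ∀ (a : A) (b : B) (a' : A), ∃ z : A ⊗[ℂ] (B ⊗[ℂ] A),
    (∀ p : A, map (mulLeft ℂ p) LinearMap.id z =
      map LinearMap.id (map LinearMap.id (mulRight ℂ a') ∘ₗ cotwist Γ)
        (TensorProduct.assoc ℂ A A B (HA.T₂ (p ⊗ₜ a) ⊗ₜ b))) ∧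
    map (cotwist Γ) LinearMap.id ((TensorProduct.assoc ℂ A B A).symm z) =
      (TensorProduct.assoc ℂ B A A).symm
        (map LinearMap.id (HA.T₁.toLinearMap ∘ₗ (TensorProduct.mk ℂ A A).flip a')
          (cotwist Γ (a ⊗ₜ b)))
  /-- There is `z = (1 ⊗ 1 ⊗ a')((ι ⊗ T)(Δ_A(a) ⊗ b))` in `A ⊗ B ⊗ A`, and
  `(T ⊗ ι)z = (1 ⊗ 1 ⊗ a')((ι ⊗ Δ_A)T(a ⊗ b))`. -/
  comul_left : ∀ (a : A) (b : B) (a' : A), ∃ z : A ⊗[ℂ] (B ⊗[ℂ] A),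
    (∀ p : A, map (mulLeft ℂ p) LinearMap.id z =
      map LinearMap.id (map LinearMap.id (mulLeft ℂ a') ∘ₗ cotwist Γ)
        (TensorProduct.assoc ℂ A A B (HA.T₂ (p ⊗ₜ a) ⊗ₜ b))) ∧
    map (cotwist Γ) LinearMap.id ((TensorProduct.assoc ℂ A B A).symm z) =
      (TensorProduct.assoc ℂ B A A).symm
        (map LinearMap.id (HA.T₄ ∘ₗ TensorProduct.mk ℂ A A a') (cotwist Γ (a ⊗ₜ b)))

/-- The cotwist map `T : A ⊗ B → B ⊗ A`, `T(a ⊗ b) = Γ(a)(b ⊗ 1)`, of a left comodule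
coalgebra. -/
def LeftComoduleCoalgebra.T {HB : RegularMultiplierHopfAlgebra B}
    (γ : LeftComoduleCoalgebra HA HB) : A ⊗[ℂ] B →ₗ[ℂ] B ⊗[ℂ] A := cotwist γ.Γ

section SmashCoproduct

variable {HB : RegularMultiplierHopfAlgebra B}
  (α : RightModuleAlgebra B HA) (γ : LeftComoduleCoalgebra HA HB)

/-- The linear map from `(A ⊗ A) ⊗ (B ⊗ B)` to `M(AB ⊗ AB)` given by
`(c ⊗ d) ⊗ (u ⊗ v) ↦ (c ⊗ 1) (Γ(d)(u ⊗ 1)) (1 ⊗ v)`, where `A` and `B` are embedded in `M(AB)`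
and `Γ(d)(u ⊗ 1) ∈ B ⊗ A`; thus formally
`(c ⊗ d) ⊗ (u ⊗ v) ↦ (c ⊗ 1) Γ(d) (u ⊗ v)`. -/
def smashCover : (A ⊗[ℂ] A) ⊗[ℂ] (B ⊗[ℂ] B) →ₗ[ℂ]
    MultiplierAlgebra (SmashProduct α ⊗[ℂ] SmashProduct α) :=
  LinearMap.mul' ℂ _ ∘ₗ
    map (tmulMultiplier.flip 1 ∘ₗ SmashProduct.inclA α)
      (LinearMap.mul' ℂ _ ∘ₗ
        map (TensorProduct.lift
              (tmulMultiplier.compl₁₂ (SmashProduct.inclB α) (SmashProduct.inclA α)) ∘ₗ γ.T)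
          (tmulMultiplier 1 ∘ₗ SmashProduct.inclB α)) ∘ₗ
    (middle A A B B).toLinearMap

theorem smashCover_tmul (c d : A) (u v : B) :
    smashCover α γ ((c ⊗ₜ d) ⊗ₜ (u ⊗ₜ v)) =
      tmulMultiplier (SmashProduct.inclA α c) 1 *
        (TensorProduct.lift
          (tmulMultiplier.compl₁₂ (SmashProduct.inclB α) (SmashProduct.inclA α))
            (γ.T (d ⊗ₜ u)) *
          tmulMultiplier 1 (SmashProduct.inclB α v)) := by
  simp [smashCover]

/-- The linear map `Δ` from `AB` to `M(AB ⊗ AB)` is the smash coproduct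
`Δ_#(ab) = ∑ (a₁ ⊗ 1) Γ(a₂) Δ_B(b)`.  The right hand side is covered by multiplying with
`p ⊗ 1` from the left (where `p ∈ A`) and with `q ⊗ q'` from the right (where `q, q' ∈ B`):
`(p ⊗ 1) Δ_#(ab) (q ⊗ q') = ∑ (p a₁ ⊗ 1) Γ(a₂) (Δ_B(b)(q ⊗ q'))`, with `(p ⊗ 1)Δ_A(a)`
in `A ⊗ A` and `Δ_B(b)(q ⊗ q')` in `B ⊗ B`. -/
def IsSmashCoproduct
    (Δ : SmashProduct α →ₗ[ℂ] MultiplierAlgebra (SmashProduct α ⊗[ℂ] SmashProduct α)) : Prop :=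
  ∀ (p a : A) (b q q' : B),
    tmulMultiplier (SmashProduct.inclA α p) 1 * Δ (SmashProduct.equiv α (a ⊗ₜ b)) *
        tmulMultiplier (SmashProduct.inclB α q) (SmashProduct.inclB α q') =
      smashCover α γ (HA.T₂ (p ⊗ₜ a) ⊗ₜ lmul (HB.comul b) (q ⊗ₜ q'))

/-- `T₁(x ⊗ x') = Δ(x)(1 ⊗ x')` for all `x, x' ∈ X`; in particular, the elements
`Δ(x)(1 ⊗ x')` of `M(X ⊗ X)` lie in `X ⊗ X`. -/
def IsCanonicalMap₁ {X : Type*} [NonUnitalRing X] [Module ℂ X] [IsScalarTower ℂ X X]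
    [SMulCommClass ℂ X X] (Δ : X →ₗ[ℂ] MultiplierAlgebra (X ⊗[ℂ] X))
    (T₁ : X ⊗[ℂ] X →ₗ[ℂ] X ⊗[ℂ] X) : Prop :=
  ∀ x x' : X, toMultiplier (T₁ (x ⊗ₜ x')) = Δ x * tmulMultiplier 1 (toMultiplier x')

/-- `T₂(x ⊗ x') = (x ⊗ 1)Δ(x')` for all `x, x' ∈ X`; in particular, the elements
`(x ⊗ 1)Δ(x')` of `M(X ⊗ X)` lie in `X ⊗ X`. -/
def IsCanonicalMap₂ {X : Type*} [NonUnitalRing X] [Module ℂ X] [IsScalarTower ℂ X X]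
    [SMulCommClass ℂ X X] (Δ : X →ₗ[ℂ] MultiplierAlgebra (X ⊗[ℂ] X))
    (T₂ : X ⊗[ℂ] X →ₗ[ℂ] X ⊗[ℂ] X) : Prop :=
  ∀ x x' : X, toMultiplier (T₂ (x ⊗ₜ x')) = tmulMultiplier (toMultiplier x) 1 * Δ x'

end SmashCoproduct

end Smash

end Bicross

end

open Bicross

open scoped TensorProduct

noncomputable section

namespace Bicross

open TensorProduct (map)
open LinearMap (mulLeft mulRight)

section

/-! ### Identities for maps on tensor products -/

section TensorMaps

variable {X Y Z W : Type*} [AddCommGroup X] [Module ℂ X] [AddCommGroup Y] [Module ℂ Y]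
  [AddCommGroup Z] [Module ℂ Z] [AddCommGroup W] [Module ℂ W]

/-! The argument has three parts. Neither the antipode `S` nor its inverse is constructed as a map:
`S(a)b` is `(ε ⊗ ι)T₁⁻¹(a ⊗ b)`, and `S⁻¹` appears as the antipode of the opposite coproduct.
Sweedler formulas below are formal; the lemmas state them with coverings.

Bijectivity of `R`. Formally `R⁻¹(a ⊗ b) = ∑ (b ◁ S⁻¹(a₂)) ⊗ a₁`. The action is a surjection `π : B
⊗ A → B`, and `R ∘ (π ⊗ ι)` is the twist `b ⊗ x ⊗ a ↦ ∑ a₁ ⊗ b ⊗ x a₂` of a free module, bijective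
by regularity of `A`, followed by the action on the last two factors. Surjectivity of `R` follows at
once. Injectivity follows because, after multiplication with `1 ⊗ q`, the inverse of the free twist
descends to `A ⊗ B` (`mulRight_map_act`).

Bijectivity of `T`. Formally `T⁻¹(b ⊗ v) = ∑ v₀ ⊗ S⁻¹(v₋₁)b`. For surjectivity `b` is replaced by
the elements `S⁻¹(c)d`, which span `B` (`cotwist_antipodeMul`); for injectivity, `T(k)` is shown to
determine all `(1 ⊗ S⁻¹(y))k` (`map_antipodeMul_eq_zero`). Both rest on `(ε ⊗ ι)Γ(v) = v`
(`counit_cotwist`), the place where injectivity of `Γ` enters.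

The coproduct. `T₁` and `T₂` are defined on `AB ⊗ AB` by the two formulas. Once `T₂(y ⊗ x)(1 ⊗ z) =
(y ⊗ 1)T₁(x ⊗ z)` is known, they are the canonical maps of some `Δ` (`exists_of_canonicalMaps`).
Since `R` is onto, one may take `y = cp`, `x = ab`, `z = qe` with `c, b, q ∈ B` and `p, a, e ∈ A`,
and both sides become `(c ⊗ 1)(∑ (p a₁ ⊗ 1) Γ(a₂) (Δ_B(b)(1 ⊗ q)))(1 ⊗ e)`. For `T₁` this is the
comodule coalgebra axiom (`embed_smashT₁`), for `T₂` the coaction axiom (`embed_smashT₂`). Dropping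
`e` shows that `Δ` is the smash coproduct. Uniqueness comes from non-degeneracy of `AB`, and
bijectivity holds because every factor of the formulas is bijective. -/

theorem map_assoc_symm_tmul (f : X ⊗[ℂ] Y →ₗ[ℂ] W) (x : X) (w : Y ⊗[ℂ] Z) :
    map f LinearMap.id ((TensorProduct.assoc ℂ X Y Z).symm (x ⊗ₜ w)) =
      map (f ∘ₗ TensorProduct.mk ℂ X Y x) LinearMap.id w := by
  induction w with
  | zero => simp
  | add u v hu hv => simp only [TensorProduct.tmul_add, map_add, hu, hv]
  | tmul u v => simp

theorem map_assoc_tmul (f : Y ⊗[ℂ] Z →ₗ[ℂ] W) (w : X ⊗[ℂ] Y) (z : Z) :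
    map LinearMap.id f (TensorProduct.assoc ℂ X Y Z (w ⊗ₜ z)) =
      map LinearMap.id (f ∘ₗ (TensorProduct.mk ℂ Y Z).flip z) w := by
  induction w with
  | zero => simp
  | add u v hu hv => simp only [TensorProduct.add_tmul, map_add, hu, hv]
  | tmul u v => simp

theorem assoc_tmul_eq (w : X ⊗[ℂ] Y) (z : Z) :
    TensorProduct.assoc ℂ X Y Z (w ⊗ₜ z) =
      map LinearMap.id ((TensorProduct.mk ℂ Y Z).flip z) w := by
  simpa using map_assoc_tmul (LinearMap.id : Y ⊗[ℂ] Z →ₗ[ℂ] _) w z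

/-- A linear functional with value 1 at some nonzero `y` strips off the second factor. -/
theorem tmul_right_cancel [Nontrivial Y] {x x' : X} (h : ∀ y : Y, x ⊗ₜ[ℂ] y = x' ⊗ₜ[ℂ] y) :
    x = x' := by
  obtain ⟨y, hy⟩ := exists_ne (0 : Y)
  obtain ⟨φ, hφ⟩ := Module.Projective.exists_dual_eq_one ℂ hy
  simpa [hφ] using congrArg (TensorProduct.rid ℂ X ∘ map LinearMap.id φ) (h y)

end TensorMaps

/-! ### Counit and antipode of a multiplier Hopf algebra -/

variable {A : Type*} [NonUnitalRing A] [Module ℂ A] [IsScalarTower ℂ A A] [SMulCommClass ℂ A A]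

namespace MultiplierHopfAlgebra


/-- `(p ⊗ 1)Δ(a)(1 ⊗ c)`, computed in two ways. -/
theorem mulRight_T₂ (H : MultiplierHopfAlgebra A) (p a c : A) :
    map LinearMap.id (mulRight ℂ c) (H.T₂ (p ⊗ₜ a)) =
      map (mulLeft ℂ p) LinearMap.id (H.T₁ (a ⊗ₜ c)) := by
  rw [← sub_eq_zero]
  apply eq_zero_of_map_right (fun e : A => mulLeft ℂ e) H.eq_zero_of_mul_left
  intro e
  rw [map_sub, sub_eq_zero]
  have h := H.mulRight_rmul p e a c
  rw [← H.mulLeft_T₂, map_map'] at h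
  have hc : mulRight ℂ c ∘ₗ mulLeft ℂ e = mulLeft ℂ e ∘ₗ mulRight ℂ c := by
    ext x
    simp [mul_assoc]
  rw [map_map', map_map']
  rw [hc] at h
  exact h

theorem lmul_mul_right (H : MultiplierHopfAlgebra A) (m : MultiplierAlgebra (A ⊗[ℂ] A)) (w z : A ⊗[ℂ] A) :
    lmul m (w * z) = lmul m w * z := by
  apply H.mul_left_inj'
  intro x y
  rw [← rmul_mul, ← mul_assoc, rmul_mul, mul_assoc]

/-- Covering by `x ⊗ y` splits: `T₁` absorbs `y`, and `x` multiplies the first leg afterwards. This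
is the passage between `Δ(a)w`, as used in the axioms for `Γ` and `Δ_#`, and the map `T₁`. -/
theorem lmul_comul_tmul (H : MultiplierHopfAlgebra A) (a x y : A) :
    lmul (H.comul a) (x ⊗ₜ y) = map (mulRight ℂ x) LinearMap.id (H.T₁ (a ⊗ₜ y)) := by
  apply H.mul_right_inj'
  intro w
  induction w with
  | zero => simp
  | add u v hu hv => simp only [mul_add, hu, hv]
  | tmul u v =>
    rw [← H.lmul_mul_right, Algebra.TensorProduct.tmul_mul_tmul, ← H.T₁_mul]
    generalize H.T₁ (a ⊗ₜ y) = z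
    induction z with
    | zero => simp
    | add u v hu hv => simp only [add_mul, map_add, hu, hv]
    | tmul u v => simp [mul_assoc]

theorem mulLeft_T₂_left (H : MultiplierHopfAlgebra A) (x p a : A) :
    H.T₂ ((x * p) ⊗ₜ a) = map (mulLeft ℂ x) LinearMap.id (H.T₂ (p ⊗ₜ a)) := by
  apply H.cancel_right
  intro c
  rw [H.mulRight_T₂, ← RightModuleAlgebra.map_left_right, H.mulRight_T₂, map_map',
    LinearMap.mulLeft_mul]
  rfl

/-- `(ι ⊗ T₁⁻¹)((c ⊗ 1)Δ(a) ⊗ b) = (T₂ ⊗ ι)(c ⊗ T₁⁻¹(a ⊗ b))`. -/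
theorem map_T₁_symm_T₂ (H : MultiplierHopfAlgebra A) (c a b : A) :
    map LinearMap.id (H.T₁.symm.toLinearMap ∘ₗ (TensorProduct.mk ℂ A A).flip b)
        (H.T₂ (c ⊗ₜ a)) =
      TensorProduct.assoc ℂ A A A
        (map (H.T₂.toLinearMap ∘ₗ TensorProduct.mk ℂ A A c) LinearMap.id
          (H.T₁.symm (a ⊗ₜ b))) := by
  -- Coassociativity says that `ι ⊗ T₁` and `T₂ ⊗ ι` commute. The claim is the case `w = T₁⁻¹(a ⊗
  -- b)`, after cancelling the injective map `ι ⊗ T₁`.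
  have key : ∀ w : A ⊗[ℂ] A,
      map LinearMap.id H.T₁.toLinearMap (TensorProduct.assoc ℂ A A A
        (map (H.T₂.toLinearMap ∘ₗ TensorProduct.mk ℂ A A c) LinearMap.id w)) =
      TensorProduct.assoc ℂ A A A
        (map (H.T₂.toLinearMap ∘ₗ TensorProduct.mk ℂ A A c) LinearMap.id (H.T₁ w)) := by
    intro w
    induction w with
    | zero => simp
    | add u v hu hv => simp only [map_add, hu, hv]
    | tmul u v =>
      rw [← map_assoc_symm_tmul (Z := A) H.T₂.toLinearMap c (H.T₁ (u ⊗ₜ v)), H.coassoc]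
      simp
  have h := key (H.T₁.symm (a ⊗ₜ b))
  rw [LinearEquiv.apply_symm_apply] at h
  have hinj : Function.Injective
      (map LinearMap.id H.T₁.toLinearMap : A ⊗[ℂ] (A ⊗[ℂ] A) →ₗ[ℂ] _) :=
    (TensorProduct.congr (LinearEquiv.refl ℂ A) H.T₁).injective
  apply hinj
  rw [h, map_map', TensorProduct.map_tmul]
  simp only [LinearMap.comp_apply, TensorProduct.mk_apply, LinearEquiv.coe_coe,
    LinearMap.id_apply, LinearMap.id_comp]
  rw [assoc_tmul_eq]
  congr 2
  ext x
  simp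

/-- Multiply the last two legs in `map_T₁_symm_T₂`: the right side becomes `(c ⊗ 1)T₁(z)` with `z =
T₁⁻¹(a ⊗ b)`, which is `ca ⊗ b`. So `m T₁⁻¹(· ⊗ b)` behaves like a counit times `b`. -/
theorem map_mul'_T₁_symm_T₂ (H : MultiplierHopfAlgebra A) (b : A) (w : A ⊗[ℂ] A) :
    map LinearMap.id (LinearMap.mul' ℂ A ∘ₗ H.T₁.symm.toLinearMap ∘ₗ
      (TensorProduct.mk ℂ A A).flip b) (H.T₂ w) = LinearMap.mul' ℂ A w ⊗ₜ b := by
  induction w with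
  | zero => simp
  | add u v hu hv => simp only [map_add, hu, hv, TensorProduct.add_tmul]
  | tmul c a =>
    have h := congrArg (map (LinearMap.id : A →ₗ[ℂ] A) (LinearMap.mul' ℂ A))
      (H.map_T₁_symm_T₂ c a b)
    rw [map_map'] at h
    refine h.trans ?_
    have h2 : ∀ z : A ⊗[ℂ] A, map LinearMap.id (LinearMap.mul' ℂ A)
        (TensorProduct.assoc ℂ A A A
          (map (H.T₂.toLinearMap ∘ₗ TensorProduct.mk ℂ A A c) LinearMap.id z)) =
        map (mulLeft ℂ c) LinearMap.id (H.T₁ z) := by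
      intro z
      induction z with
      | zero => simp
      | add u v hu hv => simp only [map_add, hu, hv]
      | tmul u v =>
        rw [← H.mulRight_T₂]
        simp only [TensorProduct.map_tmul, LinearMap.comp_apply, TensorProduct.mk_apply,
          LinearEquiv.coe_coe, LinearMap.id_apply]
        rw [map_assoc_tmul]
        rfl
    rw [h2, LinearEquiv.apply_symm_apply]
    simp

/-- As `T₂` is onto, the previous identity gives `a₀ ⊗ m T₁⁻¹(a ⊗ b) = x ⊗ b` with `x` independent
of `b`. A functional with value 1 at `a₀` turns `x` into the scalar `ε(a)`. -/
theorem exists_counit (H : MultiplierHopfAlgebra A) :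
    ∃ ε : A →ₗ[ℂ] ℂ, ∀ a b : A, LinearMap.mul' ℂ A (H.T₁.symm (a ⊗ₜ b)) = ε a • b := by
  rcases subsingleton_or_nontrivial A with hA | hA
  · exact ⟨0, fun a b => Subsingleton.elim _ _⟩
  obtain ⟨a₀, ha₀⟩ := exists_ne (0 : A)
  obtain ⟨φ, hφ⟩ := Module.Projective.exists_dual_eq_one ℂ ha₀
  refine ⟨φ ∘ₗ LinearMap.mul' ℂ A ∘ₗ H.T₂.symm.toLinearMap ∘ₗ
    TensorProduct.mk ℂ A A a₀, ?_⟩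
  intro a b
  have h := congrArg (TensorProduct.lid ℂ A ∘ map φ LinearMap.id)
    (H.map_mul'_T₁_symm_T₂ b (H.T₂.symm (a₀ ⊗ₜ a)))
  rw [LinearEquiv.apply_symm_apply] at h
  simpa [hφ] using h

/-- The counit `ε` of a multiplier Hopf algebra. -/
def counit (H : MultiplierHopfAlgebra A) : A →ₗ[ℂ] ℂ := H.exists_counit.choose

theorem mul'_T₁_symm_tmul (H : MultiplierHopfAlgebra A) (a b : A) :
    LinearMap.mul' ℂ A (H.T₁.symm (a ⊗ₜ b)) = H.counit a • b :=
  H.exists_counit.choose_spec a b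

/-- `ε(a₁)a₂ b = ab`. -/
theorem counit_T₁ (H : MultiplierHopfAlgebra A) (w : A ⊗[ℂ] A) :
    TensorProduct.lid ℂ A (map H.counit LinearMap.id (H.T₁ w)) = LinearMap.mul' ℂ A w := by
  obtain ⟨z, rfl⟩ := H.T₁.symm.surjective w
  rw [LinearEquiv.apply_symm_apply]
  induction z with
  | zero => simp
  | add u v hu hv => simp only [map_add, hu, hv]
  | tmul a b => rw [H.mul'_T₁_symm_tmul]; simp

/-- `c a₁ ε(a₂) = ca`. -/
theorem counit_T₂ (H : MultiplierHopfAlgebra A) (w : A ⊗[ℂ] A) :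
    TensorProduct.rid ℂ A (map LinearMap.id H.counit (H.T₂ w)) = LinearMap.mul' ℂ A w := by
  rcases subsingleton_or_nontrivial A with hA | hA
  · exact Subsingleton.elim _ _
  refine tmul_right_cancel (Y := A) fun b => ?_
  rw [← H.map_mul'_T₁_symm_T₂ b w]
  generalize H.T₂ w = z
  induction z with
  | zero => simp
  | add u v hu hv => simp only [map_add, TensorProduct.add_tmul, hu, hv]
  | tmul u v => simp [H.mul'_T₁_symm_tmul, TensorProduct.smul_tmul]

/-- If `ε` vanished, so would `m T₁⁻¹`, hence the whole product of `A`, against non-degeneracy. -/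
theorem exists_counit_eq_one (H : MultiplierHopfAlgebra A) [Nontrivial A] :
    ∃ a, H.counit a = 1 := by
  by_contra hc
  have h0 : ∀ a, H.counit a = 0 := by
    intro a
    by_contra ha
    exact hc ⟨(H.counit a)⁻¹ • a, by simp [ha]⟩
  obtain ⟨a, ha⟩ := exists_ne (0 : A)
  refine ha (H.eq_zero_of_mul_left a fun x => ?_)
  have h := H.mul'_T₁_symm_tmul
  have h' : ∀ w, LinearMap.mul' ℂ A (H.T₁.symm w) = 0 := by
    intro w
    induction w with
    | zero => simp
    | add u v hu hv => simp only [map_add, hu, hv, add_zero]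
    | tmul u v => rw [h, h0, zero_smul]
  simpa using h' (H.T₁ (x ⊗ₜ a))

/-- If `ε(c) = 1`, then `m` sends `T₁⁻¹(c ⊗ a)` to `a`. -/
theorem mul'_surjective (H : MultiplierHopfAlgebra A) :
    Function.Surjective (LinearMap.mul' ℂ A) := by
  intro a
  rcases subsingleton_or_nontrivial A with hA | hA
  · exact ⟨0, Subsingleton.elim _ _⟩
  obtain ⟨c, hc⟩ := H.exists_counit_eq_one
  exact ⟨H.T₁.symm (c ⊗ₜ a), by rw [H.mul'_T₁_symm_tmul, hc, one_smul]⟩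

/-- The map `ι ⊗ ε` turns right multiplication by `Δ(b)` into right multiplication by `b`. Hence it
sends `(p ⊗ a)Δ(b) = (1 ⊗ a)T₂(p ⊗ b)` to `ε(a)pb`, which is `ε(a)` times its value on `T₂(p ⊗ b)`.
Since `T₂` is onto, `T₂(p ⊗ b)` may be replaced by any `c ⊗ b`. -/
theorem counit_mul (H : MultiplierHopfAlgebra A) (a b : A) :
    H.counit (a * b) = H.counit a * H.counit b := by
  rcases subsingleton_or_nontrivial A with hA | hA
  · simp [Subsingleton.elim a 0]
  have hT : ∀ w : A ⊗[ℂ] A, TensorProduct.rid ℂ A (map LinearMap.id H.counit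
      (map LinearMap.id (mulLeft ℂ a) (H.T₂ w))) =
      H.counit a • TensorProduct.rid ℂ A (map LinearMap.id H.counit (H.T₂ w)) := by
    intro w
    induction w with
    | zero => simp
    | add u v hu hv => simp only [map_add, smul_add, hu, hv]
    | tmul p b =>
      have h : ∀ z : A ⊗[ℂ] A, TensorProduct.rid ℂ A (map LinearMap.id H.counit
          (rmul (H.comul b) z)) =
          TensorProduct.rid ℂ A (map LinearMap.id H.counit z) * b := by
        intro z
        obtain ⟨z, rfl⟩ := H.T₂.surjective z
        induction z with
        | zero => simp
        | add u v hu hv => simp only [map_add, add_mul, hu, hv]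
        | tmul u v =>
          rw [← H.T₂_mul, H.counit_T₂, H.counit_T₂]
          simp [mul_assoc]
      rw [H.mulLeft_T₂, h, H.counit_T₂]
      simp [smul_mul_assoc]
  obtain ⟨c, hc⟩ := exists_ne (0 : A)
  have h := hT (H.T₂.symm (c ⊗ₜ b))
  rw [LinearEquiv.apply_symm_apply] at h
  simp only [TensorProduct.map_tmul, LinearMap.id_apply, LinearMap.mulLeft_apply,
    TensorProduct.rid_tmul, smul_smul] at h
  exact smul_left_injective ℂ hc h

/-- The map `b ↦ S(a)b`, where `S` is the antipode: `S(a)b = (ε ⊗ ι)T₁⁻¹(a ⊗ b)`. -/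
def antipodeMul (H : MultiplierHopfAlgebra A) : A →ₗ[ℂ] A →ₗ[ℂ] A :=
  TensorProduct.curry ((TensorProduct.lid ℂ A).toLinearMap ∘ₗ map H.counit LinearMap.id ∘ₗ
    H.T₁.symm.toLinearMap)

theorem antipodeMul_apply (H : MultiplierHopfAlgebra A) (a b : A) :
    H.antipodeMul a b =
      TensorProduct.lid ℂ A (map H.counit LinearMap.id (H.T₁.symm (a ⊗ₜ b))) := rfl

/-- `c a₁ ⊗ S(a₂)b = (c ⊗ 1)T₁⁻¹(a ⊗ b)`. -/
theorem map_antipodeMul_T₂ (H : MultiplierHopfAlgebra A) (c a b : A) :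
    map LinearMap.id (H.antipodeMul.flip b) (H.T₂ (c ⊗ₜ a)) =
      map (mulLeft ℂ c) LinearMap.id (H.T₁.symm (a ⊗ₜ b)) := by
  have h := congrArg (map (LinearMap.id : A →ₗ[ℂ] A) ((TensorProduct.lid ℂ A).toLinearMap ∘ₗ
    map H.counit LinearMap.id)) (H.map_T₁_symm_T₂ c a b)
  rw [map_map'] at h
  refine h.trans ?_
  generalize H.T₁.symm (a ⊗ₜ b) = z
  induction z with
  | zero => simp
  | add u v hu hv => simp only [map_add, hu, hv]
  | tmul u v =>
    simp only [TensorProduct.map_tmul, LinearMap.comp_apply, TensorProduct.mk_apply,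
      LinearEquiv.coe_coe, LinearMap.id_apply]
    rw [map_assoc_tmul]
    have h2 := H.counit_T₂ (c ⊗ₜ u)
    rw [LinearMap.mul'_apply] at h2
    rw [LinearMap.mulLeft_apply, ← h2]
    generalize H.T₂ (c ⊗ₜ u) = y
    induction y with
    | zero => simp
    | add u v hu hv => simp only [map_add, TensorProduct.add_tmul, hu, hv]
    | tmul x y => simp [TensorProduct.smul_tmul]

/-- `c a₁ S(a₂)b = ε(a)cb`. -/
theorem mul'_map_antipodeMul_T₂ (H : MultiplierHopfAlgebra A) (c a b : A) :
    LinearMap.mul' ℂ A (map LinearMap.id (H.antipodeMul.flip b) (H.T₂ (c ⊗ₜ a))) =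
      H.counit a • (c * b) := by
  rw [H.map_antipodeMul_T₂, ← mul_smul_comm, ← H.mul'_T₁_symm_tmul]
  generalize H.T₁.symm (a ⊗ₜ b) = z
  induction z with
  | zero => simp
  | add u v hu hv => simp only [map_add, mul_add, hu, hv]
  | tmul u v => simp [mul_assoc]

end MultiplierHopfAlgebra

/-! ### The map `T₄` and the opposite counit in the regular case -/

namespace RegularMultiplierHopfAlgebra

/-- `((1 ⊗ e)Δ(a))(1 ⊗ b) = (1 ⊗ e)(Δ(a)(1 ⊗ b))`. -/
theorem mulRight_T₄ (H : RegularMultiplierHopfAlgebra A) (e a b : A) :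
    map LinearMap.id (mulRight ℂ b) (H.T₄ (e ⊗ₜ a)) =
      map LinearMap.id (mulLeft ℂ e) (H.T₁ (a ⊗ₜ b)) := by
  apply H.cancel_left
  intro q
  rw [RightModuleAlgebra.map_left_right, H.mulLeft_T₄, H.mulRight_rmul, map_map']
  rfl

theorem counit_T₄ (H : RegularMultiplierHopfAlgebra A) (w : A ⊗[ℂ] A) :
    TensorProduct.lid ℂ A (map H.opp.counit LinearMap.id (H.T₄ w)) =
      LinearMap.mul' ℂ A w := by
  rw [← H.opp.counit_T₂, T₄]
  simp only [LinearMap.comp_apply, LinearEquiv.coe_coe]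
  generalize H.opp.T₂ w = z
  induction z with
  | zero => simp
  | add u v hu hv => simp only [map_add, hu, hv]
  | tmul u v => simp

/-- Both counits satisfy `(ε ⊗ ι)T₁ = m`, and `T₁` is onto. For the opposite counit the identity is
first known for `T₄`; covering with `1 ⊗ e` from the left transfers it to `T₁`. -/
theorem counit_opp (H : RegularMultiplierHopfAlgebra A) : H.opp.counit = H.counit := by
  rcases subsingleton_or_nontrivial A with hA | hA
  · ext a
    simp [Subsingleton.elim a 0]
  have comm : ∀ (f : A →ₗ[ℂ] ℂ) (g : A →ₗ[ℂ] A) (z : A ⊗[ℂ] A),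
      TensorProduct.lid ℂ A (map f LinearMap.id (map LinearMap.id g z)) =
        g (TensorProduct.lid ℂ A (map f LinearMap.id z)) := by
    intro f g z
    induction z with
    | zero => simp
    | add u v hu hv => simp only [map_add, hu, hv]
    | tmul u v => simp
  have h : ∀ w : A ⊗[ℂ] A, TensorProduct.lid ℂ A (map H.opp.counit LinearMap.id (H.T₁ w)) =
      TensorProduct.lid ℂ A (map H.counit LinearMap.id (H.T₁ w)) := by
    intro w
    rw [H.counit_T₁]
    induction w with
    | zero => simp
    | add u v hu hv => simp only [map_add, hu, hv]
    | tmul a b =>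
      rw [← sub_eq_zero]
      apply H.eq_zero_of_mul_left
      intro e
      have h := congrArg (TensorProduct.lid ℂ A ∘ map H.opp.counit LinearMap.id)
        (H.mulRight_T₄ e a b)
      simp only [Function.comp_apply, comm, H.counit_T₄, LinearMap.mul'_apply,
        LinearMap.mulLeft_apply, LinearMap.mulRight_apply] at h
      rw [mul_sub, ← h, LinearMap.mul'_apply, mul_assoc, sub_self]
  obtain ⟨c, hc⟩ := exists_ne (0 : A)
  ext a
  have h2 := h (H.T₁.symm (a ⊗ₜ c))
  rw [LinearEquiv.apply_symm_apply] at h2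
  exact smul_left_injective ℂ hc (by simpa using h2)

theorem T₄_mul (H : RegularMultiplierHopfAlgebra A) (p a a' : A) :
    H.T₄ (p ⊗ₜ (a * a')) = rmul (H.comul a') (H.T₄ (p ⊗ₜ a)) := by
  have h := H.opp.T₂_mul p a a'
  rw [H.opp_comul] at h
  simp [T₄, h, flipMultiplier]

/-- The linear map `(1 ⊗ a)Δ(b)` is bijective. -/
def T₄Equiv (H : RegularMultiplierHopfAlgebra A) : (A ⊗[ℂ] A) ≃ₗ[ℂ] (A ⊗[ℂ] A) :=
  H.opp.T₂.trans (TensorProduct.comm ℂ A A)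

@[simp] theorem T₄Equiv_apply (H : RegularMultiplierHopfAlgebra A) (w : A ⊗[ℂ] A) :
    H.T₄Equiv w = H.T₄ w := rfl

theorem T₄_mul_left (H : RegularMultiplierHopfAlgebra A) (x p a : A) :
    H.T₄ ((x * p) ⊗ₜ a) = map LinearMap.id (mulLeft ℂ x) (H.T₄ (p ⊗ₜ a)) := by
  simp only [T₄, LinearMap.comp_apply, LinearEquiv.coe_coe, H.opp.mulLeft_T₂_left]
  rw [TensorProduct.map_comm]

end RegularMultiplierHopfAlgebra

end

/-! ### Bijectivity of the twist map `R` -/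

section

variable {A B V : Type*}
  [NonUnitalRing A] [Module ℂ A] [IsScalarTower ℂ A A] [SMulCommClass ℂ A A]
  [NonUnitalRing B] [Module ℂ B] [IsScalarTower ℂ B B] [SMulCommClass ℂ B B]
  [AddCommGroup V] [Module ℂ V]

namespace RegularMultiplierHopfAlgebra

/-- With `W = T₄⁻¹`: `W(a ⊗ e)(1 ⊗ q) = (e ⊗ 1)W((a ⊗ 1)Δ(q))`. -/
theorem mulRight_T₄Equiv_symm (H : RegularMultiplierHopfAlgebra A) (a e q : A) :
    map LinearMap.id (mulRight ℂ q) (H.T₄Equiv.symm (a ⊗ₜ e)) =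
      map (mulLeft ℂ e) LinearMap.id (H.T₄Equiv.symm (H.T₂ (a ⊗ₜ q))) := by
  have h1 : ∀ z : A ⊗[ℂ] A, H.T₄ (map LinearMap.id (mulRight ℂ q) z) =
      rmul (H.comul q) (H.T₄ z) := by
    intro z
    induction z with
    | zero => simp
    | add u v hu hv => simp only [map_add, hu, hv]
    | tmul u v => simp [H.T₄_mul]
  have h2 : ∀ z : A ⊗[ℂ] A, H.T₄ (map (mulLeft ℂ e) LinearMap.id z) =
      map LinearMap.id (mulLeft ℂ e) (H.T₄ z) := by
    intro z
    induction z with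
    | zero => simp
    | add u v hu hv => simp only [map_add, hu, hv]
    | tmul u v => simp [H.T₄_mul_left]
  -- `T₄` turns right multiplication by `1 ⊗ q` into right multiplication by `Δ(q)`, and left
  -- multiplication by `e ⊗ 1` into that by `1 ⊗ e`. Both sides therefore have the image `(a ⊗
  -- e)Δ(q)`.
  apply H.T₄Equiv.injective
  rw [H.T₄Equiv_apply, H.T₄Equiv_apply, h1, h2, ← H.T₄Equiv_apply, ← H.T₄Equiv_apply,
    LinearEquiv.apply_symm_apply, LinearEquiv.apply_symm_apply, H.mulLeft_T₂]

end RegularMultiplierHopfAlgebra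

namespace RightModuleAlgebra

variable {HA : RegularMultiplierHopfAlgebra A}

/-- The map `(b ⊗ x) ⊗ a ↦ ∑ a₁ ⊗ (b ⊗ x a₂)`, which is the twist map of the free module
`B ⊗ A`. -/
def freeTwist (_α : RightModuleAlgebra B HA) :
    (B ⊗[ℂ] A) ⊗[ℂ] A ≃ₗ[ℂ] B ⊗[ℂ] (A ⊗[ℂ] A) :=
  (TensorProduct.assoc ℂ B A A).trans (TensorProduct.congr (LinearEquiv.refl ℂ B) HA.T₄Equiv)

/-- The action `b ⊗ (x ⊗ y) ↦ x ⊗ (b ◁ y)`. -/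
def actSnd (α : RightModuleAlgebra B HA) : B ⊗[ℂ] (A ⊗[ℂ] A) →ₗ[ℂ] A ⊗[ℂ] B :=
  TensorProduct.lift (LinearMap.lTensorHom A ∘ₗ α.act)

theorem actSnd_tmul (α : RightModuleAlgebra B HA) (b : B) (z : A ⊗[ℂ] A) :
    α.actSnd (b ⊗ₜ z) = map LinearMap.id (α.act b) z := rfl

/-- Naturality of the twist along the surjective action map `B ⊗ A → B`, whose source is a free
module with a bijective twist. -/
theorem twist_map_act (α : RightModuleAlgebra B HA) (z : (B ⊗[ℂ] A) ⊗[ℂ] A) :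
    α.twist (map (TensorProduct.lift α.act) LinearMap.id z) = α.actSnd (α.freeTwist z) := by
  have h : α.twist ∘ₗ map (TensorProduct.lift α.act) LinearMap.id =
      α.actSnd ∘ₗ α.freeTwist.toLinearMap := by
    ext c e a
    simp [freeTwist, twist_act, actSnd_tmul]
  exact LinearMap.congr_fun h z

theorem lift_act_surjective (α : RightModuleAlgebra B HA) :
    Function.Surjective (TensorProduct.lift α.act) := by
  intro b
  induction b using α.act_induction with
  | h0 => exact ⟨0, map_zero _⟩
  | hadd b b' h h' =>
    obtain ⟨z, rfl⟩ := h
    obtain ⟨z', rfl⟩ := h'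
    exact ⟨z + z', map_add _ _ _⟩
  | hact c e => exact ⟨c ⊗ₜ e, by simp⟩

theorem actSnd_surjective (α : RightModuleAlgebra B HA) : Function.Surjective α.actSnd := by
  intro z
  induction z with
  | zero => exact ⟨0, map_zero _⟩
  | add u v hu hv =>
    obtain ⟨z, rfl⟩ := hu
    obtain ⟨z', rfl⟩ := hv
    exact ⟨z + z', map_add _ _ _⟩
  | tmul a b =>
    obtain ⟨w, rfl⟩ := α.lift_act_surjective b
    induction w with
    | zero => exact ⟨0, by simp⟩
    | add u v hu hv =>
      obtain ⟨z, hz⟩ := hu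
      obtain ⟨z', hz'⟩ := hv
      exact ⟨z + z', by simp [hz, hz', TensorProduct.tmul_add]⟩
    | tmul c e => exact ⟨c ⊗ₜ (a ⊗ₜ e), by simp [actSnd_tmul]⟩

/-- The map `a ⊗ b ↦ ∑ (b ◁ S⁻¹(a₂)) ⊗ a₁ q`. -/
def untwist (α : RightModuleAlgebra B HA) (q : A) : A ⊗[ℂ] B →ₗ[ℂ] B ⊗[ℂ] A :=
  TensorProduct.lift (LinearMap.flip
    (LinearMap.lcomp ℂ (B ⊗[ℂ] A) (HA.T₄Equiv.symm.toLinearMap ∘ₗ HA.T₂.toLinearMap ∘ₗ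
      (TensorProduct.mk ℂ A A).flip q) ∘ₗ LinearMap.rTensorHom A ∘ₗ α.act))

theorem untwist_tmul (α : RightModuleAlgebra B HA) (q a : A) (b : B) :
    α.untwist q (a ⊗ₜ b) =
      map (α.act b) LinearMap.id (HA.T₄Equiv.symm (HA.T₂ (a ⊗ₜ q))) := rfl

/-- The inverse of the free twist descends along `actSnd` once it is covered by `1 ⊗ q`: by
`mulRight_T₄Equiv_symm` the covering moves `e` to the left of the factor acting on `c`, so `c` and
`e` enter only through `c ◁ e`. The kernel of `actSnd` is thus harmless, which gives injectivity of
`R`. -/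
theorem mulRight_map_act (α : RightModuleAlgebra B HA) (q : A) (u : B ⊗[ℂ] (A ⊗[ℂ] A)) :
    map LinearMap.id (mulRight ℂ q)
        (map (TensorProduct.lift α.act) LinearMap.id (α.freeTwist.symm u)) =
      α.untwist q (α.actSnd u) := by
  induction u with
  | zero => simp
  | add u v hu hv => simp only [map_add, hu, hv]
  | tmul c w =>
    induction w with
    | zero => simp
    | add u v hu hv => simp only [TensorProduct.tmul_add, map_add, hu, hv]
    | tmul a e =>
      rw [actSnd_tmul, TensorProduct.map_tmul, untwist_tmul, LinearMap.id_apply]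
      have h1 : ∀ z : A ⊗[ℂ] A, map LinearMap.id (mulRight ℂ q)
          (map (TensorProduct.lift α.act) LinearMap.id
            ((TensorProduct.assoc ℂ B A A).symm (c ⊗ₜ z))) =
          map (α.act c) LinearMap.id (map LinearMap.id (mulRight ℂ q) z) := by
        intro z
        rw [map_assoc_symm_tmul, map_map', map_map']
        congr 2
      have h2 : α.freeTwist.symm (c ⊗ₜ (a ⊗ₜ e)) =
          (TensorProduct.assoc ℂ B A A).symm (c ⊗ₜ HA.T₄Equiv.symm (a ⊗ₜ e)) := by
        simp [freeTwist]
      have h3 : α.act (α.act c e) = α.act c ∘ₗ mulLeft ℂ e := by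
        ext x
        simp [α.act_mul]
      rw [h2, h1, HA.mulRight_T₄Equiv_symm, map_map', h3]
      rfl

theorem twist_bijective (α : RightModuleAlgebra B HA) : Function.Bijective α.twist := by
  constructor
  · rw [injective_iff_map_eq_zero]
    intro z hz
    obtain ⟨z, rfl⟩ := TensorProduct.map_surjective α.lift_act_surjective
      (show Function.Surjective (LinearMap.id : A →ₗ[ℂ] A) from Function.surjective_id) z
    change α.twist (map (TensorProduct.lift α.act) LinearMap.id z) = 0 at hz
    change map (TensorProduct.lift α.act) LinearMap.id z = 0
    apply HA.cancel_right
    intro q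
    rw [map_zero]
    obtain ⟨u, rfl⟩ := α.freeTwist.symm.surjective z
    rw [α.twist_map_act, LinearEquiv.apply_symm_apply] at hz
    rw [α.mulRight_map_act, hz, map_zero]
  · intro z
    obtain ⟨u, rfl⟩ := α.actSnd_surjective z
    exact ⟨_, (α.twist_map_act _).trans (by rw [LinearEquiv.apply_symm_apply])⟩

/-- The twist map as a linear equivalence. -/
def twistEquiv (α : RightModuleAlgebra B HA) : (B ⊗[ℂ] A) ≃ₗ[ℂ] (A ⊗[ℂ] B) :=
  LinearEquiv.ofBijective α.twist α.twist_bijective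

@[simp] theorem twistEquiv_apply (α : RightModuleAlgebra B HA) (z : B ⊗[ℂ] A) :
    α.twistEquiv z = α.twist z := rfl

end RightModuleAlgebra

end

/-! ### Cancellation lemmas and the span of the elements `S(a)b` -/

section

namespace MultiplierHopfAlgebra

variable {B V : Type*}
  [NonUnitalRing B] [Module ℂ B] [IsScalarTower ℂ B B] [SMulCommClass ℂ B B]
  [AddCommGroup V] [Module ℂ V]

theorem cancel_mulRight (H : MultiplierHopfAlgebra B) {z w : B ⊗[ℂ] V}
    (h : ∀ p : B, map (mulRight ℂ p) LinearMap.id z = map (mulRight ℂ p) LinearMap.id w) :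
    z = w := by
  rw [← sub_eq_zero]
  apply eq_zero_of_map_left (fun p : B => mulRight ℂ p) H.eq_zero_of_mul_right
  intro p
  rw [map_sub, h p, sub_self]

theorem cancel_mulRight₁ (H : MultiplierHopfAlgebra B) {z w : (B ⊗[ℂ] B) ⊗[ℂ] V}
    (h : ∀ p : B, map (map (mulRight ℂ p) LinearMap.id) LinearMap.id z =
      map (map (mulRight ℂ p) LinearMap.id) LinearMap.id w) : z = w := by
  rw [← sub_eq_zero]
  apply eq_zero_of_map_left (fun p : B => map (mulRight ℂ p) LinearMap.id)
  · exact eq_zero_of_map_left (fun p : B => mulRight ℂ p) H.eq_zero_of_mul_right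
  · intro p
    rw [map_sub, h p, sub_self]

theorem cancel_mulRight₂ (H : MultiplierHopfAlgebra B) {z w : (B ⊗[ℂ] B) ⊗[ℂ] V}
    (h : ∀ p : B, map (map LinearMap.id (mulRight ℂ p)) LinearMap.id z =
      map (map LinearMap.id (mulRight ℂ p)) LinearMap.id w) : z = w := by
  rw [← sub_eq_zero]
  apply eq_zero_of_map_left (fun p : B => map LinearMap.id (mulRight ℂ p))
  · exact eq_zero_of_map_right (fun p : B => mulRight ℂ p) H.eq_zero_of_mul_right
  · intro p
    rw [map_sub, h p, sub_self]

theorem cancel_mulLeft_right (H : MultiplierHopfAlgebra B) {z w : V ⊗[ℂ] B}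
    (h : ∀ p : B, map LinearMap.id (mulLeft ℂ p) z = map LinearMap.id (mulLeft ℂ p) w) :
    z = w := by
  rw [← sub_eq_zero]
  apply eq_zero_of_map_right (fun p : B => mulLeft ℂ p) H.eq_zero_of_mul_left
  intro p
  rw [map_sub, h p, sub_self]

/-- Since `T₁` is onto, any `w` is a sum of elements `Δ(s)(1 ⊗ t)`, and so `wy` is a sum of elements
`Δ(s)u`. Non-degeneracy then removes `y` and `w` in turn. -/
theorem eq_zero_of_mul_lmul_comul (H : MultiplierHopfAlgebra B) (z : B ⊗[ℂ] B)
    (h : ∀ (p : B) (u : B ⊗[ℂ] B), z * lmul (H.comul p) u = 0) : z = 0 := by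
  apply H.mul_right_inj'
  intro w
  rw [zero_mul]
  apply H.mul_right_inj'
  intro y
  obtain ⟨w, rfl⟩ := H.T₁.surjective w
  rw [zero_mul]
  induction w with
  | zero => simp
  | add u v hu hv => simp only [map_add, mul_add, add_mul, hu, hv, add_zero]
  | tmul s t =>
    induction y with
    | zero => simp
    | add u v hu hv => simp only [mul_add, hu, hv, add_zero]
    | tmul x y => rw [mul_assoc, H.T₁_mul, h]

theorem cancel_lmul_comul (H : MultiplierHopfAlgebra B) {z w : (B ⊗[ℂ] B) ⊗[ℂ] V}
    (h : ∀ (p : B) (u : B ⊗[ℂ] B), map (mulRight ℂ (lmul (H.comul p) u)) LinearMap.id z =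
      map (mulRight ℂ (lmul (H.comul p) u)) LinearMap.id w) : z = w := by
  rw [← sub_eq_zero]
  apply eq_zero_of_map_left (fun q : B × (B ⊗[ℂ] B) => mulRight ℂ (lmul (H.comul q.1) q.2))
  · exact fun a ha => H.eq_zero_of_mul_lmul_comul a fun p u => ha (p, u)
  · intro q
    rw [map_sub, h q.1 q.2, sub_self]

/-- The map `(ε ⊗ ι)T₁⁻¹` sends `T₁(a ⊗ b)` to `ε(a)b`, and `ε` takes the value 1 unless `B = 0`. -/
theorem lift_antipodeMul_surjective (H : MultiplierHopfAlgebra B) :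
    Function.Surjective (TensorProduct.lift H.antipodeMul) := by
  intro b
  rcases subsingleton_or_nontrivial B with hB | hB
  · exact ⟨0, Subsingleton.elim _ _⟩
  obtain ⟨a, ha⟩ := H.exists_counit_eq_one
  refine ⟨H.T₁ (a ⊗ₜ b), ?_⟩
  have h : TensorProduct.lift H.antipodeMul = (TensorProduct.lid ℂ B).toLinearMap ∘ₗ
      map H.counit LinearMap.id ∘ₗ H.T₁.symm.toLinearMap :=
    TensorProduct.ext' fun _ _ => rfl
  rw [h]
  simp [ha]

end MultiplierHopfAlgebra

/-! ### Bijectivity of the cotwist map `T` -/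

namespace LeftCoaction

variable {B V : Type*}
  [NonUnitalRing B] [Module ℂ B] [IsScalarTower ℂ B B] [SMulCommClass ℂ B B]
  [AddCommGroup V] [Module ℂ V]
  {HB : RegularMultiplierHopfAlgebra B} (δ : LeftCoaction V HB)

/-- The map `b ↦ (b ⊗ 1)Γ(v)`. -/
def leftCover : V →ₗ[ℂ] B →ₗ[ℂ] B ⊗[ℂ] V :=
  LinearMap.snd ℂ (B →ₗ[ℂ] B ⊗[ℂ] V) _ ∘ₗ (CompletedModule B V).subtype ∘ₗ δ.Γ

theorem mulLeft_cotwist (v : V) (b c : B) :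
    map (mulLeft ℂ c) LinearMap.id (cotwist δ.Γ (v ⊗ₜ b)) =
      map (mulRight ℂ b) LinearMap.id (δ.leftCover v c) :=
  (δ.Γ v).2 c b

theorem cotwist_mul (v : V) (b x : B) :
    cotwist δ.Γ (v ⊗ₜ (b * x)) = map (mulRight ℂ x) LinearMap.id (cotwist δ.Γ (v ⊗ₜ b)) := by
  apply HB.cancel_left
  intro c
  have h : map (mulLeft ℂ c) LinearMap.id
      (map (mulRight ℂ x) LinearMap.id (cotwist δ.Γ (v ⊗ₜ b))) =
      map (mulRight ℂ x) LinearMap.id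
        (map (mulLeft ℂ c) LinearMap.id (cotwist δ.Γ (v ⊗ₜ b))) := by
    rw [map_map', map_map']
    congr 2
    ext y
    simp [mul_assoc]
  rw [h, δ.mulLeft_cotwist, δ.mulLeft_cotwist, map_map', LinearMap.mulRight_mul]
  rfl

theorem cotwist_mulRight (x : B) (z : V ⊗[ℂ] B) :
    cotwist δ.Γ (map LinearMap.id (mulRight ℂ x) z) =
      map (mulRight ℂ x) LinearMap.id (cotwist δ.Γ z) := by
  induction z with
  | zero => simp
  | add u v hu hv => simp only [map_add, hu, hv]
  | tmul u v => rw [TensorProduct.map_tmul, ← δ.cotwist_mul]; rfl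

/-- By non-degeneracy of `B`, an element of `M₀(B ⊗ V)` is determined by its products with `b ⊗ 1`
from the right alone, so injectivity of `Γ` can be tested there. -/
theorem eq_of_cotwist_eq {v v' : V}
    (h : ∀ y : B, cotwist δ.Γ (v ⊗ₜ y) = cotwist δ.Γ (v' ⊗ₜ y)) : v = v' := by
  apply δ.injective
  apply Subtype.ext
  refine Prod.ext (LinearMap.ext h) (LinearMap.ext fun c => ?_)
  apply HB.cancel_mulRight
  intro b
  have h1 := δ.mulLeft_cotwist v b c
  have h2 := δ.mulLeft_cotwist v' b c
  rw [h b, h2] at h1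
  exact h1.symm

/-- The map `b ⊗ b' ↦ ((ι ⊗ Γ)Γ(v))(b ⊗ b' ⊗ 1)`. -/
def cotwist₂ : V →ₗ[ℂ] B ⊗[ℂ] B →ₗ[ℂ] (B ⊗[ℂ] B) ⊗[ℂ] V :=
  TensorProduct.curry ((TensorProduct.assoc ℂ B B V).symm.toLinearMap ∘ₗ
    map LinearMap.id (cotwist δ.Γ) ∘ₗ (TensorProduct.assoc ℂ B V B).toLinearMap ∘ₗ
      map (cotwist δ.Γ) LinearMap.id ∘ₗ (TensorProduct.assoc ℂ V B B).symm.toLinearMap)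

theorem cotwist₂_tmul (v : V) (b b' : B) :
    δ.cotwist₂ v (b ⊗ₜ b') = (TensorProduct.assoc ℂ B B V).symm
      (map LinearMap.id (cotwist δ.Γ ∘ₗ (TensorProduct.mk ℂ V B).flip b')
        (cotwist δ.Γ (v ⊗ₜ b))) := by
  rw [← map_assoc_tmul]
  simp [cotwist₂]

theorem cotwist₂_comul (v : V) (p : B) (w : B ⊗[ℂ] B) :
    δ.cotwist₂ v (lmul (HB.comul p) w) =
      map (LinearMap.applyₗ w ∘ₗ lmul ∘ₗ (HB.comul : B →ₗ[ℂ] MultiplierAlgebra (B ⊗[ℂ] B)))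
        LinearMap.id (cotwist δ.Γ (v ⊗ₜ p)) := by
  have h := congrArg (TensorProduct.assoc ℂ B B V).symm (δ.coassoc v p w)
  rw [LinearEquiv.symm_apply_apply] at h
  exact h

theorem cotwist₂_mulRight₁ (v : V) (x : B) (w : B ⊗[ℂ] B) :
    δ.cotwist₂ v (map (mulRight ℂ x) LinearMap.id w) =
      map (map (mulRight ℂ x) LinearMap.id) LinearMap.id (δ.cotwist₂ v w) := by
  induction w with
  | zero => simp
  | add u v hu hv => simp only [map_add, hu, hv]
  | tmul b b' =>
    rw [TensorProduct.map_tmul, cotwist₂_tmul, cotwist₂_tmul, LinearMap.mulRight_apply,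
      δ.cotwist_mul]
    generalize cotwist δ.Γ (v ⊗ₜ b) = z
    induction z with
    | zero => simp
    | add u v hu hv => simp only [map_add, hu, hv]
    | tmul u v =>
      simp only [TensorProduct.map_tmul, LinearMap.id_apply, LinearMap.comp_apply]
      generalize cotwist δ.Γ _ = y
      induction y with
      | zero => simp
      | add u v hu hv => simp only [map_add, TensorProduct.tmul_add, hu, hv]
      | tmul u v => simp

theorem cotwist₂_mulRight₂ (v : V) (x : B) (w : B ⊗[ℂ] B) :
    δ.cotwist₂ v (map LinearMap.id (mulRight ℂ x) w) =
      map (map LinearMap.id (mulRight ℂ x)) LinearMap.id (δ.cotwist₂ v w) := by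
  induction w with
  | zero => simp
  | add u v hu hv => simp only [map_add, hu, hv]
  | tmul b b' =>
    rw [TensorProduct.map_tmul, cotwist₂_tmul, cotwist₂_tmul, LinearMap.mulRight_apply,
      LinearMap.id_apply]
    generalize cotwist δ.Γ (v ⊗ₜ b) = z
    induction z with
    | zero => simp
    | add u v hu hv => simp only [map_add, hu, hv]
    | tmul u v =>
      simp only [TensorProduct.map_tmul, LinearMap.id_apply, LinearMap.comp_apply,
        LinearMap.flip_apply, TensorProduct.mk_apply, δ.cotwist_mul]
      generalize cotwist δ.Γ _ = y
      induction y with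
      | zero => simp
      | add u v hu hv => simp only [map_add, TensorProduct.tmul_add, hu, hv]
      | tmul u v => simp

/-- The coaction axiom covered in the second leg only: the factor `x` covering the first leg is
cancelled by right `B`-linearity and non-degeneracy. -/
theorem cotwist₂_T₁ (v : V) (p y : B) :
    δ.cotwist₂ v (HB.T₁ (p ⊗ₜ y)) =
      map (HB.T₁.toLinearMap ∘ₗ (TensorProduct.mk ℂ B B).flip y) LinearMap.id
        (cotwist δ.Γ (v ⊗ₜ p)) := by
  apply HB.cancel_mulRight₁
  intro x
  rw [← δ.cotwist₂_mulRight₁, ← HB.lmul_comul_tmul, δ.cotwist₂_comul, map_map']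
  congr 2
  ext b
  exact HB.lmul_comul_tmul b x y

theorem lmul_comul_tmul_opp (b x y : B) :
    lmul (HB.comul b) (x ⊗ₜ y) =
      map LinearMap.id (mulRight ℂ y) (TensorProduct.comm ℂ B B (HB.opp.T₁ (b ⊗ₜ x))) := by
  have h := congrArg (TensorProduct.comm ℂ B B) (HB.opp.lmul_comul_tmul b y x)
  rw [HB.opp_comul] at h
  rw [TensorProduct.map_comm, ← h]
  simp [flipMultiplier]

/-- The coaction axiom covered in the first leg only, the form to which the antipode of the opposite
coproduct applies. -/
theorem cotwist₂_opp_T₁ (v : V) (p x : B) :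
    δ.cotwist₂ v (TensorProduct.comm ℂ B B (HB.opp.T₁ (p ⊗ₜ x))) =
      map ((TensorProduct.comm ℂ B B).toLinearMap ∘ₗ HB.opp.T₁.toLinearMap ∘ₗ
        (TensorProduct.mk ℂ B B).flip x) LinearMap.id (cotwist δ.Γ (v ⊗ₜ p)) := by
  apply HB.cancel_mulRight₂
  intro y
  rw [← δ.cotwist₂_mulRight₂, ← lmul_comul_tmul_opp, δ.cotwist₂_comul, map_map']
  congr 2
  ext b
  exact lmul_comul_tmul_opp b x y

/-- `(ε ⊗ ι)Γ(v) = v`. -/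
theorem counit_cotwist (z : V ⊗[ℂ] B) :
    TensorProduct.lid ℂ V (map HB.counit LinearMap.id (cotwist δ.Γ z)) =
      TensorProduct.rid ℂ V (map LinearMap.id HB.counit z) := by
  induction z with
  | zero => simp
  | add u v hu hv => simp only [map_add, hu, hv]
  | tmul v b =>
    -- By injectivity of `Γ` it suffices to compare the images covered by `y`. The value of `ε` on
    -- the first leg of `((ι ⊗ Γ)Γ(v))(b ⊗ y ⊗ 1)` is computed twice: directly (`h1`), and from the
    -- coaction axiom with `(ε ⊗ ι)T₁ = m` (`h2`, extended to all of `B ⊗ B` in `h4`).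
    apply δ.eq_of_cotwist_eq
    intro y
    have h1 : ∀ b y, TensorProduct.lid ℂ (B ⊗[ℂ] V) (map HB.counit LinearMap.id
        (TensorProduct.assoc ℂ B B V (δ.cotwist₂ v (b ⊗ₜ y)))) =
        cotwist δ.Γ (TensorProduct.lid ℂ V (map HB.counit LinearMap.id
          (cotwist δ.Γ (v ⊗ₜ b))) ⊗ₜ y) := by
      intro b y
      rw [cotwist₂_tmul, LinearEquiv.apply_symm_apply]
      generalize cotwist δ.Γ (v ⊗ₜ b) = z
      induction z with
      | zero => simp
      | add u v hu hv => simp only [map_add, TensorProduct.add_tmul, hu, hv]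
      | tmul u v => simp [← TensorProduct.smul_tmul']
    have h2 : ∀ p y, TensorProduct.lid ℂ (B ⊗[ℂ] V) (map HB.counit LinearMap.id
        (TensorProduct.assoc ℂ B B V (δ.cotwist₂ v (HB.T₁ (p ⊗ₜ y))))) =
        cotwist δ.Γ (v ⊗ₜ (p * y)) := by
      intro p y
      rw [cotwist₂_T₁, δ.cotwist_mul]
      generalize cotwist δ.Γ (v ⊗ₜ p) = z
      induction z with
      | zero => simp
      | add u v hu hv => simp only [map_add, hu, hv]
      | tmul b v =>
        have h3 := HB.counit_T₁ (b ⊗ₜ y)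
        rw [LinearMap.mul'_apply] at h3
        simp only [TensorProduct.map_tmul, LinearMap.id_apply, LinearMap.comp_apply,
          LinearMap.flip_apply, TensorProduct.mk_apply, LinearEquiv.coe_coe,
          LinearMap.mulRight_apply]
        rw [← h3]
        generalize HB.T₁ (b ⊗ₜ y) = w
        induction w with
        | zero => simp
        | add u v hu hv => simp only [map_add, TensorProduct.add_tmul, hu, hv]
        | tmul u v => simp [← TensorProduct.smul_tmul']
    have h4 : ∀ w, TensorProduct.lid ℂ (B ⊗[ℂ] V) (map HB.counit LinearMap.id
        (TensorProduct.assoc ℂ B B V (δ.cotwist₂ v w))) =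
        cotwist δ.Γ (v ⊗ₜ TensorProduct.lid ℂ B (map HB.counit LinearMap.id w)) := by
      intro w
      obtain ⟨w, rfl⟩ := HB.T₁.surjective w
      induction w with
      | zero => simp
      | add u v hu hv => simp only [map_add, TensorProduct.tmul_add, hu, hv]
      | tmul p y => rw [h2, HB.counit_T₁]; rfl
    rw [← h1, h4]
    simp [TensorProduct.smul_tmul]

/-- The map on the first two legs is `b ⊗ b' ↦ S⁻¹(b')b`, so formally `S⁻¹(v₋₁u₂)v₋₂u₁ ⊗ v₀ =
S⁻¹(u₂)u₁ ⊗ v`. The elements `Δ(p)(x ⊗ 1)` span `B ⊗ B` and are sent to `ε(p)x`; on them the claim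
is the counit property of `Γ`. -/
theorem antipodeMul_cotwist₂ (v : V) (u : B ⊗[ℂ] B) :
    map ((TensorProduct.lid ℂ B).toLinearMap ∘ₗ map HB.counit LinearMap.id ∘ₗ
      HB.opp.T₁.symm.toLinearMap ∘ₗ (TensorProduct.comm ℂ B B).toLinearMap) LinearMap.id
        (δ.cotwist₂ v u) =
      TensorProduct.lid ℂ B (map HB.counit LinearMap.id
        (HB.opp.T₁.symm (TensorProduct.comm ℂ B B u))) ⊗ₜ v := by
  obtain ⟨u, rfl⟩ := (TensorProduct.comm ℂ B B).surjective u
  obtain ⟨u, rfl⟩ := HB.opp.T₁.surjective u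
  induction u with
  | zero => simp
  | add u v hu hv => simp only [map_add, TensorProduct.add_tmul, hu, hv]
  | tmul p x =>
    have h := δ.counit_cotwist (v ⊗ₜ p)
    rw [cotwist₂_opp_T₁, map_map']
    simp only [TensorProduct.map_tmul, TensorProduct.rid_tmul, LinearMap.id_apply] at h
    simp only [TensorProduct.comm_comm, LinearEquiv.symm_apply_apply, TensorProduct.map_tmul,
      TensorProduct.lid_tmul, LinearMap.id_apply]
    rw [TensorProduct.smul_tmul, ← h]
    generalize cotwist δ.Γ (v ⊗ₜ p) = z
    induction z with
    | zero => simp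
    | add u v hu hv => simp only [map_add, TensorProduct.tmul_add, hu, hv]
    | tmul u v => simp [TensorProduct.smul_tmul]

/-- Applying `Γ`, covered by `y`, to the second leg of `T(k)` gives the double coaction on `k`, from
which `antipodeMul_cotwist₂` recovers `(1 ⊗ S⁻¹(y))k`. The latter thus depends only on `T(k)`. -/
theorem map_antipodeMul_eq_zero (k : V ⊗[ℂ] B) (hk : cotwist δ.Γ k = 0) (y : B) :
    map LinearMap.id (HB.opp.antipodeMul y) k = 0 := by
  have h : ∀ k : V ⊗[ℂ] B, TensorProduct.comm ℂ V B
      (map LinearMap.id (HB.opp.antipodeMul y) k) =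
      map ((TensorProduct.lid ℂ B).toLinearMap ∘ₗ map HB.counit LinearMap.id ∘ₗ
        HB.opp.T₁.symm.toLinearMap ∘ₗ (TensorProduct.comm ℂ B B).toLinearMap) LinearMap.id
        ((TensorProduct.assoc ℂ B B V).symm
          (map LinearMap.id (cotwist δ.Γ ∘ₗ (TensorProduct.mk ℂ V B).flip y)
            (cotwist δ.Γ k))) := by
    intro k
    induction k with
    | zero => simp
    | add u v hu hv => simp only [map_add, hu, hv]
    | tmul v b =>
      rw [← cotwist₂_tmul, antipodeMul_cotwist₂]
      simp [MultiplierHopfAlgebra.antipodeMul_apply, HB.counit_opp]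
  apply (TensorProduct.comm ℂ V B).injective
  rw [h, hk]
  simp

theorem cotwist_injective : Function.Injective (cotwist δ.Γ) := by
  rw [injective_iff_map_eq_zero]
  intro k hk
  rcases subsingleton_or_nontrivial B with hB | hB
  · exact Subsingleton.elim _ _
  obtain ⟨a, ha⟩ := HB.opp.exists_counit_eq_one
  have h : ∀ w : B ⊗[ℂ] B, map LinearMap.id (LinearMap.mul' ℂ B ∘ₗ
      LinearMap.applyₗ w ∘ₗ LinearMap.lTensorHom B ∘ₗ HB.opp.antipodeMul.flip) k = 0 := by
    intro w
    induction w with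
    | zero => simp
    | add u v hu hv =>
      rw [map_add, LinearMap.add_comp, LinearMap.comp_add, TensorProduct.map_add_right,
        LinearMap.add_apply, hu, hv, add_zero]
    | tmul x y =>
      have h2 := congrArg (map LinearMap.id (mulLeft ℂ x)) (δ.map_antipodeMul_eq_zero k hk y)
      rw [map_map', map_zero] at h2
      exact h2
  apply HB.opp.cancel_mulLeft_right
  intro c
  -- With `ε(a) = 1`, the antipode identity `c a₁ S(a₂) b = ε(a) c b` of the opposite coproduct
  -- collapses this combination of the operators `b ↦ x S⁻¹(y) b` to left multiplication by `c`.
  rw [map_zero, ← h (HB.opp.T₂ (c ⊗ₜ a))]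
  congr 2
  ext b
  have h3 := HB.opp.mul'_map_antipodeMul_T₂ c a b
  rw [ha, one_smul] at h3
  exact h3.symm

/-- The map `c ⊗ e ↦ (c ⊗ e ⊗ 1)((ι ⊗ Γ)Γ(v))`. -/
def leftCover₂ (v : V) : B ⊗[ℂ] B →ₗ[ℂ] (B ⊗[ℂ] B) ⊗[ℂ] V :=
  (TensorProduct.assoc ℂ B B V).symm.toLinearMap ∘ₗ TensorProduct.lift
    (LinearMap.flip (LinearMap.lcomp ℂ _ (δ.leftCover v) ∘ₗ LinearMap.lTensorHom B ∘ₗ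
      δ.leftCover.flip))

theorem leftCover₂_tmul (v : V) (c e : B) :
    δ.leftCover₂ v (c ⊗ₜ e) = (TensorProduct.assoc ℂ B B V).symm
      (map LinearMap.id (δ.leftCover.flip e) (δ.leftCover v c)) := rfl

/-- Both sides are `(w ⊗ 1)((ι ⊗ Γ)Γ(v))(u ⊗ 1)`. The identity carries results from right coverings
to left ones. -/
theorem mulRight_leftCover₂ (v : V) (w u : B ⊗[ℂ] B) :
    map (mulRight ℂ u) LinearMap.id (δ.leftCover₂ v w) =
      map (mulLeft ℂ w) LinearMap.id (δ.cotwist₂ v u) := by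
  induction w with
  | zero => simp
  | add w w' hu hv =>
    rw [map_add, map_add, hu, hv, ← LinearMap.add_apply, ← TensorProduct.map_add_left]
    congr 2
    ext
    simp [add_mul]
  | tmul c e =>
    induction u with
    | zero => simp
    | add w w' hu hv =>
      rw [map_add, map_add, ← hu, ← hv, ← LinearMap.add_apply, ← TensorProduct.map_add_left]
      congr 2
      ext
      simp [mul_add]
    | tmul r p =>
      rw [leftCover₂_tmul, cotwist₂_tmul]
      have h1 : ∀ z : B ⊗[ℂ] V, map (mulRight ℂ (r ⊗ₜ p)) LinearMap.id
          ((TensorProduct.assoc ℂ B B V).symm (map LinearMap.id (δ.leftCover.flip e) z)) =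
          (TensorProduct.assoc ℂ B B V).symm (map LinearMap.id
            (map (mulLeft ℂ e) LinearMap.id ∘ₗ cotwist δ.Γ ∘ₗ (TensorProduct.mk ℂ V B).flip p)
              (map (mulRight ℂ r) LinearMap.id z)) := by
        intro z
        induction z with
        | zero => simp
        | add u v hu hv => simp only [map_add, hu, hv]
        | tmul b v =>
          simp only [TensorProduct.map_tmul, LinearMap.id_apply, LinearMap.comp_apply,
            LinearMap.flip_apply, TensorProduct.mk_apply, δ.mulLeft_cotwist]
          generalize δ.leftCover v e = y
          induction y with
          | zero => simp
          | add u v hu hv => simp only [map_add, TensorProduct.tmul_add, hu, hv]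
          | tmul u v => simp
      rw [h1, ← δ.mulLeft_cotwist]
      generalize cotwist δ.Γ (v ⊗ₜ r) = z
      induction z with
      | zero => simp
      | add u v hu hv => simp only [map_add, hu, hv]
      | tmul b v =>
        simp only [TensorProduct.map_tmul, LinearMap.id_apply, LinearMap.comp_apply]
        generalize cotwist δ.Γ _ = y
        induction y with
        | zero => simp
        | add u v hu hv => simp only [map_add, TensorProduct.tmul_add, hu, hv]
        | tmul u v => simp

/-- The coaction axiom covered from the left, although it is postulated only for coverings from the
right: multiply with `Δ(p)u` from the right, apply the axiom there, and cancel, since these elements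
separate points. -/
theorem leftCover₂_T₄ (v : V) (g c : B) :
    δ.leftCover₂ v (HB.T₄ (g ⊗ₜ c)) =
      map (HB.T₄ ∘ₗ TensorProduct.mk ℂ B B g) LinearMap.id (δ.leftCover v c) := by
  apply HB.cancel_lmul_comul
  intro p u
  rw [mulRight_leftCover₂, cotwist₂_comul, map_map', map_map']
  have h : mulRight ℂ (lmul (HB.comul p) u) ∘ₗ HB.T₄ ∘ₗ TensorProduct.mk ℂ B B g =
      (mulRight ℂ u ∘ₗ HB.T₄ ∘ₗ TensorProduct.mk ℂ B B g) ∘ₗ mulRight ℂ p := by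
    ext z
    simp [HB.T₄_mul, rmul_mul]
  rw [h, ← map_map' (mulRight ℂ p) LinearMap.id, ← δ.mulLeft_cotwist, map_map']
  congr 2
  ext z
  simp [HB.T₄_mul, rmul_mul]

/-- Apply `ε ⊗ ι` to `(c ⊗ 1)Γ(v)(p ⊗ 1)` with `ε(p) = 1`, and use that `ε` is multiplicative. -/
theorem counit_leftCover (v : V) (c : B) :
    TensorProduct.lid ℂ V (map HB.counit LinearMap.id (δ.leftCover v c)) =
      HB.counit c • v := by
  rcases subsingleton_or_nontrivial B with hB | hB
  · rw [Subsingleton.elim c 0]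
    simp
  obtain ⟨p, hp⟩ := HB.exists_counit_eq_one
  have h := congrArg (TensorProduct.lid ℂ V ∘ map HB.counit LinearMap.id)
    (δ.mulLeft_cotwist v p c)
  have h1 : HB.counit ∘ₗ mulLeft ℂ c = HB.counit c • HB.counit := by
    ext x
    simp [HB.counit_mul]
  have h2 : HB.counit ∘ₗ mulRight ℂ p = HB.counit := by
    ext x
    simp [HB.counit_mul, hp]
  simp only [Function.comp_apply, map_map', h1, h2, LinearMap.id_comp,
    TensorProduct.map_smul_left, LinearMap.smul_apply, map_smul, δ.counit_cotwist] at h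
  rw [← h]
  simp [hp]

/-- The map `z ⊗ y ↦ y S⁻¹(z) d`. -/
def mulAntipode (HB : RegularMultiplierHopfAlgebra B) (d : B) : B ⊗[ℂ] B →ₗ[ℂ] B :=
  LinearMap.mul' ℂ B ∘ₗ map LinearMap.id (HB.opp.antipodeMul.flip d) ∘ₗ
    (TensorProduct.comm ℂ B B).toLinearMap

/-- Formally `g z₂ S⁻¹(z₁) d = ε(z) g d`, the antipode identity of the opposite coproduct. -/
theorem mulAntipode_T₄ (g z d : B) :
    mulAntipode HB d (HB.T₄ (g ⊗ₜ z)) = HB.counit z • (g * d) := by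
  rw [← HB.counit_opp, ← HB.opp.mul'_map_antipodeMul_T₂]
  simp [mulAntipode, RegularMultiplierHopfAlgebra.T₄]

/-- Formally `e v₋₁ S⁻¹(c v₋₂) d ⊗ v₀ = e S⁻¹(c) d ⊗ v` for `w = c ⊗ e`. Since `T₄` is onto, it
suffices to take `w = T₄(g ⊗ c)`, where both sides equal `ε(c) g d ⊗ v`. -/
theorem mulAntipode_leftCover₂ (v : V) (d : B) (w : B ⊗[ℂ] B) :
    map (mulAntipode HB d) LinearMap.id (δ.leftCover₂ v w) = mulAntipode HB d w ⊗ₜ v := by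
  obtain ⟨w, rfl⟩ := HB.T₄Equiv.surjective w
  rw [HB.T₄Equiv_apply]
  induction w with
  | zero => simp
  | add u v hu hv => simp only [map_add, TensorProduct.add_tmul, hu, hv]
  | tmul g c =>
    rw [leftCover₂_T₄, map_map', mulAntipode_T₄, TensorProduct.smul_tmul,
      ← δ.counit_leftCover]
    generalize δ.leftCover v c = z
    induction z with
    | zero => simp
    | add u v hu hv => simp only [map_add, TensorProduct.tmul_add, hu, hv]
    | tmul z v => simp [mulAntipode_T₄, TensorProduct.smul_tmul]

/-- `T(v₀ ⊗ S⁻¹(cv₋₁)d) = S⁻¹(c)d ⊗ v`. -/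
theorem cotwist_antipodeMul (v : V) (c d : B) :
    cotwist δ.Γ (TensorProduct.comm ℂ B V
      (map (HB.opp.antipodeMul.flip d) LinearMap.id (δ.leftCover v c))) =
      HB.opp.antipodeMul c d ⊗ₜ v := by
  -- Covered by `e` from the left, the claim is `mulAntipode_leftCover₂` at `c ⊗ e`.
  apply HB.cancel_left
  intro e
  have h := δ.mulAntipode_leftCover₂ v d (c ⊗ₜ e)
  rw [leftCover₂_tmul] at h
  refine Eq.trans ?_ (h.trans ?_)
  · generalize δ.leftCover v c = z
    induction z with
    | zero => simp
    | add u v hu hv => simp only [map_add, hu, hv]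
    | tmul z v =>
      simp only [TensorProduct.map_tmul, LinearMap.id_apply, LinearMap.flip_apply,
        TensorProduct.comm_tmul, δ.mulLeft_cotwist]
      generalize δ.leftCover v e = y
      induction y with
      | zero => simp
      | add u v hu hv => simp only [map_add, TensorProduct.tmul_add, hu, hv]
      | tmul u v => simp [mulAntipode]
  · simp [mulAntipode]

theorem cotwist_surjective : Function.Surjective (cotwist δ.Γ) := by
  intro z
  induction z with
  | zero => exact ⟨0, map_zero _⟩
  | add u v hu hv =>
    obtain ⟨z, rfl⟩ := hu
    obtain ⟨z', rfl⟩ := hv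
    exact ⟨z + z', map_add _ _ _⟩
  | tmul b v =>
    obtain ⟨w, rfl⟩ := HB.opp.lift_antipodeMul_surjective b
    induction w with
    | zero => exact ⟨0, by simp⟩
    | add u v hu hv =>
      obtain ⟨z, hz⟩ := hu
      obtain ⟨z', hz'⟩ := hv
      exact ⟨z + z', by rw [map_add, hz, hz', map_add, TensorProduct.add_tmul]⟩
    | tmul c d => exact ⟨_, δ.cotwist_antipodeMul v c d⟩

/-- The cotwist map as a linear equivalence. -/
def cotwistEquiv : (V ⊗[ℂ] B) ≃ₗ[ℂ] (B ⊗[ℂ] V) :=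
  LinearEquiv.ofBijective (cotwist δ.Γ) ⟨δ.cotwist_injective, δ.cotwist_surjective⟩

@[simp] theorem cotwistEquiv_apply (z : V ⊗[ℂ] B) : δ.cotwistEquiv z = cotwist δ.Γ z := rfl

end LeftCoaction

end

section

/-! ### Non-degenerate algebras and linear maps given by canonical maps -/

section Nondegenerate

variable {X : Type*} [NonUnitalRing X] [Module ℂ X] [IsScalarTower ℂ X X] [SMulCommClass ℂ X X]

/-- The product of `X` is non-degenerate. -/
structure Nondegenerate (X : Type*) [NonUnitalRing X] : Prop where
  eq_zero_of_mul_left : ∀ a : X, (∀ x, x * a = 0) → a = 0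
  eq_zero_of_mul_right : ∀ a : X, (∀ x, a * x = 0) → a = 0

namespace Nondegenerate

theorem tensor (hX : Nondegenerate X) : Nondegenerate (X ⊗[ℂ] X) where
  eq_zero_of_mul_left z hz := by
    apply eq_zero_of_map_right (fun p : X => mulLeft ℂ p) hX.eq_zero_of_mul_left
    intro y
    apply eq_zero_of_map_left (fun p : X => mulLeft ℂ p) hX.eq_zero_of_mul_left
    intro x
    rw [← MultiplierHopfAlgebra.tmul_mul_eq, hz]
  eq_zero_of_mul_right z hz := by
    apply eq_zero_of_map_right (fun p : X => mulRight ℂ p) hX.eq_zero_of_mul_right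
    intro y
    apply eq_zero_of_map_left (fun p : X => mulRight ℂ p) hX.eq_zero_of_mul_right
    intro x
    rw [← MultiplierHopfAlgebra.mul_tmul_eq, hz]

theorem multiplier_ext_left (hX : Nondegenerate X) {m n : MultiplierAlgebra X}
    (h : ∀ x, lmul m x = lmul n x) : m = n := by
  refine multiplier_ext h fun x => ?_
  rw [← sub_eq_zero]
  refine hX.eq_zero_of_mul_right _ fun y => ?_
  rw [sub_mul, rmul_mul, rmul_mul, h, sub_self]

theorem multiplier_ext_right (hX : Nondegenerate X) {m n : MultiplierAlgebra X}
    (h : ∀ x, rmul m x = rmul n x) : m = n := by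
  refine multiplier_ext (fun x => ?_) h
  rw [← sub_eq_zero]
  refine hX.eq_zero_of_mul_left _ fun y => ?_
  rw [mul_sub, ← rmul_mul, ← rmul_mul, h, sub_self]

theorem toMultiplier_injective (hX : Nondegenerate X) :
    Function.Injective (toMultiplier : X →ₗ[ℂ] MultiplierAlgebra X) := by
  rw [injective_iff_map_eq_zero]
  intro x hx
  refine hX.eq_zero_of_mul_right x fun y => ?_
  rw [← lmul_toMultiplier, hx]
  rfl

theorem cancel_mulLeft (hX : Nondegenerate X) {z w : X ⊗[ℂ] X}
    (h : ∀ p : X, map (mulLeft ℂ p) LinearMap.id z = map (mulLeft ℂ p) LinearMap.id w) :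
    z = w := by
  rw [← sub_eq_zero]
  apply eq_zero_of_map_left (fun p : X => mulLeft ℂ p) hX.eq_zero_of_mul_left
  intro p
  rw [map_sub, h p, sub_self]

theorem cancel_mulRight (hX : Nondegenerate X) {z w : X ⊗[ℂ] X}
    (h : ∀ p : X, map LinearMap.id (mulRight ℂ p) z = map LinearMap.id (mulRight ℂ p) w) :
    z = w := by
  rw [← sub_eq_zero]
  apply eq_zero_of_map_right (fun p : X => mulRight ℂ p) hX.eq_zero_of_mul_right
  intro p
  rw [map_sub, h p, sub_self]

theorem canonicalMap₁_unique (hX : Nondegenerate X)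
    {Δ : X →ₗ[ℂ] MultiplierAlgebra (X ⊗[ℂ] X)} {T T' : X ⊗[ℂ] X →ₗ[ℂ] X ⊗[ℂ] X}
    (h : IsCanonicalMap₁ Δ T) (h' : IsCanonicalMap₁ Δ T') : T = T' :=
  TensorProduct.ext' fun x y =>
    hX.tensor.toMultiplier_injective ((h x y).trans (h' x y).symm)

theorem canonicalMap₂_unique (hX : Nondegenerate X)
    {Δ : X →ₗ[ℂ] MultiplierAlgebra (X ⊗[ℂ] X)} {T T' : X ⊗[ℂ] X →ₗ[ℂ] X ⊗[ℂ] X}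
    (h : IsCanonicalMap₂ Δ T) (h' : IsCanonicalMap₂ Δ T') : T = T' :=
  TensorProduct.ext' fun x y =>
    hX.tensor.toMultiplier_injective ((h x y).trans (h' x y).symm)

/-- Two linear maps `T₁` and `T₂` such that `T₂(y ⊗ x)(1 ⊗ z) = (y ⊗ 1)T₁(x ⊗ z)` are the
canonical maps of a linear map `Δ : X → M(X ⊗ X)`. -/
theorem exists_of_canonicalMaps (hX : Nondegenerate X) (T₁ T₂ : X ⊗[ℂ] X →ₗ[ℂ] X ⊗[ℂ] X)
    (h : ∀ x y z : X, map LinearMap.id (mulRight ℂ z) (T₂ (y ⊗ₜ x)) =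
      map (mulLeft ℂ y) LinearMap.id (T₁ (x ⊗ₜ z))) :
    ∃ Δ : X →ₗ[ℂ] MultiplierAlgebra (X ⊗[ℂ] X), IsCanonicalMap₁ Δ T₁ ∧ IsCanonicalMap₂ Δ T₂ := by
  -- `L x` and `R x` are to be multiplication by `Δ(x)` from the left and from the right: `L x (y ⊗
  -- y') = T₁(x ⊗ y')(y ⊗ 1)` and `R x (y ⊗ y') = (1 ⊗ y')T₂(y ⊗ x)`. The hypothesis then gives the
  -- multiplier condition `hc`.
  let L (x : X) : X ⊗[ℂ] X →ₗ[ℂ] X ⊗[ℂ] X := TensorProduct.lift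
    (LinearMap.lcomp ℂ _ (T₁ ∘ₗ TensorProduct.mk ℂ X X x) ∘ₗ LinearMap.rTensorHom X ∘ₗ
      (LinearMap.mul ℂ X).flip)
  let R (x : X) : X ⊗[ℂ] X →ₗ[ℂ] X ⊗[ℂ] X := TensorProduct.lift (LinearMap.flip
    (LinearMap.lcomp ℂ _ (T₂ ∘ₗ (TensorProduct.mk ℂ X X).flip x) ∘ₗ LinearMap.lTensorHom X ∘ₗ
      LinearMap.mul ℂ X))
  have hL (x y y' : X) : L x (y ⊗ₜ y') = map (mulRight ℂ y) LinearMap.id (T₁ (x ⊗ₜ y')) := rfl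
  have hR (x y y' : X) : R x (y ⊗ₜ y') = map LinearMap.id (mulLeft ℂ y') (T₂ (y ⊗ₜ x)) := rfl
  have hc (x : X) (w w' : X ⊗[ℂ] X) : R x w * w' = w * L x w' := by
    induction w with
    | zero => simp
    | add u v hu hv => simp only [map_add, add_mul, hu, hv]
    | tmul y y' =>
      induction w' with
      | zero => simp
      | add u v hu hv => simp only [map_add, mul_add, hu, hv]
      | tmul z z' =>
        have h1 : ∀ u : X ⊗[ℂ] X, map LinearMap.id (mulLeft ℂ y') u * (z ⊗ₜ z') =
            map (mulRight ℂ z) (mulLeft ℂ y') (map LinearMap.id (mulRight ℂ z') u) := by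
          intro u
          induction u with
          | zero => simp
          | add u v hu hv => simp only [map_add, add_mul, hu, hv]
          | tmul u v => simp [mul_assoc]
        have h2 : ∀ u : X ⊗[ℂ] X, (y ⊗ₜ y') * map (mulRight ℂ z) LinearMap.id u =
            map (mulRight ℂ z) (mulLeft ℂ y') (map (mulLeft ℂ y) LinearMap.id u) := by
          intro u
          induction u with
          | zero => simp
          | add u v hu hv => simp only [map_add, mul_add, hu, hv]
          | tmul u v => simp [mul_assoc]
        rw [hL, hR, h1, h2, h]
  let Δ : X →ₗ[ℂ] MultiplierAlgebra (X ⊗[ℂ] X) :=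
    { toFun := fun x => mkMultiplier (L x) (R x) (hc x)
      map_add' := fun x x' => hX.tensor.multiplier_ext_left fun w => by
        induction w with
        | zero => simp
        | add u v hu hv => rw [map_add, map_add, hu, hv]
        | tmul y y' => simp [hL, TensorProduct.add_tmul]
      map_smul' := fun r x => hX.tensor.multiplier_ext_left fun w => by
        induction w with
        | zero => simp
        | add u v hu hv => rw [map_add, map_add, hu, hv]
        | tmul y y' => simp [hL, ← TensorProduct.smul_tmul'] }
  have hΔL (x : X) : lmul (Δ x) = L x := rfl
  have hΔR (x : X) : rmul (Δ x) = R x := rfl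
  refine ⟨Δ, fun x x' => hX.tensor.multiplier_ext_left fun w => ?_,
    fun x x' => hX.tensor.multiplier_ext_right fun w => ?_⟩
  · induction w with
    | zero => simp
    | add u v hu hv => rw [map_add, map_add, hu, hv]
    | tmul y y' =>
      -- `T₁` is only assumed linear over `ℂ`. Its right `X`-linearity in the second leg follows
      -- from the hypothesis: `(p ⊗ 1)T₁(x ⊗ z)` is `T₂(p ⊗ x)(1 ⊗ z)`, which is right linear in
      -- `z`.
      have h1 : T₁ (x ⊗ₜ (x' * y')) = map LinearMap.id (mulRight ℂ y') (T₁ (x ⊗ₜ x')) := by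
        apply hX.cancel_mulLeft
        intro p
        rw [← h, RightModuleAlgebra.map_left_right, ← h, map_map', LinearMap.mulRight_mul]
        rfl
      rw [lmul_mul, hΔL]
      simp only [lmul_tmulMultiplier, TensorProduct.map_tmul, lmul_one, lmul_toMultiplier]
      rw [hL, h1, MultiplierHopfAlgebra.mul_tmul_eq]
  · induction w with
    | zero => simp
    | add u v hu hv => rw [map_add, map_add, hu, hv]
    | tmul y y' =>
      have h1 : T₂ ((y * x) ⊗ₜ x') = map (mulLeft ℂ y) LinearMap.id (T₂ (x ⊗ₜ x')) := by
        apply hX.cancel_mulRight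
        intro p
        rw [h, ← RightModuleAlgebra.map_left_right, h, map_map', LinearMap.mulLeft_mul]
        rfl
      rw [rmul_mul', hΔR]
      simp only [rmul_tmulMultiplier, TensorProduct.map_tmul, rmul_one, rmul_toMultiplier]
      rw [hR, h1, MultiplierHopfAlgebra.tmul_mul_eq, RightModuleAlgebra.map_left_right]

end Nondegenerate

end Nondegenerate

/-! ### Non-degeneracy of `AB` and relations in `M(AB)` -/

namespace SmashProduct

variable {A B : Type*}
  [NonUnitalRing A] [Module ℂ A] [IsScalarTower ℂ A A] [SMulCommClass ℂ A A]
  [NonUnitalRing B] [Module ℂ B] [IsScalarTower ℂ B B] [SMulCommClass ℂ B B]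
  {HA : RegularMultiplierHopfAlgebra A} (α : RightModuleAlgebra B HA)

theorem Bmul_twist (b : B) (u : B ⊗[ℂ] A) :
    α.Bmul b (α.twist u) = α.twist (map (mulLeft ℂ b) LinearMap.id u) := by
  induction u with
  | zero => simp
  | add u v hu hv => simp only [map_add, hu, hv]
  | tmul c a => rw [← α.twist_mul_left]; rfl

theorem mulA_twist (a : A) (u : B ⊗[ℂ] A) :
    α.mulA a (α.twist u) = α.twist (map LinearMap.id (mulRight ℂ a) u) := by
  induction u with
  | zero => simp
  | add u v hu hv => simp only [map_add, hu, hv]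
  | tmul c a' => rw [← α.twist_mul_right]; rfl

/-- Write the element as `R(u)`. Then `b R(u) = R((b ⊗ 1)u)`, so left multiplication by `ab` is a
multiplication in the first leg of `B ⊗ A`, then `R`, then one in the first leg of `A ⊗ B`.
Injectivity of `R` lets non-degeneracy of `A` and of `B` remove both. Right multiplication is
symmetric. -/
theorem nondegenerate (HB : RegularMultiplierHopfAlgebra B) :
    Nondegenerate (SmashProduct α) where
  eq_zero_of_mul_left x hx := by
    obtain ⟨z, rfl⟩ := (equiv α).surjective x
    obtain ⟨u, rfl⟩ := α.twistEquiv.surjective z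
    rw [α.twistEquiv_apply] at hx ⊢
    suffices u = 0 by rw [this, map_zero, map_zero]
    apply HB.cancel_left
    intro b
    apply α.twist_bijective.1
    rw [← Bmul_twist, map_zero, map_zero]
    apply HA.cancel_left
    intro a
    have h := hx (equiv α (a ⊗ₜ b))
    rw [mul_def, LinearEquiv.symm_apply_apply, LinearEquiv.symm_apply_apply,
      α.smashMul_left] at h
    rw [map_zero]
    exact (equiv α).injective (h.trans (map_zero _).symm)
  eq_zero_of_mul_right x hx := by
    obtain ⟨z, rfl⟩ := (equiv α).surjective x
    obtain ⟨u, rfl⟩ := α.twistEquiv.surjective z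
    rw [α.twistEquiv_apply] at hx ⊢
    suffices u = 0 by rw [this, map_zero, map_zero]
    apply HA.cancel_right
    intro a
    apply α.twist_bijective.1
    rw [← mulA_twist, map_zero, map_zero]
    apply HB.cancel_right
    intro b
    have h := hx (equiv α (a ⊗ₜ b))
    rw [mul_def, LinearEquiv.symm_apply_apply, LinearEquiv.symm_apply_apply,
      α.smashMul_right] at h
    rw [map_zero]
    exact (equiv α).injective (h.trans (map_zero _).symm)

theorem inclA_mul (a a' : A) : inclA α (a * a') = inclA α a * inclA α a' := by
  refine multiplier_ext (fun x => ?_) fun x => ?_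
  · simp [inclA, LinearMap.mulLeft_mul, map_map']
  · simp [inclA, α.mulA_mul]

theorem inclB_mul (b b' : B) : inclB α (b * b') = inclB α b * inclB α b' := by
  refine multiplier_ext (fun x => ?_) fun x => ?_
  · simp [inclB, α.Bmul_mul]
  · simp [inclB, LinearMap.mulRight_mul, map_map']

theorem inclA_mul_inclB (a : A) (b : B) :
    inclA α a * inclB α b = toMultiplier (equiv α (a ⊗ₜ b)) := by
  refine multiplier_ext (fun x => ?_) fun x => ?_
  · simp [inclA, inclB, mul_def, α.smashMul_left]
  · simp [inclA, inclB, mul_def, α.smashMul_right]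

theorem inclB_mul_inclA (b : B) (a : A) :
    inclB α b * inclA α a = toMultiplier (equiv α (α.twist (b ⊗ₜ a))) := by
  refine multiplier_ext (fun x => ?_) fun x => ?_
  · simp [inclA, inclB, mul_def, α.Bmul_mulLeft]
  · simp [inclA, inclB, mul_def, α.mulA_mulRight]

end SmashProduct

end

section

/-! ### Multipliers of a tensor product -/

section TmulMultiplier

variable {X Y : Type*}
  [NonUnitalRing X] [Module ℂ X] [IsScalarTower ℂ X X] [SMulCommClass ℂ X X]
  [NonUnitalRing Y] [Module ℂ Y] [IsScalarTower ℂ Y Y] [SMulCommClass ℂ Y Y]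

theorem tmulMultiplier_mul (m m' : MultiplierAlgebra X) (n n' : MultiplierAlgebra Y) :
    tmulMultiplier m n * tmulMultiplier m' n' = tmulMultiplier (m * m') (n * n') := by
  refine multiplier_ext (fun x => ?_) fun x => ?_
  · rw [lmul_mul]
    simp only [lmul_tmulMultiplier, map_map']
    rfl
  · rw [rmul_mul']
    simp only [rmul_tmulMultiplier, map_map']
    rfl

theorem tmulMultiplier_one_mul (n n' : MultiplierAlgebra Y) :
    tmulMultiplier (1 : MultiplierAlgebra X) n * tmulMultiplier 1 n' =
      tmulMultiplier 1 (n * n') :=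
  (tmulMultiplier_mul _ _ _ _).trans (by rw [mul_one])

theorem tmulMultiplier_mul_one (m m' : MultiplierAlgebra X) :
    tmulMultiplier m (1 : MultiplierAlgebra Y) * tmulMultiplier m' 1 =
      tmulMultiplier (m * m') 1 :=
  (tmulMultiplier_mul _ _ _ _).trans (by rw [mul_one])

theorem tmulMultiplier_left_mul_right (m : MultiplierAlgebra X) (n : MultiplierAlgebra Y) :
    tmulMultiplier m 1 * tmulMultiplier 1 n = tmulMultiplier m n :=
  (tmulMultiplier_mul _ _ _ _).trans (by rw [mul_one, one_mul])

theorem tmulMultiplier_right_mul_left (m : MultiplierAlgebra X) (n : MultiplierAlgebra Y) :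
    tmulMultiplier 1 n * tmulMultiplier m 1 = tmulMultiplier m n :=
  (tmulMultiplier_mul _ _ _ _).trans (by rw [mul_one, one_mul])

theorem toMultiplier_tmul (x : X) (y : Y) :
    toMultiplier (x ⊗ₜ[ℂ] y) = tmulMultiplier (toMultiplier x) (toMultiplier y) := by
  refine multiplier_ext (fun w => ?_) fun w => ?_
  · induction w with
    | zero => simp
    | add u v hu hv => rw [map_add, map_add, hu, hv]
    | tmul u v => simp
  · induction w with
    | zero => simp
    | add u v hu hv => rw [map_add, map_add, hu, hv]
    | tmul u v => simp

theorem toMultiplier_map_mulLeft (x : X) (w : X ⊗[ℂ] Y) :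
    toMultiplier (map (mulLeft ℂ x) LinearMap.id w) =
      tmulMultiplier (toMultiplier x) 1 * toMultiplier w := by
  induction w with
  | zero => simp
  | add u v hu hv => simp only [map_add, mul_add, hu, hv]
  | tmul u v =>
    have h : toMultiplier (x * u) = toMultiplier x * toMultiplier u :=
      multiplier_ext (fun z => mul_assoc x u z) fun z => (mul_assoc z x u).symm
    simp [toMultiplier_tmul, tmulMultiplier_mul, h]

theorem toMultiplier_map_mulRight (y : Y) (w : X ⊗[ℂ] Y) :
    toMultiplier (map LinearMap.id (mulRight ℂ y) w) =
      toMultiplier w * tmulMultiplier 1 (toMultiplier y) := by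
  induction w with
  | zero => simp
  | add u v hu hv => simp only [map_add, add_mul, hu, hv]
  | tmul u v =>
    have h : toMultiplier (v * y) = toMultiplier v * toMultiplier y :=
      multiplier_ext (fun z => mul_assoc v y z) fun z => (mul_assoc z v y).symm
    simp [toMultiplier_tmul, tmulMultiplier_mul, h]

end TmulMultiplier

/-! ### The formulas for the two canonical maps -/

variable {A B : Type*}
  [NonUnitalRing A] [Module ℂ A] [IsScalarTower ℂ A A] [SMulCommClass ℂ A A]
  [NonUnitalRing B] [Module ℂ B] [IsScalarTower ℂ B B] [SMulCommClass ℂ B B]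
  {HA : RegularMultiplierHopfAlgebra A} {HB : RegularMultiplierHopfAlgebra B}
  (α : RightModuleAlgebra B HA) (γ : LeftComoduleCoalgebra HA HB)

open SmashProduct

/-- The formula for the first canonical map of the smash coproduct. -/
def smashT₁ : (A ⊗[ℂ] B) ⊗[ℂ] (A ⊗[ℂ] B) →ₗ[ℂ] (A ⊗[ℂ] B) ⊗[ℂ] (A ⊗[ℂ] B) :=
  leg12 γ.cotwistEquiv.symm.toLinearMap ∘ₗ leg23 HA.T₁.toLinearMap ∘ₗ
    leg12 γ.cotwistEquiv.toLinearMap ∘ₗ leg34 α.twistEquiv.toLinearMap ∘ₗ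
      leg23 HB.T₁.toLinearMap ∘ₗ leg34 α.twistEquiv.symm.toLinearMap

/-- The formula for the second canonical map of the smash coproduct. -/
def smashT₂ : (A ⊗[ℂ] B) ⊗[ℂ] (A ⊗[ℂ] B) →ₗ[ℂ] (A ⊗[ℂ] B) ⊗[ℂ] (A ⊗[ℂ] B) :=
  leg34 γ.cotwistEquiv.symm.toLinearMap ∘ₗ leg23 HB.T₂.toLinearMap ∘ₗ
    leg34 γ.cotwistEquiv.toLinearMap ∘ₗ leg12 α.twistEquiv.toLinearMap ∘ₗ
      leg23 HA.T₂.toLinearMap ∘ₗ leg12 α.twistEquiv.symm.toLinearMap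

theorem leg23_T₁_tmul (X : B ⊗[ℂ] A) (c : A) (d : B) :
    leg23 HA.T₁.toLinearMap (X ⊗ₜ (c ⊗ₜ d)) =
      TensorProduct.assoc ℂ (B ⊗[ℂ] A) A B ((TensorProduct.assoc ℂ B A A).symm
        (map LinearMap.id (HA.T₁.toLinearMap ∘ₗ (TensorProduct.mk ℂ A A).flip c) X) ⊗ₜ d) := by
  induction X with
  | zero => simp
  | add u v hu hv => simp only [TensorProduct.add_tmul, map_add, hu, hv]
  | tmul β a =>
    simp only [leg23, LinearMap.comp_apply, LinearEquiv.coe_coe, middle_tmul,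
      TensorProduct.map_tmul, LinearMap.id_apply, LinearMap.flip_apply, TensorProduct.mk_apply]
    generalize HA.T₁ (a ⊗ₜ c) = z
    induction z with
    | zero => simp
    | add u v hu hv => simp only [TensorProduct.add_tmul, TensorProduct.tmul_add, map_add, hu, hv]
    | tmul u v => rfl

theorem leg12_assoc (f : A ⊗[ℂ] B →ₗ[ℂ] B ⊗[ℂ] A) (z : (A ⊗[ℂ] B) ⊗[ℂ] A) (d : B) :
    leg12 f (TensorProduct.assoc ℂ (A ⊗[ℂ] B) A B (z ⊗ₜ d)) =
      TensorProduct.assoc ℂ (B ⊗[ℂ] A) A B (map f LinearMap.id z ⊗ₜ d) := by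
  induction z with
  | zero => simp
  | add u v hu hv => simp only [TensorProduct.add_tmul, map_add, hu, hv]
  | tmul u v => simp [leg12]

/-- Covering by `q` trades `T₂(δ ⊗ β)` for `(δ ⊗ 1)T₁(β ⊗ q)`, so that the coaction axiom in the
form `cotwist₂_T₁` becomes applicable. -/
theorem leg23_T₂_tmul (γ₀ : A) (δ q : B) (X : B ⊗[ℂ] A) :
    map LinearMap.id (map (mulRight ℂ q) LinearMap.id)
        (leg23 HB.T₂.toLinearMap ((γ₀ ⊗ₜ δ) ⊗ₜ X)) =
      map (TensorProduct.mk ℂ A B γ₀ ∘ₗ mulLeft ℂ δ) LinearMap.id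
        (TensorProduct.assoc ℂ B B A
          (map (HB.T₁.toLinearMap ∘ₗ (TensorProduct.mk ℂ B B).flip q) LinearMap.id X)) := by
  induction X with
  | zero => simp
  | add u v hu hv => simp only [TensorProduct.tmul_add, map_add, hu, hv]
  | tmul β a =>
    have h1 : ∀ z : B ⊗[ℂ] B, map LinearMap.id (map (mulRight ℂ q) LinearMap.id)
        ((middle A B B A).symm (γ₀ ⊗ₜ (z ⊗ₜ a))) =
        (middle A B B A).symm (γ₀ ⊗ₜ (map LinearMap.id (mulRight ℂ q) z ⊗ₜ a)) := by
      intro z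
      induction z with
      | zero => simp
      | add u v hu hv =>
        simp only [TensorProduct.add_tmul, TensorProduct.tmul_add, map_add, hu, hv]
      | tmul u v => rfl
    have h2 : leg23 HB.T₂.toLinearMap ((γ₀ ⊗ₜ δ) ⊗ₜ (β ⊗ₜ a)) =
        (middle A B B A).symm (γ₀ ⊗ₜ (HB.T₂ (δ ⊗ₜ β) ⊗ₜ a)) := rfl
    rw [h2, h1, HB.mulRight_T₂]
    simp only [TensorProduct.map_tmul, LinearMap.id_apply, LinearMap.comp_apply,
      LinearMap.flip_apply, TensorProduct.mk_apply, LinearEquiv.coe_coe]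
    generalize HB.T₁ (β ⊗ₜ q) = z
    induction z with
    | zero => simp
    | add u v hu hv => simp only [TensorProduct.add_tmul, TensorProduct.tmul_add, map_add, hu, hv]
    | tmul u v => rfl

end

/-! ### Comparison of the canonical maps inside an algebra containing two copies of `A` and `B` -/

section

variable {A B : Type*}
  [NonUnitalRing A] [Module ℂ A] [IsScalarTower ℂ A A] [SMulCommClass ℂ A A]
  [NonUnitalRing B] [Module ℂ B] [IsScalarTower ℂ B B] [SMulCommClass ℂ B B]
  {HA : RegularMultiplierHopfAlgebra A} {HB : RegularMultiplierHopfAlgebra B}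
  (α : RightModuleAlgebra B HA) (γ : LeftComoduleCoalgebra HA HB)

/-- Linear maps of `A` and `B` to an algebra `M` (twice) that have the algebraic properties of the
embeddings `a ⊗ 1`, `1 ⊗ a`, `b ⊗ 1`, `1 ⊗ b` in `M(AB ⊗ AB)`. -/
structure LegEmbedding (α : RightModuleAlgebra B HA) (M : Type*) [Ring M] [Algebra ℂ M] where
  a₁ : A →ₗ[ℂ] M
  b₁ : B →ₗ[ℂ] M
  a₂ : A →ₗ[ℂ] M
  b₂ : B →ₗ[ℂ] M
  a₁_mul : ∀ x y, a₁ (x * y) = a₁ x * a₁ y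
  b₁_mul : ∀ x y, b₁ (x * y) = b₁ x * b₁ y
  a₂_mul : ∀ x y, a₂ (x * y) = a₂ x * a₂ y
  b₂_mul : ∀ x y, b₂ (x * y) = b₂ x * b₂ y
  b₂_mul_b₁ : ∀ x y, b₂ x * b₁ y = b₁ y * b₂ x
  a₂_mul_b₁ : ∀ x y, a₂ x * b₁ y = b₁ y * a₂ x
  b₁_mul_a₁ : ∀ b a, b₁ b * a₁ a = LinearMap.mul' ℂ M (map a₁ b₁ (α.twist (b ⊗ₜ a)))
  b₂_mul_a₂ : ∀ b a, b₂ b * a₂ a = LinearMap.mul' ℂ M (map a₂ b₂ (α.twist (b ⊗ₜ a)))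

namespace LegEmbedding

variable {α} {M : Type*} [Ring M] [Algebra ℂ M] (E : LegEmbedding α M)

/-- The map `(a ⊗ b) ⊗ (a' ⊗ b') ↦ a₁ b₁ a'₂ b'₂`. -/
def embed : (A ⊗[ℂ] B) ⊗[ℂ] (A ⊗[ℂ] B) →ₗ[ℂ] M :=
  LinearMap.mul' ℂ M ∘ₗ map (LinearMap.mul' ℂ M ∘ₗ map E.a₁ E.b₁)
    (LinearMap.mul' ℂ M ∘ₗ map E.a₂ E.b₂)

theorem embed_tmul (a a' : A) (b b' : B) :
    E.embed ((a ⊗ₜ b) ⊗ₜ (a' ⊗ₜ b')) = E.a₁ a * E.b₁ b * (E.a₂ a' * E.b₂ b') := rfl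

/-- The map `b ⊗ a ↦ b₁ a₂`. -/
def embedBA : B ⊗[ℂ] A →ₗ[ℂ] M := LinearMap.mul' ℂ M ∘ₗ map E.b₁ E.a₂

theorem embedBA_tmul (b : B) (a : A) : E.embedBA (b ⊗ₜ a) = E.b₁ b * E.a₂ a := rfl

/-- The map `(c ⊗ d) ⊗ (u ⊗ v) ↦ (c ⊗ 1) Γ(d) (u ⊗ v)`. -/
def cover : (A ⊗[ℂ] A) ⊗[ℂ] (B ⊗[ℂ] B) →ₗ[ℂ] M :=
  LinearMap.mul' ℂ M ∘ₗ map E.a₁ (LinearMap.mul' ℂ M ∘ₗ map (E.embedBA ∘ₗ γ.T) E.b₂) ∘ₗ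
    (middle A A B B).toLinearMap

theorem cover_tmul (c d : A) (u v : B) :
    E.cover γ ((c ⊗ₜ d) ⊗ₜ (u ⊗ₜ v)) =
      E.a₁ c * (E.embedBA (γ.T (d ⊗ₜ u)) * E.b₂ v) := rfl

theorem a₁_mul_embed_assoc (p : A) (z : A ⊗[ℂ] (B ⊗[ℂ] A)) (d : B) :
    E.a₁ p * E.embed (TensorProduct.assoc ℂ (A ⊗[ℂ] B) A B
        ((TensorProduct.assoc ℂ A B A).symm z ⊗ₜ d)) =
      E.embed (TensorProduct.assoc ℂ (A ⊗[ℂ] B) A B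
        ((TensorProduct.assoc ℂ A B A).symm (map (mulLeft ℂ p) LinearMap.id z) ⊗ₜ d)) := by
  induction z with
  | zero => simp
  | add u v hu hv => simp only [TensorProduct.add_tmul, map_add, mul_add, hu, hv]
  | tmul a w =>
    induction w with
    | zero => simp
    | add u v hu hv =>
      simp only [TensorProduct.tmul_add, TensorProduct.add_tmul, map_add, mul_add, hu, hv]
    | tmul b a' => simp [embed_tmul, a₁_mul, mul_assoc]

theorem cover_mul_a₂ (Y : A ⊗[ℂ] A) (u v : B) (c : A) :
    E.cover γ (Y ⊗ₜ (u ⊗ₜ v)) * E.a₂ c =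
      LinearMap.mul' ℂ M (map E.a₁ (E.embedBA ∘ₗ γ.T ∘ₗ (TensorProduct.mk ℂ A B).flip u) Y) *
        LinearMap.mul' ℂ M (map E.a₂ E.b₂ (α.twist (v ⊗ₜ c))) := by
  rw [← E.b₂_mul_a₂]
  induction Y with
  | zero => simp
  | add y y' hy hy' => simp only [TensorProduct.add_tmul, map_add, add_mul, hy, hy']
  | tmul s t => simp [cover_tmul, mul_assoc]

/-- `(p ⊗ 1)T₁(a u ⊗ v c) = ∑ (p a₁ ⊗ 1)(Γ(a₂)(u ⊗ 1))(1 ⊗ v c)`, up to the maps in the formula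
for `T₁` that do not involve the first factor. -/
theorem embed_leg23_T₁ (p a c : A) (u v : B) :
    E.a₁ p * E.embed (leg12 γ.cotwistEquiv.symm.toLinearMap
        (leg23 HA.T₁.toLinearMap (γ.T (a ⊗ₜ u) ⊗ₜ α.twist (v ⊗ₜ c)))) =
      E.cover γ (HA.T₂ (p ⊗ₜ a) ⊗ₜ (u ⊗ₜ v)) * E.a₂ c := by
  rw [cover_mul_a₂]
  generalize α.twist (v ⊗ₜ c) = r
  induction r with
  | zero => simp
  | add r r' hr hr' => simp only [TensorProduct.tmul_add, map_add, mul_add, hr, hr']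
  | tmul c d =>
    -- The comodule coalgebra axiom: `z` is `((ι ⊗ T)(Δ_A(a) ⊗ u))(1 ⊗ 1 ⊗ c)`, and `T₁₂` sends it
    -- to `((ι ⊗ Δ_A)T(a ⊗ u))(1 ⊗ 1 ⊗ c)`, which is what `(T₁^A)₂₃` produces. Hence `T⁻¹` on the
    -- first two legs gives back `z`, whose left multiples by `p` are known.
    obtain ⟨z, hz, hz'⟩ := γ.comul_right a u c
    have h2 : leg12 γ.cotwistEquiv.symm.toLinearMap
        (leg23 HA.T₁.toLinearMap (γ.T (a ⊗ₜ u) ⊗ₜ (c ⊗ₜ d))) =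
        TensorProduct.assoc ℂ (A ⊗[ℂ] B) A B
          ((TensorProduct.assoc ℂ A B A).symm z ⊗ₜ d) := by
      have h3 := leg12_assoc (cotwist γ.Γ) ((TensorProduct.assoc ℂ A B A).symm z) d
      rw [hz', ← leg23_T₁_tmul] at h3
      refine Eq.trans (congrArg _ h3.symm) ?_
      have h4 : γ.cotwistEquiv.symm.toLinearMap ∘ₗ cotwist γ.Γ = LinearMap.id :=
        LinearMap.ext fun x => γ.cotwistEquiv.symm_apply_apply x
      rw [leg12, leg12, map_map', h4]
      simp
    rw [h2, a₁_mul_embed_assoc, hz]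
    generalize HA.T₂ (p ⊗ₜ a) = Y
    induction Y with
    | zero => simp
    | add r r' hr hr' => simp only [TensorProduct.add_tmul, map_add, add_mul, hr, hr']
    | tmul s t =>
      simp only [TensorProduct.assoc_tmul, TensorProduct.map_tmul, LinearMap.id_apply,
        LinearMap.comp_apply, LinearMap.flip_apply, TensorProduct.mk_apply,
        LinearMap.mul'_apply, LeftComoduleCoalgebra.T]
      generalize cotwist γ.Γ (t ⊗ₜ u) = X
      induction X with
      | zero => simp
      | add r r' hr hr' =>
        simp only [TensorProduct.tmul_add, TensorProduct.add_tmul, map_add, mul_add, add_mul,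
          hr, hr']
      | tmul b a' => simp [embed_tmul, embedBA_tmul, a₂_mul, mul_assoc]

/-- `(p ⊗ 1)T₁(ab ⊗ q c) = (∑ (p a₁ ⊗ 1) Γ(a₂) (Δ(b)(1 ⊗ q)))(1 ⊗ c)`. -/
theorem embed_smashT₁ (p a c : A) (b q : B) :
    E.a₁ p * E.embed (smashT₁ α γ ((a ⊗ₜ b) ⊗ₜ α.twist (q ⊗ₜ c))) =
      E.cover γ (HA.T₂ (p ⊗ₜ a) ⊗ₜ HB.T₁ (b ⊗ₜ q)) * E.a₂ c := by
  have h1 : α.twistEquiv.symm (α.twist (q ⊗ₜ c)) = q ⊗ₜ c :=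
    α.twistEquiv.symm_apply_apply (q ⊗ₜ c)
  have h2 : leg23 HB.T₁.toLinearMap (leg34 α.twistEquiv.symm.toLinearMap
      ((a ⊗ₜ b) ⊗ₜ α.twist (q ⊗ₜ c))) =
      (middle A B B A).symm (a ⊗ₜ (HB.T₁ (b ⊗ₜ q) ⊗ₜ c)) := by
    simp [leg34, h1, leg23]
  simp only [smashT₁, LinearMap.comp_apply, h2]
  generalize HB.T₁ (b ⊗ₜ q) = w
  induction w with
  | zero => simp
  | add r r' hr hr' =>
    simp only [TensorProduct.tmul_add, TensorProduct.add_tmul, map_add, mul_add, add_mul, hr, hr']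
  | tmul u v => exact E.embed_leg23_T₁ γ p a c u v

theorem embed_mul_b₂ (y : (A ⊗[ℂ] B) ⊗[ℂ] (A ⊗[ℂ] B)) (q : B) :
    E.embed y * E.b₂ q = E.embed (map LinearMap.id (map LinearMap.id (mulRight ℂ q)) y) := by
  induction y with
  | zero => simp
  | add r r' hr hr' => simp only [map_add, add_mul, hr, hr']
  | tmul y y' =>
    induction y with
    | zero => simp
    | add r r' hr hr' => simp only [TensorProduct.add_tmul, map_add, add_mul, hr, hr']
    | tmul a b =>
      induction y' with
      | zero => simp
      | add r r' hr hr' => simp only [TensorProduct.tmul_add, map_add, add_mul, hr, hr']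
      | tmul a' b' => simp [embed_tmul, b₂_mul, mul_assoc]

theorem cotwistEquiv_symm_mulRight (q : B) (X : B ⊗[ℂ] A) :
    map LinearMap.id (mulRight ℂ q) (γ.cotwistEquiv.symm X) =
      γ.cotwistEquiv.symm (map (mulRight ℂ q) LinearMap.id X) := by
  apply γ.cotwistEquiv.injective
  rw [LinearEquiv.apply_symm_apply, LeftCoaction.cotwistEquiv_apply, γ.cotwist_mulRight,
    ← LeftCoaction.cotwistEquiv_apply, LinearEquiv.apply_symm_apply]

theorem leg34_symm_mulRight (q : B) (y : (A ⊗[ℂ] B) ⊗[ℂ] (B ⊗[ℂ] A)) :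
    map LinearMap.id (map LinearMap.id (mulRight ℂ q))
        (leg34 γ.cotwistEquiv.symm.toLinearMap y) =
      leg34 γ.cotwistEquiv.symm.toLinearMap
        (map LinearMap.id (map (mulRight ℂ q) LinearMap.id) y) := by
  have h : map LinearMap.id (mulRight ℂ q) ∘ₗ γ.cotwistEquiv.symm.toLinearMap =
      γ.cotwistEquiv.symm.toLinearMap ∘ₗ map (mulRight ℂ q) LinearMap.id :=
    LinearMap.ext fun X => cotwistEquiv_symm_mulRight γ q X
  rw [leg34, map_map', map_map', h]

/-- The map `u ⊗ v ↦ (Γ(t)(u ⊗ 1))(1 ⊗ v)`. -/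
def coverB (t : A) : B ⊗[ℂ] B →ₗ[ℂ] M :=
  LinearMap.mul' ℂ M ∘ₗ map (E.embedBA ∘ₗ γ.T ∘ₗ TensorProduct.mk ℂ A B t) E.b₂

theorem cover_tmul_left (s t : A) (w : B ⊗[ℂ] B) :
    E.cover γ ((s ⊗ₜ t) ⊗ₜ w) = E.a₁ s * E.coverB γ t w := by
  induction w with
  | zero => simp
  | add r r' hr hr' => simp only [TensorProduct.tmul_add, map_add, mul_add, hr, hr']
  | tmul u v => rfl

/-- In `((ι ⊗ Γ)Γ(t))(u ⊗ v ⊗ 1)` the inverse of `T` on the last two legs undoes the outer `Γ` and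
leaves `Γ(t)(u ⊗ 1)` followed by `v`. -/
theorem embed_cotwist₂ (c t : A) (d : B) (w : B ⊗[ℂ] B) :
    E.embed (leg34 γ.cotwistEquiv.symm.toLinearMap
        (map (TensorProduct.mk ℂ A B c ∘ₗ mulLeft ℂ d) LinearMap.id
          (TensorProduct.assoc ℂ B B A (γ.cotwist₂ t w)))) =
      E.a₁ c * E.b₁ d * E.coverB γ t w := by
  induction w with
  | zero => simp
  | add r r' hr hr' => simp only [map_add, mul_add, hr, hr']
  | tmul u v =>
    have h : (γ.cotwistEquiv.symm.toLinearMap ∘ₗ LinearMap.id) ∘ₗ cotwist γ.Γ ∘ₗ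
        (TensorProduct.mk ℂ A B).flip v = (TensorProduct.mk ℂ A B).flip v :=
      LinearMap.ext fun x => γ.cotwistEquiv.symm_apply_apply (x ⊗ₜ v)
    rw [γ.cotwist₂_tmul, LinearEquiv.apply_symm_apply, leg34, map_map', map_map', h]
    simp only [coverB, LinearMap.comp_apply, TensorProduct.map_tmul, TensorProduct.mk_apply,
      LinearMap.mul'_apply, LeftComoduleCoalgebra.T]
    generalize cotwist γ.Γ (t ⊗ₜ u) = X
    induction X with
    | zero => simp
    | add r r' hr hr' => simp only [map_add, mul_add, add_mul, hr, hr']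
    | tmul b a => simp [embed_tmul, embedBA_tmul, b₁_mul, mul_assoc]

/-- `T₂(c p ⊗ ab)(1 ⊗ q) = (c ⊗ 1)(∑ (p a₁ ⊗ 1) Γ(a₂) (Δ(b)(1 ⊗ q)))`. -/
theorem embed_smashT₂ (p a : A) (c b q : B) :
    E.embed (smashT₂ α γ (α.twist (c ⊗ₜ p) ⊗ₜ (a ⊗ₜ b))) * E.b₂ q =
      E.b₁ c * E.cover γ (HA.T₂ (p ⊗ₜ a) ⊗ₜ HB.T₁ (b ⊗ₜ q)) := by
  have h1 : α.twistEquiv.symm (α.twist (c ⊗ₜ p)) = c ⊗ₜ p :=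
    α.twistEquiv.symm_apply_apply (c ⊗ₜ p)
  have h2 : leg23 HA.T₂.toLinearMap (leg12 α.twistEquiv.symm.toLinearMap
      (α.twist (c ⊗ₜ p) ⊗ₜ (a ⊗ₜ b))) =
      (middle B A A B).symm (c ⊗ₜ (HA.T₂ (p ⊗ₜ a) ⊗ₜ b)) := by
    simp [leg12, h1, leg23]
  simp only [smashT₂, LinearMap.comp_apply, h2]
  generalize HA.T₂ (p ⊗ₜ a) = Y
  induction Y with
  | zero => simp
  | add r r' hr hr' =>
    simp only [TensorProduct.tmul_add, TensorProduct.add_tmul, map_add, mul_add, add_mul, hr, hr']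
  | tmul s t =>
    rw [cover_tmul_left, ← mul_assoc, E.b₁_mul_a₁]
    have h3 : leg34 γ.cotwistEquiv.toLinearMap (leg12 α.twistEquiv.toLinearMap
        ((middle B A A B).symm (c ⊗ₜ ((s ⊗ₜ t) ⊗ₜ b)))) =
        α.twist (c ⊗ₜ s) ⊗ₜ cotwist γ.Γ (t ⊗ₜ b) := rfl
    rw [h3]
    generalize α.twist (c ⊗ₜ s) = r
    induction r with
    | zero => simp
    | add r r' hr hr' =>
      simp only [TensorProduct.add_tmul, map_add, add_mul, hr,
        hr']
    | tmul x d =>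
      -- The factor `q` passes through `T⁻¹` by right `B`-linearity and turns `T₂^B` into `T₁^B`.
      -- The coaction axiom then recognises the double coaction on `Δ_B(b)(1 ⊗ q)`, of which `T⁻¹`
      -- removes one layer.
      rw [embed_mul_b₂, leg34_symm_mulRight, leg23_T₂_tmul, ← γ.cotwist₂_T₁, embed_cotwist₂]
      rfl

/-- `T₂(y ⊗ x)(1 ⊗ z) = (y ⊗ 1)T₁(x ⊗ z)` for the maps `T₁`, `T₂` given by the formulas. -/
theorem embed_smashT₂_mul (x y z : A ⊗[ℂ] B) :
    E.embed (smashT₂ α γ (y ⊗ₜ x)) * LinearMap.mul' ℂ M (map E.a₂ E.b₂ z) =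
      LinearMap.mul' ℂ M (map E.a₁ E.b₁ y) * E.embed (smashT₁ α γ (x ⊗ₜ z)) := by
  obtain ⟨y, rfl⟩ := α.twist_bijective.2 y
  obtain ⟨z, rfl⟩ := α.twist_bijective.2 z
  induction x with
  | zero => simp
  | add r r' hr hr' =>
    simp only [TensorProduct.tmul_add, TensorProduct.add_tmul, map_add, mul_add, add_mul, hr, hr']
  | tmul a b =>
    induction y with
    | zero => simp
    | add r r' hr hr' =>
      simp only [TensorProduct.add_tmul, map_add, add_mul, hr, hr']
    | tmul c p =>
      induction z with
      | zero => simp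
      | add r r' hr hr' =>
        simp only [TensorProduct.tmul_add, map_add, mul_add, hr, hr']
      | tmul q e =>
        -- With `y = cp` and `z = qe`, both sides reduce to the covered coproduct multiplied by `c`
        -- in the first factor from the left and by `e` in the second from the right.
        rw [← E.b₁_mul_a₁, ← E.b₂_mul_a₂, ← mul_assoc, embed_smashT₂, mul_assoc, mul_assoc,
          embed_smashT₁]

theorem embedBA_mul_b₁ (X : B ⊗[ℂ] A) (q : B) :
    E.embedBA X * E.b₁ q = E.embedBA (map (mulRight ℂ q) LinearMap.id X) := by
  induction X with
  | zero => simp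
  | add r r' hr hr' => simp only [map_add, add_mul, hr, hr']
  | tmul b a => simp [embedBA_tmul, mul_assoc, a₂_mul_b₁, b₁_mul]

/-- `((c ⊗ 1) Γ(d) w)(q ⊗ 1) = (c ⊗ 1) Γ(d) (w (q ⊗ 1))`. -/
theorem cover_mul_b₁ (Y : A ⊗[ℂ] A) (w : B ⊗[ℂ] B) (q : B) :
    E.cover γ (Y ⊗ₜ w) * E.b₁ q = E.cover γ (Y ⊗ₜ map (mulRight ℂ q) LinearMap.id w) := by
  induction Y with
  | zero => simp
  | add r r' hr hr' => simp only [TensorProduct.add_tmul, map_add, add_mul, hr, hr']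
  | tmul c d =>
    induction w with
    | zero => simp
    | add r r' hr hr' => simp only [TensorProduct.tmul_add, map_add, add_mul, hr, hr']
    | tmul u v =>
      simp only [TensorProduct.map_tmul, cover_tmul, LinearMap.mulRight_apply,
        LinearMap.id_apply, LeftComoduleCoalgebra.T, γ.cotwist_mul]
      rw [← embedBA_mul_b₁, mul_assoc, mul_assoc, mul_assoc, E.b₂_mul_b₁]

end LegEmbedding

end

/-! ### Realisation in `M(AB ⊗ AB)`, existence and uniqueness of the smash coproduct -/

section

variable {A B : Type*}
  [NonUnitalRing A] [Module ℂ A] [IsScalarTower ℂ A A] [SMulCommClass ℂ A A]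
  [NonUnitalRing B] [Module ℂ B] [IsScalarTower ℂ B B] [SMulCommClass ℂ B B]
  {HA : RegularMultiplierHopfAlgebra A} {HB : RegularMultiplierHopfAlgebra B}
  (α : RightModuleAlgebra B HA) (γ : LeftComoduleCoalgebra HA HB)

open SmashProduct

theorem mul'_map_inclA_inclB (z : A ⊗[ℂ] B) :
    LinearMap.mul' ℂ (MultiplierAlgebra (SmashProduct α)) (map (inclA α) (inclB α) z) =
      toMultiplier (equiv α z) := by
  have h : LinearMap.mul' ℂ (MultiplierAlgebra (SmashProduct α)) ∘ₗ
      map (inclA α) (inclB α) = toMultiplier ∘ₗ (equiv α).toLinearMap :=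
    TensorProduct.ext' fun a b => inclA_mul_inclB α a b
  exact LinearMap.congr_fun h z

section

variable {X Y V W : Type*}
  [NonUnitalRing X] [Module ℂ X] [IsScalarTower ℂ X X] [SMulCommClass ℂ X X]
  [NonUnitalRing Y] [Module ℂ Y] [IsScalarTower ℂ Y Y] [SMulCommClass ℂ Y Y]
  [AddCommGroup V] [Module ℂ V] [AddCommGroup W] [Module ℂ W]

theorem mul'_map_tmulMultiplier_left (f : V →ₗ[ℂ] MultiplierAlgebra X)
    (g : W →ₗ[ℂ] MultiplierAlgebra X) (z : V ⊗[ℂ] W) :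
    LinearMap.mul' ℂ (MultiplierAlgebra (X ⊗[ℂ] Y))
      (map (tmulMultiplier.flip (1 : MultiplierAlgebra Y) ∘ₗ f)
        (tmulMultiplier.flip (1 : MultiplierAlgebra Y) ∘ₗ g) z) =
      tmulMultiplier (LinearMap.mul' ℂ (MultiplierAlgebra X) (map f g z))
        (1 : MultiplierAlgebra Y) := by
  induction z with
  | zero => simp only [map_zero, LinearMap.zero_apply]
  | add x y hx hy => simp only [map_add, LinearMap.add_apply, hx, hy]
  | tmul v w => exact tmulMultiplier_mul_one (f v) (g w)

theorem mul'_map_tmulMultiplier_right (f : V →ₗ[ℂ] MultiplierAlgebra Y)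
    (g : W →ₗ[ℂ] MultiplierAlgebra Y) (z : V ⊗[ℂ] W) :
    LinearMap.mul' ℂ (MultiplierAlgebra (X ⊗[ℂ] Y))
      (map (tmulMultiplier (1 : MultiplierAlgebra X) ∘ₗ f)
        (tmulMultiplier (1 : MultiplierAlgebra X) ∘ₗ g) z) =
      tmulMultiplier (1 : MultiplierAlgebra X)
        (LinearMap.mul' ℂ (MultiplierAlgebra Y) (map f g z)) := by
  induction z with
  | zero => simp only [map_zero]
  | add x y hx hy => simp only [map_add, hx, hy]
  | tmul v w => exact tmulMultiplier_one_mul (f v) (g w)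

end

theorem mul'_map_incl_left (z : A ⊗[ℂ] B) :
    LinearMap.mul' ℂ (MultiplierAlgebra (SmashProduct α ⊗[ℂ] SmashProduct α))
      (map (tmulMultiplier.flip (1 : MultiplierAlgebra (SmashProduct α)) ∘ₗ inclA α)
        (tmulMultiplier.flip (1 : MultiplierAlgebra (SmashProduct α)) ∘ₗ inclB α) z) =
      tmulMultiplier (toMultiplier (equiv α z)) (1 : MultiplierAlgebra (SmashProduct α)) :=
  (mul'_map_tmulMultiplier_left (inclA α) (inclB α) z).trans
    (congrArg (fun m => tmulMultiplier m (1 : MultiplierAlgebra (SmashProduct α)))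
      (mul'_map_inclA_inclB α z))

theorem mul'_map_incl_right (z : A ⊗[ℂ] B) :
    LinearMap.mul' ℂ (MultiplierAlgebra (SmashProduct α ⊗[ℂ] SmashProduct α))
      (map (tmulMultiplier (1 : MultiplierAlgebra (SmashProduct α)) ∘ₗ inclA α)
        (tmulMultiplier (1 : MultiplierAlgebra (SmashProduct α)) ∘ₗ inclB α) z) =
      tmulMultiplier (1 : MultiplierAlgebra (SmashProduct α)) (toMultiplier (equiv α z)) :=
  (mul'_map_tmulMultiplier_right (inclA α) (inclB α) z).trans
    (congrArg (fun m => tmulMultiplier (1 : MultiplierAlgebra (SmashProduct α)) m)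
      (mul'_map_inclA_inclB α z))

/-- The embeddings of `A` and `B` in the two factors of `M(AB ⊗ AB)`. -/
def smashLegs : LegEmbedding α
    (MultiplierAlgebra (SmashProduct α ⊗[ℂ] SmashProduct α)) where
  a₁ := tmulMultiplier.flip 1 ∘ₗ inclA α
  b₁ := tmulMultiplier.flip 1 ∘ₗ inclB α
  a₂ := tmulMultiplier 1 ∘ₗ inclA α
  b₂ := tmulMultiplier 1 ∘ₗ inclB α
  a₁_mul x y := (congrArg
      (fun m => tmulMultiplier m (1 : MultiplierAlgebra (SmashProduct α))) (inclA_mul α x y)).trans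
    (tmulMultiplier_mul_one (inclA α x) (inclA α y)).symm
  b₁_mul x y := (congrArg
      (fun m => tmulMultiplier m (1 : MultiplierAlgebra (SmashProduct α))) (inclB_mul α x y)).trans
    (tmulMultiplier_mul_one (inclB α x) (inclB α y)).symm
  a₂_mul x y := (congrArg
      (fun m => tmulMultiplier (1 : MultiplierAlgebra (SmashProduct α)) m) (inclA_mul α x y)).trans
    (tmulMultiplier_one_mul (inclA α x) (inclA α y)).symm
  b₂_mul x y := (congrArg
      (fun m => tmulMultiplier (1 : MultiplierAlgebra (SmashProduct α)) m) (inclB_mul α x y)).trans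
    (tmulMultiplier_one_mul (inclB α x) (inclB α y)).symm
  b₂_mul_b₁ x y := (tmulMultiplier_right_mul_left (inclB α y) (inclB α x)).trans
    (tmulMultiplier_left_mul_right (inclB α y) (inclB α x)).symm
  a₂_mul_b₁ x y := (tmulMultiplier_right_mul_left (inclB α y) (inclA α x)).trans
    (tmulMultiplier_left_mul_right (inclB α y) (inclA α x)).symm
  b₁_mul_a₁ b a := (tmulMultiplier_mul_one (inclB α b) (inclA α a)).trans
    ((congrArg
      (fun m => tmulMultiplier m (1 : MultiplierAlgebra (SmashProduct α)))
        (inclB_mul_inclA α b a)).trans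
      (mul'_map_incl_left α (α.twist (b ⊗ₜ a))).symm)
  b₂_mul_a₂ b a := (tmulMultiplier_one_mul (inclB α b) (inclA α a)).trans
    ((congrArg
      (fun m => tmulMultiplier (1 : MultiplierAlgebra (SmashProduct α)) m)
        (inclB_mul_inclA α b a)).trans
      (mul'_map_incl_right α (α.twist (b ⊗ₜ a))).symm)

theorem smashLegs_embed (y : (A ⊗[ℂ] B) ⊗[ℂ] (A ⊗[ℂ] B)) :
    (smashLegs α).embed y =
      toMultiplier (map (equiv α).toLinearMap (equiv α).toLinearMap y) := by
  have h : (smashLegs α).embed =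
      toMultiplier ∘ₗ map (equiv α).toLinearMap (equiv α).toLinearMap := by
    refine TensorProduct.ext' fun x x' => ?_
    refine Eq.trans (congrArg₂ (fun m n => m * n) (mul'_map_incl_left α x)
      (mul'_map_incl_right α x')) ?_
    exact (tmulMultiplier_left_mul_right _ _).trans (toMultiplier_tmul _ _).symm
  exact LinearMap.congr_fun h y

theorem smashLegs_cover : (smashLegs α).cover γ = smashCover α γ := by
  have h : (smashLegs α).embedBA = TensorProduct.lift
      (tmulMultiplier.compl₁₂ (inclB α) (inclA α)) :=
    TensorProduct.ext' fun b a => tmulMultiplier_left_mul_right (inclB α b) (inclA α a)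
  rw [LegEmbedding.cover, h]
  rfl

/-- The map `T₁` of the smash coproduct on `AB ⊗ AB`. -/
def canonicalMap₁ : SmashProduct α ⊗[ℂ] SmashProduct α →ₗ[ℂ]
    SmashProduct α ⊗[ℂ] SmashProduct α :=
  map (equiv α).toLinearMap (equiv α).toLinearMap ∘ₗ smashT₁ α γ ∘ₗ
    map (equiv α).symm.toLinearMap (equiv α).symm.toLinearMap

/-- The map `T₂` of the smash coproduct on `AB ⊗ AB`. -/
def canonicalMap₂ : SmashProduct α ⊗[ℂ] SmashProduct α →ₗ[ℂ]
    SmashProduct α ⊗[ℂ] SmashProduct α :=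
  map (equiv α).toLinearMap (equiv α).toLinearMap ∘ₗ smashT₂ α γ ∘ₗ
    map (equiv α).symm.toLinearMap (equiv α).symm.toLinearMap

theorem toMultiplier_canonicalMap₁ (x z : A ⊗[ℂ] B) :
    toMultiplier (canonicalMap₁ α γ (equiv α x ⊗ₜ equiv α z)) =
      (smashLegs α).embed (smashT₁ α γ (x ⊗ₜ z)) :=
  (smashLegs_embed α _).symm

theorem toMultiplier_canonicalMap₂ (x z : A ⊗[ℂ] B) :
    toMultiplier (canonicalMap₂ α γ (equiv α x ⊗ₜ equiv α z)) =
      (smashLegs α).embed (smashT₂ α γ (x ⊗ₜ z)) :=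
  (smashLegs_embed α _).symm

/-- The hypothesis of `exists_of_canonicalMaps`. It can be checked in `M(AB ⊗ AB)`, since
non-degeneracy makes `AB ⊗ AB` embed there. -/
theorem canonicalMap₂_mulRight (x y z : SmashProduct α) :
    map LinearMap.id (mulRight ℂ z) (canonicalMap₂ α γ (y ⊗ₜ x)) =
      map (mulLeft ℂ y) LinearMap.id (canonicalMap₁ α γ (x ⊗ₜ z)) := by
  obtain ⟨x, rfl⟩ := (equiv α).surjective x
  obtain ⟨y, rfl⟩ := (equiv α).surjective y
  obtain ⟨z, rfl⟩ := (equiv α).surjective z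
  apply (nondegenerate α HB).tensor.toMultiplier_injective
  rw [toMultiplier_map_mulRight, toMultiplier_map_mulLeft, toMultiplier_canonicalMap₁,
    toMultiplier_canonicalMap₂]
  have h := (smashLegs α).embed_smashT₂_mul γ x y z
  exact (congrArg _ (mul'_map_incl_right α z)).symm.trans
    (h.trans (congrArg (fun m => m * _) (mul'_map_incl_left α y)))

/-- The products `b x` span `AB`, because `R` is onto, `B` is spanned by products, and `R(bb' ⊗ a) =
b R(b' ⊗ a)`. -/
theorem Bmul_span (HB : RegularMultiplierHopfAlgebra B) (α : RightModuleAlgebra B HA)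
    {p : A ⊗[ℂ] B → Prop} (x : A ⊗[ℂ] B) (h0 : p 0) (hadd : ∀ x y, p x → p y → p (x + y))
    (h : ∀ b x, p (α.Bmul b x)) : p x := by
  obtain ⟨u, rfl⟩ := α.twist_bijective.2 x
  induction u with
  | zero => rwa [map_zero]
  | add u v hu hv => rw [map_add]; exact hadd _ _ hu hv
  | tmul b a =>
    obtain ⟨w, rfl⟩ := HB.mul'_surjective b
    induction w with
    | zero => simpa using h0
    | add u v hu hv => rw [map_add, TensorProduct.add_tmul, map_add]; exact hadd _ _ hu hv
    | tmul b b' =>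
      rw [LinearMap.mul'_apply, α.twist_mul_left]
      exact h _ _

theorem mulLeft_span {V : Type*} [AddCommGroup V] [Module ℂ V]
    (HA : RegularMultiplierHopfAlgebra A) {p : A ⊗[ℂ] V → Prop} (x : A ⊗[ℂ] V) (h0 : p 0)
    (hadd : ∀ x y, p x → p y → p (x + y))
    (h : ∀ a x, p (map (mulLeft ℂ a) LinearMap.id x)) : p x := by
  induction x with
  | zero => exact h0
  | add u v hu hv => exact hadd _ _ hu hv
  | tmul a b =>
    obtain ⟨w, rfl⟩ := HA.mul'_surjective a
    induction w with
    | zero => simpa using h0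
    | add u v hu hv => rw [map_add, TensorProduct.add_tmul]; exact hadd _ _ hu hv
    | tmul a a' => exact h a (a' ⊗ₜ b)

section Ext

variable {N X V : Type*} [AddCommGroup N] [Module ℂ N] [AddCommGroup X] [Module ℂ X]
  [AddCommGroup V] [Module ℂ V]

theorem linearMap_ext_mulLeft {f g : X ⊗[ℂ] (A ⊗[ℂ] V) →ₗ[ℂ] N}
    (HA : RegularMultiplierHopfAlgebra A)
    (h : ∀ x c z, f (x ⊗ₜ map (mulLeft ℂ c) LinearMap.id z) =
      g (x ⊗ₜ map (mulLeft ℂ c) LinearMap.id z)) : f = g := by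
  refine TensorProduct.ext' fun x z => ?_
  induction z using mulLeft_span HA with
  | h0 => simp
  | hadd u v hu hv => rw [TensorProduct.tmul_add, map_add, map_add, hu, hv]
  | h a z => exact h x a z

theorem linearMap_ext_Bmul {f g : (A ⊗[ℂ] B) ⊗[ℂ] (A ⊗[ℂ] B) →ₗ[ℂ] N}
    (HB : RegularMultiplierHopfAlgebra B)
    (h : ∀ q q' x x', f (α.Bmul q x ⊗ₜ α.Bmul q' x') = g (α.Bmul q x ⊗ₜ α.Bmul q' x')) :
    f = g := by
  refine TensorProduct.ext' fun x x' => ?_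
  induction x using Bmul_span HB α with
  | h0 => simp
  | hadd u v hu hv => rw [TensorProduct.add_tmul, map_add, map_add, hu, hv]
  | h q x =>
    induction x' using Bmul_span HB α with
    | h0 => simp
    | hadd u v hu hv => rw [TensorProduct.tmul_add, map_add, map_add, hu, hv]
    | h q' x' => exact h q q' x x'

end Ext

/-- A multiplier `m` of `AB ⊗ AB` is determined by the elements `m(1 ⊗ c)` with `c ∈ A`. -/
theorem multiplier_ext_inclA (HB : RegularMultiplierHopfAlgebra B)
    {m n : MultiplierAlgebra (SmashProduct α ⊗[ℂ] SmashProduct α)}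
    (h : ∀ c, m * tmulMultiplier 1 (inclA α c) = n * tmulMultiplier 1 (inclA α c)) : m = n := by
  have key : lmul m ∘ₗ map LinearMap.id (equiv α).toLinearMap =
      lmul n ∘ₗ map LinearMap.id (equiv α).toLinearMap :=
    linearMap_ext_mulLeft HA fun x c z =>
      congrArg (fun k => lmul k (x ⊗ₜ equiv α z)) (h c)
  apply (nondegenerate α HB).tensor.multiplier_ext_left
  intro w
  obtain ⟨w, rfl⟩ :=
    (TensorProduct.congr (LinearEquiv.refl ℂ (SmashProduct α)) (equiv α)).surjective w
  exact LinearMap.congr_fun key w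

theorem inclA_cancel {V : Type*} [AddCommGroup V] [Module ℂ V] {z w : SmashProduct α ⊗[ℂ] V}
    (h : ∀ p, map (lmul (inclA α p)) LinearMap.id z = map (lmul (inclA α p)) LinearMap.id w) :
    z = w := by
  rw [← sub_eq_zero]
  apply eq_zero_of_map_left (fun p : A => lmul (inclA α p))
  · intro x hx
    obtain ⟨x, rfl⟩ := (equiv α).surjective x
    have hx' : x = 0 := HA.cancel_left fun p =>
      (equiv α).injective ((hx p).trans (by rw [map_zero, map_zero]))
    rw [hx', map_zero]
  · intro p
    rw [map_sub, sub_eq_zero, h]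

/-- A multiplier `m` of `AB ⊗ AB` is determined by the elements `(p ⊗ 1)m(q ⊗ q')` with `p ∈ A`
and `q, q' ∈ B`. -/
theorem multiplier_ext_inclA_inclB (HB : RegularMultiplierHopfAlgebra B)
    {m n : MultiplierAlgebra (SmashProduct α ⊗[ℂ] SmashProduct α)}
    (h : ∀ p q q', tmulMultiplier (inclA α p) 1 * m *
        tmulMultiplier (inclB α q) (inclB α q') =
      tmulMultiplier (inclA α p) 1 * n * tmulMultiplier (inclB α q) (inclB α q')) : m = n := by
  have key : lmul m ∘ₗ map (equiv α).toLinearMap (equiv α).toLinearMap =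
      lmul n ∘ₗ map (equiv α).toLinearMap (equiv α).toLinearMap :=
    linearMap_ext_Bmul α HB fun q q' x x' => inclA_cancel α fun p =>
      congrArg (fun k => lmul k (equiv α x ⊗ₜ equiv α x')) (h p q q')
  apply (nondegenerate α HB).tensor.multiplier_ext_left
  intro w
  obtain ⟨w, rfl⟩ := (TensorProduct.congr (equiv α) (equiv α)).surjective w
  exact LinearMap.congr_fun key w

/-- `embed_smashT₁` gives the equality after multiplication with `1 ⊗ c`, since `R(q ⊗ c)` is the
product `qc`. A multiplier is determined by these products, so `c` can be dropped. -/
theorem mul_tmulMultiplier_inclB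
    {Δ : SmashProduct α →ₗ[ℂ] MultiplierAlgebra (SmashProduct α ⊗[ℂ] SmashProduct α)}
    (h : IsCanonicalMap₁ Δ (canonicalMap₁ α γ)) (p a : A) (b q : B) :
    (smashLegs α).a₁ p * (Δ (equiv α (a ⊗ₜ b)) * (smashLegs α).b₂ q) =
      (smashLegs α).cover γ (HA.T₂ (p ⊗ₜ a) ⊗ₜ HB.T₁ (b ⊗ₜ q)) := by
  apply multiplier_ext_inclA α HB
  intro c
  have h1 : (smashLegs α).embed (smashT₁ α γ ((a ⊗ₜ b) ⊗ₜ α.twist (q ⊗ₜ c))) =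
      Δ (equiv α (a ⊗ₜ b)) * ((smashLegs α).b₂ q * (smashLegs α).a₂ c) := by
    rw [(smashLegs α).b₂_mul_a₂ q c]
    exact (toMultiplier_canonicalMap₁ α γ _ _).symm.trans ((h _ _).trans
      (congrArg (fun m => Δ (equiv α (a ⊗ₜ b)) * m) (mul'_map_incl_right α _).symm))
  have h2 := (smashLegs α).embed_smashT₁ γ p a c b q
  rw [h1] at h2
  refine Eq.trans ?_ h2
  exact (mul_assoc ((smashLegs α).a₁ p) (Δ (equiv α (a ⊗ₜ b)) * (smashLegs α).b₂ q)
    ((smashLegs α).a₂ c)).trans (congrArg (fun m => (smashLegs α).a₁ p * m)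
      (mul_assoc (Δ (equiv α (a ⊗ₜ b))) ((smashLegs α).b₂ q) ((smashLegs α).a₂ c)))

/-- Multiplication with `q ⊗ 1` completes the covering `Δ_B(b)(1 ⊗ q')` to `Δ_B(b)(q ⊗ q')`: it
commutes with `1 ⊗ v`, and `Γ(d)(u ⊗ 1)` absorbs it into `u`. -/
theorem isSmashCoproduct_of_isCanonicalMap₁
    {Δ : SmashProduct α →ₗ[ℂ] MultiplierAlgebra (SmashProduct α ⊗[ℂ] SmashProduct α)}
    (h : IsCanonicalMap₁ Δ (canonicalMap₁ α γ)) : IsSmashCoproduct α γ Δ := by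
  intro p a b q q'
  have h1 := (smashLegs α).cover_mul_b₁ γ (HA.T₂ (p ⊗ₜ a)) (HB.T₁ (b ⊗ₜ q')) q
  rw [← mul_tmulMultiplier_inclB α γ h, smashLegs_cover, ← HB.lmul_comul_tmul] at h1
  refine Eq.trans ?_ h1
  have h2 : (tmulMultiplier (inclB α q) (inclB α q') :
      MultiplierAlgebra (SmashProduct α ⊗[ℂ] SmashProduct α)) =
      (smashLegs α).b₂ q' * (smashLegs α).b₁ q :=
    (tmulMultiplier_right_mul_left (inclB α q) (inclB α q')).symm
  have h3 : ∀ x y z w : MultiplierAlgebra (SmashProduct α ⊗[ℂ] SmashProduct α),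
      x * y * (z * w) = x * (y * z) * w := fun x y z w => by simp only [mul_assoc]
  exact (congrArg
      (fun m => tmulMultiplier (inclA α p) 1 * Δ (equiv α (a ⊗ₜ b)) * m) h2).trans
    (h3 ((smashLegs α).a₁ p) (Δ (equiv α (a ⊗ₜ b))) ((smashLegs α).b₂ q')
      ((smashLegs α).b₁ q))

theorem isSmashCoproduct_unique
    {Δ Δ' : SmashProduct α →ₗ[ℂ] MultiplierAlgebra (SmashProduct α ⊗[ℂ] SmashProduct α)}
    (h : IsSmashCoproduct α γ Δ) (h' : IsSmashCoproduct α γ Δ') : Δ = Δ' := by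
  refine LinearMap.ext fun x => ?_
  obtain ⟨x, rfl⟩ := (equiv α).surjective x
  induction x with
  | zero => rw [map_zero, map_zero, map_zero]
  | add u v hu hv => rw [map_add, map_add, map_add, hu, hv]
  | tmul a b =>
    exact multiplier_ext_inclA_inclB α HB fun p q q' =>
      (h p a b q q').trans (h' p a b q q').symm

/-! ### Bijectivity of the canonical maps -/

section Bijective

variable {X Y Y' Z Z' W : Type*} [AddCommGroup X] [Module ℂ X] [AddCommGroup Y] [Module ℂ Y]
  [AddCommGroup Y'] [Module ℂ Y'] [AddCommGroup Z] [Module ℂ Z] [AddCommGroup Z'] [Module ℂ Z']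
  [AddCommGroup W] [Module ℂ W]

theorem leg12_bijective (f : X ⊗[ℂ] Y ≃ₗ[ℂ] Y' ⊗[ℂ] Z') :
    Function.Bijective (leg12 (Z := Z) (W := W) f.toLinearMap) :=
  (TensorProduct.congr f (LinearEquiv.refl ℂ (Z ⊗[ℂ] W))).bijective

theorem leg34_bijective (f : Z ⊗[ℂ] W ≃ₗ[ℂ] Y' ⊗[ℂ] Z') :
    Function.Bijective (leg34 (X := X) (Y := Y) f.toLinearMap) :=
  (TensorProduct.congr (LinearEquiv.refl ℂ (X ⊗[ℂ] Y)) f).bijective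

theorem leg23_bijective (f : Y ⊗[ℂ] Z ≃ₗ[ℂ] Y' ⊗[ℂ] Z') :
    Function.Bijective (leg23 (X := X) (W := W) f.toLinearMap) :=
  (((middle X Y Z W).trans (TensorProduct.congr (LinearEquiv.refl ℂ X)
    (TensorProduct.congr f (LinearEquiv.refl ℂ W)))).trans (middle X Y' Z' W).symm).bijective

end Bijective

theorem smashT₁_bijective : Function.Bijective (smashT₁ α γ) := by
  simp only [smashT₁, LinearMap.coe_comp]
  exact (leg12_bijective γ.cotwistEquiv.symm).comp ((leg23_bijective HA.T₁).comp
    ((leg12_bijective γ.cotwistEquiv).comp ((leg34_bijective α.twistEquiv).comp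
      ((leg23_bijective HB.T₁).comp (leg34_bijective α.twistEquiv.symm)))))

theorem smashT₂_bijective : Function.Bijective (smashT₂ α γ) := by
  simp only [smashT₂, LinearMap.coe_comp]
  exact (leg34_bijective γ.cotwistEquiv.symm).comp ((leg23_bijective HB.T₂).comp
    ((leg34_bijective γ.cotwistEquiv).comp ((leg12_bijective α.twistEquiv).comp
      ((leg23_bijective HA.T₂).comp (leg12_bijective α.twistEquiv.symm)))))

theorem canonicalMap₁_bijective : Function.Bijective (canonicalMap₁ α γ) :=
  (TensorProduct.congr (equiv α) (equiv α)).bijective.comp ((smashT₁_bijective α γ).comp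
    (TensorProduct.congr (equiv α).symm (equiv α).symm).bijective)

theorem canonicalMap₂_bijective : Function.Bijective (canonicalMap₂ α γ) :=
  (TensorProduct.congr (equiv α) (equiv α)).bijective.comp ((smashT₂_bijective α γ).comp
    (TensorProduct.congr (equiv α).symm (equiv α).symm).bijective)

theorem canonicalMap₁_comp :
    canonicalMap₁ α γ ∘ₗ map (equiv α).toLinearMap (equiv α).toLinearMap =
      map (equiv α).toLinearMap (equiv α).toLinearMap ∘ₗ smashT₁ α γ :=
  TensorProduct.ext' fun _ _ => rfl

theorem canonicalMap₂_comp :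
    canonicalMap₂ α γ ∘ₗ map (equiv α).toLinearMap (equiv α).toLinearMap =
      map (equiv α).toLinearMap (equiv α).toLinearMap ∘ₗ smashT₂ α γ :=
  TensorProduct.ext' fun _ _ => rfl

end

end Bicross

end

theorem proposition4p2 {A B : Type*}
    [NonUnitalRing A] [Module ℂ A] [IsScalarTower ℂ A A] [SMulCommClass ℂ A A]
    [NonUnitalRing B] [Module ℂ B] [IsScalarTower ℂ B B] [SMulCommClass ℂ B B]
    (HA : RegularMultiplierHopfAlgebra A) (HB : RegularMultiplierHopfAlgebra B)
    (α : RightModuleAlgebra B HA) (γ : LeftComoduleCoalgebra HA HB) :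
    ∃ (R : (B ⊗[ℂ] A) ≃ₗ[ℂ] (A ⊗[ℂ] B)) (T : (A ⊗[ℂ] B) ≃ₗ[ℂ] (B ⊗[ℂ] A)),
      R.toLinearMap = α.twist ∧ T.toLinearMap = γ.T ∧
      (∃! Δ, IsSmashCoproduct α γ Δ) ∧
      ∀ Δ, IsSmashCoproduct α γ Δ →
        (∃! T₁, IsCanonicalMap₁ Δ T₁) ∧ (∃! T₂, IsCanonicalMap₂ Δ T₂) ∧
        ∀ T₁ T₂, IsCanonicalMap₁ Δ T₁ → IsCanonicalMap₂ Δ T₂ →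
          T₁ ∘ₗ TensorProduct.map (SmashProduct.equiv α).toLinearMap
              (SmashProduct.equiv α).toLinearMap =
            TensorProduct.map (SmashProduct.equiv α).toLinearMap
              (SmashProduct.equiv α).toLinearMap ∘ₗ
              leg12 T.symm.toLinearMap ∘ₗ leg23 HA.T₁.toLinearMap ∘ₗ leg12 T.toLinearMap ∘ₗ
                leg34 R.toLinearMap ∘ₗ leg23 HB.T₁.toLinearMap ∘ₗ
                  leg34 R.symm.toLinearMap ∧
          T₂ ∘ₗ TensorProduct.map (SmashProduct.equiv α).toLinearMap
              (SmashProduct.equiv α).toLinearMap =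
            TensorProduct.map (SmashProduct.equiv α).toLinearMap
              (SmashProduct.equiv α).toLinearMap ∘ₗ
              leg34 T.symm.toLinearMap ∘ₗ leg23 HB.T₂.toLinearMap ∘ₗ leg34 T.toLinearMap ∘ₗ
                leg12 R.toLinearMap ∘ₗ leg23 HA.T₂.toLinearMap ∘ₗ
                  leg12 R.symm.toLinearMap ∧
          Function.Bijective T₁ ∧ Function.Bijective T₂ := by
  refine ⟨α.twistEquiv, γ.cotwistEquiv, rfl, rfl, ?_⟩
  -- The coproduct is produced from the two formulas; that it equals `∑ (a₁ ⊗ 1) Γ(a₂) Δ_B(b)` is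
  -- deduced afterwards from its first canonical map.
  obtain ⟨Δ, h₁, h₂⟩ := (SmashProduct.nondegenerate α HB).exists_of_canonicalMaps
    (canonicalMap₁ α γ) (canonicalMap₂ α γ) (canonicalMap₂_mulRight α γ)
  have hΔ := isSmashCoproduct_of_isCanonicalMap₁ α γ h₁
  refine ⟨⟨Δ, hΔ, fun Δ' h => isSmashCoproduct_unique α γ h hΔ⟩, fun Δ' hΔ' => ?_⟩
  obtain rfl := isSmashCoproduct_unique α γ hΔ hΔ'
  have u₁ : ∀ T, IsCanonicalMap₁ Δ T → T = canonicalMap₁ α γ := fun T hT =>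
    (SmashProduct.nondegenerate α HB).canonicalMap₁_unique hT h₁
  have u₂ : ∀ T, IsCanonicalMap₂ Δ T → T = canonicalMap₂ α γ := fun T hT =>
    (SmashProduct.nondegenerate α HB).canonicalMap₂_unique hT h₂
  refine ⟨⟨_, h₁, u₁⟩, ⟨_, h₂, u₂⟩, fun T₁ T₂ hT₁ hT₂ => ?_⟩
  obtain rfl := u₁ T₁ hT₁
  obtain rfl := u₂ T₂ hT₂
  exact ⟨canonicalMap₁_comp α γ, canonicalMap₂_comp α γ, canonicalMap₁_bijective α γ,
    canonicalMap₂_bijective α γ⟩
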